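/- Let $h\ge 1$ and let $G$ be a QED Feynman graph with two external lepton lines, one external photon line and no lepton cycles: its vertices $0,1,\dots,2h$ lie on a lepton path with internal lepton lines $k=(k\to k+1)$, $0\le k<2h$; the external lepton enters at $0$ with momentum $p_1$ and leaves at $2h$ with momentum $p_2$; the external photon line ends at one vertex, where $q=p_2-p_1$ enters, and the remaining vertices are joined in pairs by $h$ internal photon lines. Let $E$ be the set of the $L=3h$ internal lines. A 1-tree is a spanning tree of $G$; a tree with cycle is a set of lines containing a cycle which becomes a 1-tree after deleting any line of this cycle. For $s\subseteq E$ let $\omega(s)=2\,\min_T|s\setminus T|-|s|+\tfrac12|\mathrm{Lept}(s)|$, where $T$ runs over the 1-trees and $\mathrm{Lept}(s)$ is the set of lepton lines in $s$. Assume $\omega(s)<0$ for every $s\subseteq E$, $s\ne\emptyset,E$ (no ultraviolet divergent subgraphs). Let $\gamma_\mu$ be complex $4\times4$ matrices with $\gamma_\mu\gamma_\nu+\gamma_\nu\gamma_\mu=2g_{\mu\nu}$, $g=\mathrm{diag}(1,-1,-1,-1)$; write $\hat p=p^\nu\gamma_\nu$, $\sigma_{\mu\nu}=\tfrac12(\gamma_\mu\gamma_\nu-\gamma_\nu\gamma_\mu)$,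 and let $m>0$ be the lepton mass. For $z\in(0,\infty)^E$ put $D(z)=\sum_T\prod_{l\notin T}z_l$ (sum over 1-trees); $Q_k(z)=\sum_{T\ni k}p[T]\prod_{l\notin T}z_l$ for a lepton line $k$, where $p[T]$ is the sum of the external momenta leaving the component of $T\setminus k$ to which $k$ is directed; and $B_{kk'}(z)=\sum_{T'}\pm\prod_{l\notin T'}z_l$, summed over the trees with cycle $T'$ having $k,k'$ on the cycle, with sign $+$ iff $k,k'$ have the same direction on the cycle. Let $W(z)$ be the electrical power absorbed in the circuit $G$ with resistances $z_l$ and external currents equal to the external momenta (a quadratic form in them), minus $m^2\sum_{l\in \mathrm{Lept}(E)}z_l$, taken at $q=0$ and $p_1=p_2=p$, $p^2=m^2$. For a set $P$ of disjoint unordered pairs of lepton lines let $K_P(z)=D(z)^{-2}\prod_{\{k,k'\}\in P}B_{kk'}(z)/D(z)$, and let $\Gamma^{P}_\mu(z;p_1,p_2)$ be the matrix product along the lepton path (beginning of the path rightmost) of the factors: $\gamma_\nu$ at each vertex, $\gamma_\nu$ at each lepton line belonging to a pair of $P$, and $m+\hat Q_k(z)/D(z)$ at each other lepton line $k$; the indices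 are contracted by the metric along the internal photon lines and along the pairs of $P$, and the index at the external photon vertex is the free index $\mu$. For a vertex function $\Gamma_\mu(p_1,p_2)$ let $\mathcal A\Gamma=\lim_{q^2\to0}g(q^2)$, where $g$ is given by the form factor decomposition $$\overline\psi_2\Gamma_\mu\psi_1=\overline\psi_2\Big(f(q^2)\gamma_\mu-\tfrac1{2m}g(q^2)\sigma_{\mu\nu}q^\nu+h(q^2)q_\mu\Big)\psi_1\quad\text{for all }\psi_1,\overline\psi_2\text{ with }(\hat p_1-m)\psi_1=0=\overline\psi_2(\hat p_2-m).$$ Let $\kappa_P$ be arbitrary complex numbers (the numerical coefficients of the terms belonging to $P$), and define the Feynman parametric integrand of the contribution of $G$ to the lepton anomalous magnetic moment by $$I'(z)=\sum_P\kappa_P\,\frac{K_P(z)\,\mathcal A\big[\Gamma^P(z)\big]}{W(z)^{\,h-|P|}} .$$ Then: (i) For all $z\in(0,\infty)^E$ the integrand is well defined: $D(z)\neq0$, $W(z)\ne0$, and $\mathcal A[\Gamma^P(z)]$ exists and is unique for every $P$. (ii) There is a constant $C$, depending only on the graph $G$, the coefficients $\kappa_P$ and the chosen matrices $\gamma_\mu$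 (and not on $m$ or $z$), such that for all $z$ with $z_l>0$ and $\sum_l z_l=1$ $$|I'(z)|\le C\,\frac{\big(\min_l z_l\big)^{1/2}}{\prod_{l\in E}z_l}.$$ (iii) The Feynman parametric integral $\int_{z_l>0}I'(z)\,\delta\big(\sum_l z_l-1\big)\,\prod_l dz_l$ converges absolutely: for each line $e\in E$, after eliminating $z_e=1-\sum_{l\ne e}z_l$, the function $I'$ is Lebesgue integrable over $\{z_l>0\ (l\neq e),\ \sum_{l\ne e}z_l<1\}$. -/

import Mathlib

open scoped BigOperators Matrix Topology
open MeasureTheory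

noncomputable section

namespace QED

/-- Four-vectors, given by their contravariant components. -/
abbrev FourVector := Fin 4 → ℝ

/-- `4 × 4` complex matrices acting on spinors. -/
abbrev SpinorMatrix := Matrix (Fin 4) (Fin 4) ℂ

/-- The Minkowski metric with signature `(+,-,-,-)`; numerically `g_{μν} = g^{μν}`. -/
def metric (μ ν : Fin 4) : ℝ := if μ = ν then (if μ = 0 then 1 else -1) else 0

/-- The Minkowski product of four-vectors. -/
def mdot (p q : FourVector) : ℝ := ∑ μ, ∑ ν, metric μ ν * p μ * q ν

/-- The anticommutation relations of the Dirac matrices `γ_μ` (lower index). -/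
def IsDirac (γ : Fin 4 → SpinorMatrix) : Prop :=
  ∀ μ ν, γ μ * γ ν + γ ν * γ μ = ((2 * metric μ ν : ℝ) : ℂ) • (1 : SpinorMatrix)

/-- `p̂ = p^ν γ_ν`. -/
def slash (γ : Fin 4 → SpinorMatrix) (p : FourVector) : SpinorMatrix :=
  ∑ ν, ((p ν : ℝ) : ℂ) • γ ν

/-- `σ_{μν} = (γ_μ γ_ν - γ_ν γ_μ) / 2`. -/
def sigma (γ : Fin 4 → SpinorMatrix) (μ ν : Fin 4) : SpinorMatrix :=
  (1 / 2 : ℂ) • (γ μ * γ ν - γ ν * γ μ)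

/-- The combination `f γ_μ - g / (2m) σ_{μν} q^ν + h q_μ` of the three form factors. -/
def formFactorMatrix (m : ℝ) (γ : Fin 4 → SpinorMatrix) (f g h : ℂ) (q : FourVector)
    (μ : Fin 4) : SpinorMatrix :=
  f • γ μ - (g / (2 * (m : ℂ))) • (∑ ν, ((q ν : ℝ) : ℂ) • sigma γ μ ν)
    + (h * ((∑ ν, metric μ ν * q ν : ℝ) : ℂ)) • (1 : SpinorMatrix)

/-- `a` is the anomalous magnetic moment of the vertex function `Γ μ p₁ p₂`
(`p₁` the incoming, `p₂` the outgoing lepton momentum): between solutions of the Dirac equations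
`Γ` is expressed through form factors `f, g, h` of `q²`, where `q = p₂ - p₁`, and `g(q²) → a` as
`q² → 0`.  For real momenta on the mass shell the values of `q²` close to `0` are `≤ 0`. -/
def HasMagneticMoment (m : ℝ) (γ : Fin 4 → SpinorMatrix)
    (Γ : Fin 4 → FourVector → FourVector → SpinorMatrix) (a : ℂ) : Prop :=
  ∃ f g h : ℝ → ℂ,
    (∀ (p₁ p₂ : FourVector) (ψ₁ ψ₂ : Fin 4 → ℂ) (μ : Fin 4),
      (slash γ p₁ - (m : ℂ) • (1 : SpinorMatrix)) *ᵥ ψ₁ = 0 →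
      ψ₂ ᵥ* (slash γ p₂ - (m : ℂ) • (1 : SpinorMatrix)) = 0 →
      ψ₂ ⬝ᵥ (Γ μ p₁ p₂ *ᵥ ψ₁) =
        ψ₂ ⬝ᵥ (formFactorMatrix m γ
          (f (mdot (p₂ - p₁) (p₂ - p₁))) (g (mdot (p₂ - p₁) (p₂ - p₁)))
          (h (mdot (p₂ - p₁) (p₂ - p₁))) (p₂ - p₁) μ *ᵥ ψ₁)) ∧
    Filter.Tendsto g (𝓝[<] 0) (𝓝 a)

open Classical in
/-- The anomalous magnetic moment projector. -/
def magneticMoment (m : ℝ) (γ : Fin 4 → SpinorMatrix)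
    (Γ : Fin 4 → FourVector → FourVector → SpinorMatrix) : ℂ :=
  if H : ∃ a, HasMagneticMoment m γ Γ a then H.choose else 0

/-- A QED Feynman graph with two external lepton lines, one external photon line, `h` internal
photon lines and no lepton cycles.  Its vertices `0, 1, …, 2h` are numbered along the lepton path;
the external lepton lines enter at `0` and leave at `2h`, and the internal lepton line `k` goes from
`k` to `k + 1`.  Exactly one photon line ends at each vertex: the external one at `ext`, and the
internal photon line `i` joins `fst i` and `snd i`. -/
structure VertexGraph (h : ℕ) where
  ext : Fin (2 * h + 1)
  fst : Fin h → Fin (2 * h + 1)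
  snd : Fin h → Fin (2 * h + 1)
  bij : Function.Bijective (Sum.elim (fun _ : Unit => ext) (Sum.elim fst snd))

/-- The internal lines: `Sum.inl` for lepton lines, `Sum.inr` for photon lines. -/
abbrev Line (h : ℕ) := Fin (2 * h) ⊕ Fin h

namespace VertexGraph

variable {h : ℕ}

/-- The start of a line (for photon lines the direction is immaterial). -/
def tail (G : VertexGraph h) : Line h → Fin (2 * h + 1) :=
  Sum.elim (fun k => k.castSucc) G.fst

/-- The end of a line. -/
def head (G : VertexGraph h) : Line h → Fin (2 * h + 1) :=
  Sum.elim (fun k => k.succ) G.snd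

/-- There is a path in `s` between `u` and `v`. -/
def Joined (G : VertexGraph h) (s : Finset (Line h)) (u v : Fin (2 * h + 1)) : Prop :=
  Relation.EqvGen (fun a b => ∃ l ∈ s, G.tail l = a ∧ G.head l = b) u v

/-- `s` has no cycles: no line of `s` has its ends joined by the rest of `s`. -/
def Acyclic (G : VertexGraph h) (s : Finset (Line h)) : Prop :=
  ∀ l ∈ s, ¬ G.Joined (s.erase l) (G.tail l) (G.head l)

/-- A spanning tree. -/
def IsOneTree (G : VertexGraph h) (s : Finset (Line h)) : Prop :=
  (∀ u v, G.Joined s u v) ∧ G.Acyclic s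

/-- The set of lines of a (simple) cycle: a minimal set that is not acyclic. -/
def IsCycle (G : VertexGraph h) (c : Finset (Line h)) : Prop :=
  ¬ G.Acyclic c ∧ ∀ l ∈ c, G.Acyclic (c.erase l)

/-- `s` is a tree with cycle, and `c` is its cycle. -/
def IsTreeWithCycle (G : VertexGraph h) (s c : Finset (Line h)) : Prop :=
  c ⊆ s ∧ G.IsCycle c ∧ ∀ l ∈ c, G.IsOneTree (s.erase l)

/-- The loop number of `s`: the minimum of `|s \ T|` over the 1-trees `T`. -/
def nloops (G : VertexGraph h) (s : Finset (Line h)) : ℕ :=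
  sInf {n | ∃ T, G.IsOneTree T ∧ (s \ T).card = n}

/-- The number of lepton lines in `s`. -/
def leptonCard (s : Finset (Line h)) : ℕ := (s.filter (fun l => l.isLeft = true)).card

/-- The ultraviolet degree of divergence. -/
def omega (G : VertexGraph h) (s : Finset (Line h)) : ℝ :=
  2 * (G.nloops s : ℝ) - (s.card : ℝ) + (1 / 2) * (leptonCard s : ℝ)

/-- No ultraviolet divergences in proper subgraphs. -/
def NoUVDivergentSubgraphs (G : VertexGraph h) : Prop :=
  ∀ s : Finset (Line h), s ≠ ∅ → s ≠ Finset.univ → G.omega s < 0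

/-- The external momentum leaving the graph at the vertex `v`: the lepton enters at `0` with `p₁` and
leaves at `2h` with `p₂`, the external photon enters at `ext` with `p₂ - p₁`. -/
def outMomentum (G : VertexGraph h) (p₁ p₂ : FourVector) (v : Fin (2 * h + 1)) : FourVector :=
  (if v = Fin.last (2 * h) then p₂ else 0) - (if v = 0 then p₁ else 0)
    - (if v = G.ext then p₂ - p₁ else 0)

open Classical in
/-- `D(z)`, the sum over the 1-trees `T` of the product of `z_l` over the lines not in `T`. -/
def D (G : VertexGraph h) (z : Line h → ℝ) : ℝ :=
  ∑ T ∈ Finset.univ.filter (fun T : Finset (Line h) => G.IsOneTree T), ∏ l ∈ Tᶜ, z l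

open Classical in
/-- `B_{k k'}(z)` for lepton lines `k, k'`: the signed sum over the trees with cycle that have both
lines on the cycle.  The lines have the same direction on the cycle iff, after their removal, the end
of `k` is still joined to the start of `k'`. -/
def B (G : VertexGraph h) (k k' : Fin (2 * h)) (z : Line h → ℝ) : ℝ :=
  ∑ T ∈ Finset.univ.filter (fun T : Finset (Line h) =>
      ∃ c, G.IsTreeWithCycle T c ∧ Sum.inl k ∈ c ∧ Sum.inl k' ∈ c),
    (if G.Joined ((T.erase (Sum.inl k)).erase (Sum.inl k'))
        (G.head (Sum.inl k)) (G.tail (Sum.inl k')) then 1 else -1) * ∏ l ∈ Tᶜ, z l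

open Classical in
/-- The momentum that passes through the lepton line `k` in the 1-tree `T`: the sum of the external
momenta leaving the component of `T \ k` to which `k` is directed. -/
def treeMomentum (G : VertexGraph h) (k : Fin (2 * h)) (T : Finset (Line h))
    (p₁ p₂ : FourVector) : FourVector :=
  ∑ v ∈ Finset.univ.filter (fun v => G.Joined (T.erase (Sum.inl k)) (G.head (Sum.inl k)) v),
    G.outMomentum p₁ p₂ v

open Classical in
/-- `Q_k(z)` for a lepton line `k`. -/
def Q (G : VertexGraph h) (k : Fin (2 * h)) (z : Line h → ℝ) (p₁ p₂ : FourVector) : FourVector :=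
  ∑ T ∈ Finset.univ.filter (fun T : Finset (Line h) => G.IsOneTree T ∧ Sum.inl k ∈ T),
    (∏ l ∈ Tᶜ, z l) • G.treeMomentum k T p₁ p₂

/-- Kirchhoff's laws: `φ` is the potential in the circuit with resistances `z` when the current `J v`
is drawn out at each vertex `v`. -/
def IsPotential (G : VertexGraph h) (z : Line h → ℝ) (J φ : Fin (2 * h + 1) → ℝ) : Prop :=
  ∀ v, ∑ l, ((if G.head l = v then (φ (G.tail l) - φ (G.head l)) / z l else 0)
    - (if G.tail l = v then (φ (G.tail l) - φ (G.head l)) / z l else 0)) = J v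

open Classical in
/-- The electrical power absorbed within the circuit with resistances `z` and external currents
`J`. -/
def circuitPower (G : VertexGraph h) (z : Line h → ℝ) (J : Fin (2 * h + 1) → ℝ) : ℝ :=
  if H : ∃ φ, G.IsPotential z J φ then
    ∑ l, (H.choose (G.tail l) - H.choose (G.head l)) ^ 2 / z l
  else 0

/-- `W(z, p, q, 0)`: the power, as a quadratic form in the external currents, with the external
momenta substituted, minus `∑ z_l m²` over the lepton lines. -/
def Wfull (G : VertexGraph h) (m : ℝ) (z : Line h → ℝ) (p₁ p₂ : FourVector) : ℝ :=
  (∑ μ, metric μ μ * G.circuitPower z (fun v => G.outMomentum p₁ p₂ v μ))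
    - ∑ k : Fin (2 * h), z (Sum.inl k) * m ^ 2

/-- `W(z)`: the value of `W(z, p, q, 0)` at `p² = m²`, `q = 0`, taken in the rest frame
`p = (m, 0, 0, 0)`. -/
def W (G : VertexGraph h) (m : ℝ) (z : Line h → ℝ) : ℝ :=
  G.Wfull m z ![m, 0, 0, 0] ![m, 0, 0, 0]

/-- A set of disjoint unordered pairs of internal lepton lines; a pair `{k, k'}` with `k < k'` is
written `(k, k')`. -/
def IsPairing (P : Finset (Fin (2 * h) × Fin (2 * h))) : Prop :=
  (∀ a ∈ P, a.1 < a.2) ∧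
    ∀ a ∈ P, ∀ b ∈ P, a ≠ b → a.1 ≠ b.1 ∧ a.1 ≠ b.2 ∧ a.2 ≠ b.1 ∧ a.2 ≠ b.2

/-- The lepton line `k` belongs to some pair of `P`. -/
def IsPaired (P : Finset (Fin (2 * h) × Fin (2 * h))) (k : Fin (2 * h)) : Prop :=
  ∃ a ∈ P, k = a.1 ∨ k = a.2

/-- The global multiplier `D⁻² ∏ B_{k k'} / D` of the terms belonging to `P`. -/
def K (G : VertexGraph h) (P : Finset (Fin (2 * h) × Fin (2 * h))) (z : Line h → ℝ) : ℝ :=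
  1 / G.D z ^ 2 * ∏ a ∈ P, (G.B a.1 a.2 z / G.D z)

open Classical in
/-- The multiplier of the lepton line `k`: `γ_ν` for a paired line, `m + Q̂_k / D` otherwise. -/
def lineFactor (G : VertexGraph h) (m : ℝ) (γ : Fin 4 → SpinorMatrix)
    (P : Finset (Fin (2 * h) × Fin (2 * h))) (z : Line h → ℝ) (p₁ p₂ : FourVector)
    (b : Fin (2 * h) → Fin 4) (k : Fin (2 * h)) : SpinorMatrix :=
  if IsPaired P k then γ (b k)
  else (m : ℂ) • (1 : SpinorMatrix) + slash γ ((G.D z)⁻¹ • G.Q k z p₁ p₂)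

open Classical in
/-- The tensor part of the terms belonging to `P`.  The multipliers are multiplied along the lepton
path, the beginning of the path standing rightmost.  `a` runs over the tensor indices at the
vertices (the one at `ext` is the free index `μ`), contracted along the photon lines; `b` runs over
the tensor indices at the paired lepton lines (fixed to `0` at the other lines, where it is not
used), contracted along the pairs. -/
def amplitude (G : VertexGraph h) (m : ℝ) (γ : Fin 4 → SpinorMatrix)
    (P : Finset (Fin (2 * h) × Fin (2 * h))) (z : Line h → ℝ)
    (μ : Fin 4) (p₁ p₂ : FourVector) : SpinorMatrix :=
  ∑ a ∈ Finset.univ.filter (fun a : Fin (2 * h + 1) → Fin 4 => a G.ext = μ),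
    ∑ b ∈ Finset.univ.filter (fun b : Fin (2 * h) → Fin 4 => ∀ k, ¬ IsPaired P k → b k = 0),
      (((∏ i, metric (a (G.fst i)) (a (G.snd i))) * ∏ c ∈ P, metric (b c.1) (b c.2) : ℝ) : ℂ) •
        (((List.finRange (2 * h)).reverse.map
            (fun k => γ (a k.succ) * G.lineFactor m γ P z p₁ p₂ b k)).prod * γ (a 0))

open Classical in
/-- The Feynman parametric integrand `I'(z)`.  The terms belonging to `P` are homogeneous of degree
`u = -2h - |P|`, so that the power of `W` is `L + u = h - |P|`.  `κ P` is the numerical coefficient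
of the terms belonging to `P`. -/
def integrand (G : VertexGraph h) (m : ℝ) (γ : Fin 4 → SpinorMatrix)
    (κ : Finset (Fin (2 * h) × Fin (2 * h)) → ℂ) (z : Line h → ℝ) : ℂ :=
  ∑ P ∈ Finset.univ.filter (fun P : Finset (Fin (2 * h) × Fin (2 * h)) => IsPairing P),
    κ P * (G.K P z : ℂ) * magneticMoment m γ (G.amplitude m γ P z)
      / (G.W m z : ℂ) ^ (h - P.card)

end VertexGraph

/-- The point of the hyperplane `∑ z_l = 1` whose coordinates other than `z_e` are `x`. -/
def simplexPoint {h : ℕ} (e : Line h) (x : {l : Line h // l ≠ e} → ℝ) : Line h → ℝ :=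
  fun l => if hl : l = e then 1 - ∑ j, x j else x ⟨l, hl⟩

end QED

end

/-! Write `W = -m² w`. Here `w` (`excessPower`) is the power dissipated by the unit current kept on
the lepton path, minus the power of the true circuit current. By Thomson's principle `w` is the
dissipation of the difference of these two flows (`excessPower_eq_sum_sq`). Cauchy–Schwarz against
the loop formed by a photon line `i` and the lepton lines under it gives `z_k² ≤ (z_k + z_i) w` for
every lepton line `k` under `i`. Hence `w > 0`, and there is a scale `v ≤ 2w` such that `z_k ≤ v` or
`z_k² ≤ v z_i` whenever `i` passes over `k` (`exists_scale`).

In the numerator, deleting a cycle line maps trees with cycle to 1-trees, so `|B / D| ≤ (z_k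
z_k')^(-1/2)`, while `D` is at least the monomial of any one tree. The coefficients of `p₁`, `p₂` in
`Q_k / D` are at most 1. Anticommutation and the Dirac equations reduce every contracted word of
gamma matrices to `γ_μ` and the two momenta (`IsDirac.reduces`). So the magnetic moment exists and
is a C¹ function of these coefficients, and traces in the Breit frame show that it is unique. A
further gain is needed for `P = ∅`: if all photon parameters are much larger than the lepton ones,
the momenta run along the lepton path, and there the Dirac equation collapses the amplitude to a
multiple of `γ_μ`, whose moment is zero (`hasMagneticMoment_pathCoeff`). The mean value inequality
turns this into a small factor.

In the variables `x = log z` the claim is then a piecewise linear inequality (`level_bound`). It is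
written as a weighted sum of total weight zero, which is nonpositive as soon as the weights below
every level add up to something nonnegative. Below the level `log v` this is the ultraviolet
condition for the set of lines below the level; as `2ω` is an integer, it even leaves the margin
`1/2` that becomes the square root of the smallest parameter. Above `log v` it is the ultraviolet
condition for the complement of a set `K` of lepton lines and of the photon lines `c` over them, in
the form `|K| + 1 ≤ 2|c|` (`card_lt_two_mul_crossing`). The condition says nothing when `K` consists
of all lepton lines, and exactly there the vanishing of the moment helps.

Finally, the square root of the minimum is spread evenly over the `n = 3h` lines. This bounds the
integrand by products of the integrable functions `z_l ^ (1/(2n) - 1)` over all lines but one. -/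

namespace QED
-- Spanning trees as bases of boundary vectors, and the ultraviolet condition
namespace VertexGraph

variable {h : ℕ}

/-- The boundary of a line, as a vector indexed by the vertices. -/
def boundary (G : VertexGraph h) (l : Line h) : Fin (2 * h + 1) → ℝ :=
  Pi.single (G.head l) 1 - Pi.single (G.tail l) 1

/-- The span of the boundaries of the lines in `s`. -/
def boundarySpan (G : VertexGraph h) (s : Finset (Line h)) :
    Submodule ℝ (Fin (2 * h + 1) → ℝ) :=
  Submodule.span ℝ (G.boundary '' (s : Set (Line h)))

theorem boundarySpan_mono (G : VertexGraph h) {s t : Finset (Line h)} (hst : s ⊆ t) :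
    G.boundarySpan s ≤ G.boundarySpan t :=
  Submodule.span_mono (Set.image_mono (by exact_mod_cast hst))

theorem boundary_mem_boundarySpan (G : VertexGraph h) {s : Finset (Line h)} {l : Line h}
    (hl : l ∈ s) : G.boundary l ∈ G.boundarySpan s :=
  Submodule.subset_span ⟨l, by exact_mod_cast hl, rfl⟩

theorem Joined.symm {G : VertexGraph h} {s : Finset (Line h)} {u v : Fin (2 * h + 1)}
    (H : G.Joined s u v) : G.Joined s v u := Relation.EqvGen.symm _ _ H

theorem Joined.trans {G : VertexGraph h} {s : Finset (Line h)} {u v w : Fin (2 * h + 1)}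
    (H : G.Joined s u v) (H' : G.Joined s v w) : G.Joined s u w :=
  Relation.EqvGen.trans _ _ _ H H'

theorem Joined.of_mem {G : VertexGraph h} {s : Finset (Line h)} {l : Line h} (hl : l ∈ s) :
    G.Joined s (G.tail l) (G.head l) := Relation.EqvGen.rel _ _ ⟨l, hl, rfl, rfl⟩

theorem dotProduct_boundary (G : VertexGraph h) (f : Fin (2 * h + 1) → ℝ) (l : Line h) :
    f ⬝ᵥ G.boundary l = f (G.head l) - f (G.tail l) := by
  simp [boundary, dotProduct_sub]

/-- Turns connectivity into linear algebra, so that exchange arguments become statements about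
spans. If `v` is not reachable from `u`, the indicator of the component of `u` annihilates every
boundary in `s`, but not the difference at `v` and `u`. -/
theorem joined_iff_mem_boundarySpan (G : VertexGraph h) (s : Finset (Line h))
    (u v : Fin (2 * h + 1)) :
    G.Joined s u v ↔ (Pi.single v 1 - Pi.single u 1 : Fin (2 * h + 1) → ℝ) ∈ G.boundarySpan s := by
  classical
  constructor
  · intro H
    induction H with
    | rel a b hab =>
      obtain ⟨l, hl, rfl, rfl⟩ := hab
      exact G.boundary_mem_boundarySpan hl
    | refl a => simp
    | symm a b _ ih => simpa using Submodule.neg_mem _ ih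
    | trans a b c _ _ ih1 ih2 => simpa using Submodule.add_mem _ ih1 ih2
  · intro H
    by_contra hJ
    let f : Fin (2 * h + 1) → ℝ := fun w => if G.Joined s u w then 1 else 0
    have key : ∀ x ∈ G.boundarySpan s, f ⬝ᵥ x = 0 := by
      intro x hx
      refine Submodule.span_induction ?_ ?_ ?_ ?_ hx
      · rintro _ ⟨l, hl, rfl⟩
        rw [dotProduct_boundary]
        have hl' : l ∈ s := by exact_mod_cast hl
        have : G.Joined s u (G.head l) ↔ G.Joined s u (G.tail l) :=
          ⟨fun H => H.trans (Joined.of_mem hl').symm, fun H => H.trans (Joined.of_mem hl')⟩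
        simp [f, this]
      · simp
      · intro x y _ _ hx hy
        simp [dotProduct_add, hx, hy]
      · intro a x _ hx
        simp [dotProduct_smul, hx]
    have := key _ H
    have hu : G.Joined s u u := Relation.EqvGen.refl _
    simp [dotProduct_sub, f, hJ, hu] at this

/-- Parallel lines have equal or opposite boundaries; they are rejected on the right as well,
because independence is that of the family and not of its range. -/
theorem acyclic_iff_linearIndepOn (G : VertexGraph h) (s : Finset (Line h)) :
    G.Acyclic s ↔ LinearIndepOn ℝ G.boundary (s : Set (Line h)) := by
  rw [linearIndepOn_iff_notMem_span]
  simp only [Acyclic, joined_iff_mem_boundarySpan, boundarySpan, Finset.coe_erase, Finset.mem_coe]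
  rfl

theorem finrank_boundarySpan_le (G : VertexGraph h) (s : Finset (Line h)) :
    Module.finrank ℝ (G.boundarySpan s) ≤ s.card := by
  classical
  have h1 := finrank_span_finset_le_card (R := ℝ) (s.image G.boundary)
  rw [Finset.coe_image] at h1
  exact h1.trans Finset.card_image_le

theorem Acyclic.finrank_boundarySpan {G : VertexGraph h} {s : Finset (Line h)}
    (hs : G.Acyclic s) : Module.finrank ℝ (G.boundarySpan s) = s.card := by
  rw [acyclic_iff_linearIndepOn] at hs
  have := finrank_span_eq_card (R := ℝ) (b := fun x : (s : Set (Line h)) => G.boundary x) hs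
  rw [boundarySpan, Set.image_eq_range]
  simpa using this

/-- A forest whose lines have their ends joined by `t` has at most as many lines as `t`. -/
theorem Acyclic.card_le {G : VertexGraph h} {s t : Finset (Line h)} (hs : G.Acyclic s)
    (hst : ∀ l ∈ s, G.boundary l ∈ G.boundarySpan t) : s.card ≤ t.card := by
  rw [← hs.finrank_boundarySpan]
  refine le_trans (Submodule.finrank_mono ?_) (G.finrank_boundarySpan_le t)
  rw [boundarySpan, Submodule.span_le]
  rintro _ ⟨l, hl, rfl⟩
  exact hst l (by exact_mod_cast hl)

theorem Acyclic.mono {G : VertexGraph h} {s t : Finset (Line h)} (ht : G.Acyclic t)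
    (hst : s ⊆ t) : G.Acyclic s := by
  rw [acyclic_iff_linearIndepOn] at *
  exact ht.mono (by exact_mod_cast hst)

/-- The lepton lines form a spanning tree. -/
def leptonPath (h : ℕ) : Finset (Line h) := Finset.univ.filter (fun l => l.isLeft = true)

theorem inl_mem_leptonPath (k : Fin (2 * h)) : (Sum.inl k : Line h) ∈ leptonPath h := by
  simp [leptonPath]

theorem inr_notMem_leptonPath (i : Fin h) : (Sum.inr i : Line h) ∉ leptonPath h := by
  simp [leptonPath]

theorem leptonPath_eq_image (h : ℕ) :
    leptonPath h = Finset.univ.image (Sum.inl : Fin (2 * h) → Line h) := by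
  ext l; cases l <;> simp [leptonPath]

theorem card_leptonPath : (leptonPath h).card = 2 * h := by
  rw [leptonPath_eq_image, Finset.card_image_of_injective _ Sum.inl_injective]; simp

theorem leptonPath_joined (G : VertexGraph h) (u v : Fin (2 * h + 1)) :
    G.Joined (leptonPath h) u v := by
  have key : ∀ n (hn : n < 2 * h + 1), G.Joined (leptonPath h) 0 ⟨n, hn⟩ := by
    intro n
    induction n with
    | zero => intro hn; exact Relation.EqvGen.refl _
    | succ n ih =>
      intro hn
      exact (ih (by omega)).trans
        (Joined.of_mem (G := G) (inl_mem_leptonPath (⟨n, by omega⟩ : Fin (2 * h))))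
  exact (key u u.2).symm.trans (key v v.2)

/-- The cut between the vertices `k` and `k + 1` is crossed by no lepton line except `k`, so its
indicator annihilates all the other boundaries. -/
theorem leptonPath_acyclic (G : VertexGraph h) : G.Acyclic (leptonPath h) := by
  classical
  rw [acyclic_iff_linearIndepOn, linearIndepOn_iff_notMem_span]
  rintro l hl H
  obtain ⟨k, rfl⟩ : ∃ k, l = Sum.inl k := by
    cases l with
    | inl k => exact ⟨k, rfl⟩
    | inr i => exact absurd (by exact_mod_cast hl) (inr_notMem_leptonPath i)
  let f : Fin (2 * h + 1) → ℝ := fun w => if w.val ≤ k.val then 1 else 0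
  have key : ∀ x ∈ Submodule.span ℝ (G.boundary '' ((leptonPath h : Set (Line h)) \ {Sum.inl k})),
      f ⬝ᵥ x = 0 := by
    intro x hx
    refine Submodule.span_induction ?_ ?_ ?_ ?_ hx
    · rintro _ ⟨l, ⟨hl, hlk⟩, rfl⟩
      rw [dotProduct_boundary]
      cases l with
      | inl j =>
        have hjk : j.val ≠ k.val := fun e => hlk (by simp [Fin.ext_iff, e])
        have : (j.val + 1 ≤ k.val) ↔ j.val ≤ k.val := by omega
        simp [f, head, tail, this]
      | inr i => exact absurd (by exact_mod_cast hl) (inr_notMem_leptonPath i)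
    · simp
    · intro x y _ _ hx hy
      simp [dotProduct_add, hx, hy]
    · intro a x _ hx
      simp [dotProduct_smul, hx]
  have := key _ H
  rw [dotProduct_boundary] at this
  simp [f, head, tail] at this

theorem leptonPath_isOneTree (G : VertexGraph h) : G.IsOneTree (leptonPath h) :=
  ⟨G.leptonPath_joined, G.leptonPath_acyclic⟩

theorem boundary_mem_boundarySpan_leptonPath (G : VertexGraph h) (l : Line h) :
    G.boundary l ∈ G.boundarySpan (leptonPath h) :=
  (G.joined_iff_mem_boundarySpan _ _ _).1 (G.leptonPath_joined _ _)

/-- The lepton path fixes the rank: its `2h` boundaries form a basis of the span of all boundaries,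
so a forest of that size spans for dimension reasons. -/
theorem isOneTree_iff (G : VertexGraph h) (T : Finset (Line h)) :
    G.IsOneTree T ↔ G.Acyclic T ∧ T.card = 2 * h := by
  constructor
  · rintro ⟨h1, h2⟩
    refine ⟨h2, le_antisymm ?_ ?_⟩
    · rw [← card_leptonPath (h := h)]
      exact h2.card_le fun l _ => G.boundary_mem_boundarySpan_leptonPath l
    · rw [← card_leptonPath (h := h)]
      exact G.leptonPath_acyclic.card_le fun l _ =>
        (G.joined_iff_mem_boundarySpan _ _ _).1 (h1 _ _)
  · rintro ⟨h1, h2⟩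
    refine ⟨fun u v => ?_, h1⟩
    have hle : G.boundarySpan T ≤ G.boundarySpan (leptonPath h) := by
      rw [boundarySpan, Submodule.span_le]
      rintro _ ⟨l, _, rfl⟩
      exact G.boundary_mem_boundarySpan_leptonPath l
    have heq := Submodule.eq_of_le_of_finrank_le hle (by
      rw [h1.finrank_boundarySpan, h2, G.leptonPath_acyclic.finrank_boundarySpan, card_leptonPath])
    rw [joined_iff_mem_boundarySpan, heq, ← joined_iff_mem_boundarySpan]
    exact G.leptonPath_joined u v

theorem IsOneTree.card_eq {G : VertexGraph h} {T : Finset (Line h)} (hT : G.IsOneTree T) :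
    T.card = 2 * h := ((G.isOneTree_iff T).1 hT).2

theorem IsOneTree.boundary_mem {G : VertexGraph h} {T : Finset (Line h)} (hT : G.IsOneTree T)
    (l : Line h) : G.boundary l ∈ G.boundarySpan T :=
  (G.joined_iff_mem_boundarySpan _ _ _).1 (hT.1 _ _)

/-- Exchange: if `l'` is outside the tree `T` and is not spanned by the lines of `T` with the
property `p`, then `l'` can replace some line of `T` that does not have this property. -/
theorem IsOneTree.exchange {G : VertexGraph h} {T : Finset (Line h)} (hT : G.IsOneTree T)
    {l' : Line h} (hl' : l' ∉ T) (p : Line h → Prop) [DecidablePred p]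
    (hp : G.boundary l' ∉ G.boundarySpan (T.filter p)) :
    ∃ l ∈ T, ¬ p l ∧ G.IsOneTree (insert l' (T.erase l)) := by
  classical
  -- A smallest subset `R` of `T` that spans `l'` is the path of `T` between the ends of `l'`. It
  -- contains a line without the property `p`, and by minimality any line of `R` may be replaced by
  -- `l'`.
  have hex : ∃ n, ∃ R ⊆ T, G.boundary l' ∈ G.boundarySpan R ∧ R.card = n :=
    ⟨_, T, subset_rfl, hT.boundary_mem l', rfl⟩
  obtain ⟨R, hRT, hR, hcard⟩ := Nat.find_spec hex
  have hmin := fun m (hm : m < Nat.find hex) => Nat.find_min hex hm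
  have hnot : ¬ ∀ l ∈ R, p l := fun H => hp (G.boundarySpan_mono (fun l hl =>
    Finset.mem_filter.2 ⟨hRT hl, H l hl⟩) hR)
  push Not at hnot
  obtain ⟨l, hlR, hpl⟩ := hnot
  refine ⟨l, hRT hlR, hpl, ?_⟩
  have h1 : G.boundary l' ∉ G.boundarySpan (R.erase l) := fun H =>
    hmin (R.erase l).card (by rw [← hcard]; exact Finset.card_erase_lt_of_mem hlR)
      ⟨_, (Finset.erase_subset _ _).trans hRT, H, rfl⟩
  have h2 : G.boundary l' ∉ G.boundarySpan (T.erase l) := by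
    intro H
    have h3 : G.boundary l ∈ Submodule.span ℝ
        (insert (G.boundary l') (G.boundary '' ((R.erase l : Finset (Line h)) : Set (Line h)))) := by
      apply mem_span_insert_exchange _ h1
      rw [← Set.image_insert_eq, ← Finset.coe_insert, Finset.insert_erase hlR]
      exact hR
    have h4 : G.boundary l ∈ G.boundarySpan (T.erase l) := by
      refine (Submodule.span_le.2 ?_) h3
      rw [Set.insert_subset_iff]
      exact ⟨H, fun x hx => G.boundarySpan_mono (Finset.erase_subset_erase _ hRT)
        (Submodule.subset_span hx)⟩
    exact hT.2 l (hRT hlR) ((G.joined_iff_mem_boundarySpan _ _ _).2 h4)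
  have hmem : l' ∉ T.erase l := fun H => hl' (Finset.mem_of_mem_erase H)
  rw [isOneTree_iff]
  constructor
  · rw [acyclic_iff_linearIndepOn, Finset.coe_insert, linearIndepOn_insert (by exact_mod_cast hmem)]
    refine ⟨?_, h2⟩
    rw [← acyclic_iff_linearIndepOn]
    exact hT.2.mono (Finset.erase_subset _ _)
  · rw [Finset.card_insert_of_notMem hmem, Finset.card_erase_of_mem (hRT hlR), hT.card_eq]
    have := Finset.card_pos.2 ⟨l, hRT hlR⟩
    rw [hT.card_eq] at this
    omega

/-- The photon line `i` passes over the lepton line `k`. -/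
def Crosses (G : VertexGraph h) (i : Fin h) (k : Fin (2 * h)) : Prop :=
  ((G.fst i).val ≤ k.val ∧ k.val < (G.snd i).val) ∨
    ((G.snd i).val ≤ k.val ∧ k.val < (G.fst i).val)

open Classical in
/-- The orientation of the lepton line `k` on the lepton path from `fst i` to `snd i`. -/
noncomputable def crossSign (G : VertexGraph h) (i : Fin h) (k : Fin (2 * h)) : ℝ :=
  (if (G.fst i).val ≤ k.val ∧ k.val < (G.snd i).val then 1 else 0)
    - (if (G.snd i).val ≤ k.val ∧ k.val < (G.fst i).val then 1 else 0)

theorem sum_range_telescope {h : ℕ} (f : Fin (2 * h + 1) → ℝ) {u v : Fin (2 * h + 1)}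
    (huv : u ≤ v) :
    ∑ k : Fin (2 * h), (if u.val ≤ k.val ∧ k.val < v.val then (1 : ℝ) else 0)
      * (f k.succ - f k.castSucc) = f v - f u := by
  let F : ℕ → ℝ := fun n => if hn : n < 2 * h + 1 then f ⟨n, hn⟩ else 0
  have h1 : ∀ k : Fin (2 * h), f k.succ - f k.castSucc = F (k.val + 1) - F k.val := by
    intro k
    have hk := k.2
    simp only [F]
    rw [dif_pos (by omega), dif_pos (by omega)]
    rfl
  simp_rw [h1]
  rw [Fin.sum_univ_eq_sum_range
    (fun n => (if u.val ≤ n ∧ n < v.val then (1 : ℝ) else 0) * (F (n + 1) - F n)) (2 * h)]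
  simp_rw [ite_mul, one_mul, zero_mul]
  rw [← Finset.sum_filter]
  have h2 : (Finset.range (2 * h)).filter (fun n => u.val ≤ n ∧ n < v.val)
      = Finset.Ico u.val v.val := by
    ext n
    have := v.2
    simp only [Finset.mem_filter, Finset.mem_range, Finset.mem_Ico]
    omega
  rw [h2, Finset.sum_Ico_sub F (by exact_mod_cast huv)]
  simp only [F, dif_pos u.2, dif_pos v.2]

/-- For `f` a coordinate function this expresses a photon boundary through the lepton boundaries
under it; for `f` a potential it is Kirchhoff's loop law for the photon line and the lepton lines
under it. -/
theorem sum_crossSign_mul (G : VertexGraph h) (i : Fin h) (f : Fin (2 * h + 1) → ℝ) :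
    ∑ k, G.crossSign i k * (f k.succ - f k.castSucc) = f (G.snd i) - f (G.fst i) := by
  rcases le_total (G.fst i) (G.snd i) with hle | hle
  · rw [← sum_range_telescope f hle]
    refine Finset.sum_congr rfl fun k _ => ?_
    have : ¬ ((G.snd i).val ≤ k.val ∧ k.val < (G.fst i).val) := by
      have : (G.fst i).val ≤ (G.snd i).val := hle
      omega
    simp [crossSign, this]
  · have := sum_range_telescope f hle
    rw [← neg_sub, ← this, ← Finset.sum_neg_distrib]
    refine Finset.sum_congr rfl fun k _ => ?_
    have : ¬ ((G.fst i).val ≤ k.val ∧ k.val < (G.snd i).val) := by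
      have : (G.snd i).val ≤ (G.fst i).val := hle
      omega
    simp [crossSign, this]

theorem crossSign_eq_zero (G : VertexGraph h) {i : Fin h} {k : Fin (2 * h)}
    (hk : ¬ G.Crosses i k) : G.crossSign i k = 0 := by
  simp only [Crosses, not_or] at hk
  simp [crossSign, hk.1, hk.2]

theorem boundary_inr (G : VertexGraph h) (i : Fin h) :
    G.boundary (Sum.inr i) = ∑ k, G.crossSign i k • G.boundary (Sum.inl k) := by
  ext v
  have := G.sum_crossSign_mul i (fun w => (Pi.single w (1 : ℝ) : Fin (2 * h + 1) → ℝ) v)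
  simp only [Finset.sum_apply, Pi.smul_apply, smul_eq_mul, boundary, Pi.sub_apply]
  exact this.symm

/-- The ends of a photon line are joined by the lepton lines under it. -/
theorem boundary_inr_mem (G : VertexGraph h) {i : Fin h} {s : Finset (Line h)}
    (hs : ∀ k, G.Crosses i k → Sum.inl k ∈ s) : G.boundary (Sum.inr i) ∈ G.boundarySpan s := by
  rw [boundary_inr]
  refine Submodule.sum_mem _ fun k _ => ?_
  by_cases hk : G.Crosses i k
  · exact Submodule.smul_mem _ _ (G.boundary_mem_boundarySpan (hs k hk))
  · simp [G.crossSign_eq_zero hk]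

theorem fst_ne_snd (G : VertexGraph h) (i : Fin h) : G.fst i ≠ G.snd i := by
  intro e
  have := G.bij.1 (a₁ := Sum.inr (Sum.inl i)) (a₂ := Sum.inr (Sum.inr i)) (by simpa using e)
  simp at this

theorem exists_crosses (G : VertexGraph h) (i : Fin h) : ∃ k, G.Crosses i k := by
  have hne : (G.fst i).val ≠ (G.snd i).val := fun e => G.fst_ne_snd i (Fin.ext e)
  have h1 := (G.fst i).2
  have h2 := (G.snd i).2
  rcases lt_or_gt_of_ne hne with hlt | hlt
  · exact ⟨⟨(G.fst i).val, by omega⟩, Or.inl ⟨le_rfl, hlt⟩⟩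
  · exact ⟨⟨(G.snd i).val, by omega⟩, Or.inr ⟨le_rfl, hlt⟩⟩

/-- A lepton line outside a tree can replace a photon line of the tree that passes over it. -/
theorem IsOneTree.exchange_lepton {G : VertexGraph h} {T : Finset (Line h)} (hT : G.IsOneTree T)
    {j : Fin (2 * h)} (hj : Sum.inl j ∉ T) :
    ∃ i, G.Crosses i j ∧ Sum.inr i ∈ T ∧ G.IsOneTree (insert (Sum.inl j) (T.erase (Sum.inr i))) := by
  classical
  -- The cut between `j` and `j + 1`. The path in `T` joining the ends of `j` has to cross it, and
  -- apart from `j` only the photon lines over `j` do so.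
  let f : Fin (2 * h + 1) → ℝ := fun w => if w.val ≤ j.val then 1 else 0
  obtain ⟨l, hlT, hpl, htree⟩ := hT.exchange hj (fun l => f (G.head l) = f (G.tail l)) (by
    intro H
    have key : ∀ x ∈ G.boundarySpan (T.filter (fun l => f (G.head l) = f (G.tail l))),
        f ⬝ᵥ x = 0 := by
      intro x hx
      refine Submodule.span_induction ?_ ?_ ?_ ?_ hx
      · rintro _ ⟨l, hl, rfl⟩
        rw [dotProduct_boundary, sub_eq_zero]
        exact (Finset.mem_filter.1 (Finset.mem_coe.1 hl)).2
      · simp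
      · intro x y _ _ hx hy
        simp [dotProduct_add, hx, hy]
      · intro a x _ hx
        simp [dotProduct_smul, hx]
    have := key _ H
    rw [dotProduct_boundary] at this
    simp [f, head, tail] at this)
  cases l with
  | inl k =>
    exfalso
    have hkj : k.val ≠ j.val := fun e => hj (by rwa [Fin.ext e] at hlT)
    have : (k.val + 1 ≤ j.val) ↔ k.val ≤ j.val := by omega
    simp [f, head, tail, this] at hpl
  | inr i =>
    refine ⟨i, ?_, hlT, htree⟩
    by_contra hc
    simp only [Crosses] at hc
    have : ((G.snd i).val ≤ j.val) ↔ (G.fst i).val ≤ j.val := by omega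
    simp [f, head, tail, this] at hpl

/-- Trees of minimal weight: at each level `t` the tree leaves out the smallest possible number of
lines below the level. -/
theorem exists_minimal_tree (G : VertexGraph h) (z : Line h → ℝ) :
    ∃ T, G.IsOneTree T ∧ ∀ t : ℝ, ∀ T', G.IsOneTree T' →
      ((Finset.univ.filter (fun l => z l < t)) \ T).card
        ≤ ((Finset.univ.filter (fun l => z l < t)) \ T').card := by
  classical
  -- A tree of least total `z` serves all levels at once, as in the greedy algorithm. If some `T'`
  -- contained more lines below `t`, one of these could be exchanged for a line of `T` at or above
  -- `t`, and the total would decrease.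
  obtain ⟨T, hT, hmin⟩ := Finset.exists_min_image
    (Finset.univ.filter (fun T : Finset (Line h) => G.IsOneTree T)) (fun T => ∑ l ∈ T, z l)
    ⟨leptonPath h, by simpa using G.leptonPath_isOneTree⟩
  simp only [Finset.mem_filter, Finset.mem_univ, true_and] at hT hmin
  refine ⟨T, hT, fun t T' hT' => ?_⟩
  set s := Finset.univ.filter (fun l => z l < t) with hs
  by_contra hlt
  push Not at hlt
  have e1 := Finset.card_sdiff_add_card_inter s T
  have e2 := Finset.card_sdiff_add_card_inter s T'
  have h1 : (s ∩ T).card < (s ∩ T').card := by omega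
  have h2 : ¬ ∀ l ∈ s ∩ T', G.boundary l ∈ G.boundarySpan (s ∩ T) := fun H =>
    absurd ((hT'.2.mono Finset.inter_subset_right).card_le H) (by omega)
  push Not at h2
  obtain ⟨l', hl', hspan⟩ := h2
  rw [Finset.mem_inter] at hl'
  have hl's : z l' < t := by simpa [hs] using hl'.1
  have hl'T : l' ∉ T := fun H => hspan
    (G.boundary_mem_boundarySpan (Finset.mem_inter.2 ⟨hl'.1, H⟩))
  obtain ⟨l, hlT, hpl, htree⟩ := hT.exchange hl'T (fun l => z l < t) (by
    have e : T.filter (fun l => z l < t) = s ∩ T := by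
      ext l; simp [hs, and_comm]
    rwa [e])
  have := hmin _ htree
  rw [Finset.sum_insert (fun H => hl'T (Finset.mem_of_mem_erase H)),
    ← Finset.add_sum_erase T z hlT] at this
  linarith [not_lt.1 hpl]

/-- In the absence of ultraviolet divergences, the photon lines over the lepton lines of `K` are
more than half as many as these. -/
theorem card_lt_two_mul_crossing (G : VertexGraph h) (hG : G.NoUVDivergentSubgraphs)
    (K : Finset (Fin (2 * h))) (hK : K.Nonempty) (hK' : K ≠ Finset.univ) (c : Finset (Fin h))
    (hc : ∀ i, i ∉ c → ∀ k ∈ K, ¬ G.Crosses i k) : K.card + 1 ≤ 2 * c.card := by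
  classical
  -- The ultraviolet condition is applied to what is left after removing `K` and `c`. This set has
  -- `3h - |K| - |c|` lines, `2h - |K|` of them leptons, and at least `h - |c|` loops, so that `ω <
  -- 0` becomes `|K| < 2|c|`.
  let s : Finset (Line h) := Kᶜ.disjSum cᶜ
  have hcard : s.card + K.card + c.card = 3 * h := by
    simp only [s, Finset.card_disjSum, Finset.card_compl, Fintype.card_fin]
    have h1 := Finset.card_le_univ K
    have h2 := Finset.card_le_univ c
    simp only [Fintype.card_fin] at h1 h2
    omega
  have hlep : leptonCard s + K.card = 2 * h := by
    have : s.filter (fun l => l.isLeft = true) = Kᶜ.image Sum.inl := by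
      ext l; cases l <;> simp [s]
    rw [leptonCard, this, Finset.card_image_of_injective _ Sum.inl_injective, Finset.card_compl,
      Fintype.card_fin]
    have h1 := Finset.card_le_univ K
    simp only [Fintype.card_fin] at h1
    omega
  have hne : s ≠ ∅ := by
    intro e
    obtain ⟨k, hk⟩ : ∃ k, k ∉ K := by
      by_contra H; push Not at H; exact hK' (Finset.eq_univ_iff_forall.2 H)
    have : (Sum.inl k : Line h) ∈ s := by simp [s, hk]
    rw [e] at this
    simp at this
  have hne' : s ≠ Finset.univ := by
    intro e
    obtain ⟨k, hk⟩ := hK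
    have : (Sum.inl k : Line h) ∈ s := by rw [e]; simp
    simp [s, hk] at this
  have hω := hG s hne hne'
  have hn : h ≤ G.nloops s + c.card := by
    have hne : {n | ∃ T, G.IsOneTree T ∧ (s \ T).card = n}.Nonempty :=
      ⟨_, leptonPath h, G.leptonPath_isOneTree, rfl⟩
    obtain ⟨T, hT, hTn⟩ := Nat.sInf_mem hne
    change (s \ T).card = G.nloops s at hTn
    -- A photon line outside `c` is spanned by lepton lines outside `K`, so a forest in `s` has at
    -- most `2h - |K|` lines.
    have h1 : (s ∩ T).card ≤ (Kᶜ.image (Sum.inl : Fin (2 * h) → Line h)).card := by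
      refine (hT.2.mono Finset.inter_subset_right).card_le fun l hl => ?_
      have hl := (Finset.mem_inter.1 hl).1
      cases l with
      | inl k =>
        exact G.boundary_mem_boundarySpan (Finset.mem_image.2 ⟨k, by simpa [s] using hl, rfl⟩)
      | inr i =>
        refine G.boundary_inr_mem fun k hk => Finset.mem_image.2 ⟨k, ?_, rfl⟩
        rw [Finset.mem_compl]
        exact fun hkK => hc i (by simpa [s] using hl) k hkK hk
    rw [Finset.card_image_of_injective _ Sum.inl_injective, Finset.card_compl,
      Fintype.card_fin] at h1
    have := Finset.card_sdiff_add_card_inter s T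
    have h2 := Finset.card_le_univ K
    simp only [Fintype.card_fin] at h2
    omega
  rw [omega] at hω
  have hn' : (h : ℝ) ≤ G.nloops s + c.card := by exact_mod_cast hn
  have hcard' : (s.card : ℝ) + K.card + c.card = 3 * h := by exact_mod_cast hcard
  have hlep' : (leptonCard s : ℝ) + K.card = 2 * h := by exact_mod_cast hlep
  have : (K.card : ℝ) < 2 * c.card := by linarith
  exact_mod_cast this

end VertexGraph
end QED

/-! ### Circuit power: Kirchhoff potentials and a lower bound for the denominator -/

namespace QED
namespace VertexGraph

variable {h : ℕ}

/-- Discrete integration by parts. The test function `ψ` will be the potential itself (energy),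
another potential (reciprocity) or the constant `1` (conservation of the current). -/
theorem sum_mul_netCurrent (G : VertexGraph h) (ψ : Fin (2 * h + 1) → ℝ) (c : Line h → ℝ) :
    ∑ v, ψ v * ∑ l, ((if G.head l = v then c l else 0) - (if G.tail l = v then c l else 0))
      = ∑ l, (ψ (G.head l) - ψ (G.tail l)) * c l := by
  simp_rw [Finset.mul_sum]
  rw [Finset.sum_comm]
  refine Finset.sum_congr rfl fun l _ => ?_
  simp [mul_sub, sub_mul, Finset.sum_sub_distrib]

theorem IsPotential.sum_mul {G : VertexGraph h} {z : Line h → ℝ} {J φ : Fin (2 * h + 1) → ℝ}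
    (H : G.IsPotential z J φ) (ψ : Fin (2 * h + 1) → ℝ) :
    ∑ v, ψ v * J v
      = ∑ l, (ψ (G.head l) - ψ (G.tail l)) * ((φ (G.tail l) - φ (G.head l)) / z l) := by
  rw [← G.sum_mul_netCurrent ψ (fun l => (φ (G.tail l) - φ (G.head l)) / z l)]
  exact Finset.sum_congr rfl fun v _ => by rw [H v]

theorem IsPotential.power_eq {G : VertexGraph h} {z : Line h → ℝ} {J φ : Fin (2 * h + 1) → ℝ}
    (H : G.IsPotential z J φ) :
    ∑ l, (φ (G.tail l) - φ (G.head l)) ^ 2 / z l = -∑ v, φ v * J v := by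
  rw [H.sum_mul φ, ← Finset.sum_neg_distrib]
  exact Finset.sum_congr rfl fun l _ => by ring

/-- The matrix of the circuit (potentials to currents drawn out), made invertible on constants. -/
noncomputable def groundedLaplacian (G : VertexGraph h) (z : Line h → ℝ) :
    Matrix (Fin (2 * h + 1)) (Fin (2 * h + 1)) ℝ :=
  -- The final `- 1` is a number subtracted from every entry, that is, the all-ones matrix and not
  -- the identity.
  Matrix.of fun v u => (∑ l, ((if G.head l = v then (1 : ℝ) else 0) - (if G.tail l = v then 1 else 0))
    * ((if G.tail l = u then (1 : ℝ) else 0) - (if G.head l = u then 1 else 0)) * (z l)⁻¹) - 1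

theorem groundedLaplacian_mulVec (G : VertexGraph h) (z : Line h → ℝ)
    (φ : Fin (2 * h + 1) → ℝ) (v : Fin (2 * h + 1)) :
    (G.groundedLaplacian z *ᵥ φ) v
      = (∑ l, ((if G.head l = v then (φ (G.tail l) - φ (G.head l)) / z l else 0)
        - (if G.tail l = v then (φ (G.tail l) - φ (G.head l)) / z l else 0))) - ∑ u, φ u := by
  simp only [Matrix.mulVec, dotProduct, groundedLaplacian, Matrix.of_apply]
  rw [Finset.sum_congr rfl fun u _ => sub_mul _ _ _, Finset.sum_sub_distrib]
  simp only [one_mul, Finset.sum_mul]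
  congr 1
  rw [Finset.sum_comm]
  refine Finset.sum_congr rfl fun l _ => ?_
  have : ∀ u, ((if G.head l = v then (1 : ℝ) else 0) - (if G.tail l = v then 1 else 0))
      * ((if G.tail l = u then (1 : ℝ) else 0) - (if G.head l = u then 1 else 0)) * (z l)⁻¹ * φ u
      = ((if G.head l = v then (1 : ℝ) else 0) - (if G.tail l = v then 1 else 0)) * (z l)⁻¹
        * ((if G.tail l = u then φ u else 0) - (if G.head l = u then φ u else 0)) := by
    intro u
    split_ifs <;> ring
  simp_rw [this]
  rw [← Finset.mul_sum, Finset.sum_sub_distrib]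
  simp only [Finset.sum_ite_eq, Finset.mem_univ, if_true]
  split_ifs <;> ring

theorem eq_of_forall_succ {h : ℕ} {φ : Fin (2 * h + 1) → ℝ}
    (H : ∀ k : Fin (2 * h), φ k.succ = φ k.castSucc) (v : Fin (2 * h + 1)) : φ v = φ 0 := by
  have := sum_range_telescope φ (Fin.zero_le v)
  simp_rw [H, sub_self, mul_zero, Finset.sum_const_zero] at this
  linarith

/-- Tested against `φ`, the matrix gives minus the dissipated power minus `(∑ φ)²`. Both vanish only
if `φ` is constant along the lepton path and has sum zero. -/
theorem isUnit_groundedLaplacian (G : VertexGraph h) {z : Line h → ℝ} (hz : ∀ l, 0 < z l) :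
    IsUnit (G.groundedLaplacian z) := by
  rw [← Matrix.mulVec_injective_iff_isUnit]
  refine (injective_iff_map_eq_zero (G.groundedLaplacian z).mulVecLin).2 fun φ H => ?_
  have hv : ∀ v, (G.groundedLaplacian z *ᵥ φ) v = 0 := fun v => congrFun H v
  have h1 : ∑ v, φ v * (G.groundedLaplacian z *ᵥ φ) v = 0 := by simp [hv]
  rw [Finset.sum_congr rfl fun v _ => by rw [groundedLaplacian_mulVec, mul_sub],
    Finset.sum_sub_distrib] at h1
  rw [G.sum_mul_netCurrent φ (fun l => (φ (G.tail l) - φ (G.head l)) / z l), ← Finset.sum_mul]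
    at h1
  have h2 : ∑ l, (φ (G.head l) - φ (G.tail l)) * ((φ (G.tail l) - φ (G.head l)) / z l)
      = -∑ l, (φ (G.head l) - φ (G.tail l)) ^ 2 / z l := by
    rw [← Finset.sum_neg_distrib]
    exact Finset.sum_congr rfl fun l _ => by ring
  have h3 : ∀ l ∈ Finset.univ, 0 ≤ (φ (G.head l) - φ (G.tail l)) ^ 2 / z l := fun l _ =>
    div_nonneg (sq_nonneg _) (hz l).le
  have h4 := Finset.sum_nonneg h3
  have h5 : ∑ l, (φ (G.head l) - φ (G.tail l)) ^ 2 / z l = 0 := by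
    nlinarith [mul_self_nonneg (∑ v, φ v)]
  have h6 : (∑ v, φ v) = 0 := by
    have : (∑ v, φ v) * ∑ v, φ v = 0 := by linarith
    exact mul_self_eq_zero.1 this
  have h7 := (Finset.sum_eq_zero_iff_of_nonneg h3).1 h5
  have h8 : ∀ v, φ v = φ 0 := eq_of_forall_succ fun k => by
    have := h7 (Sum.inl k) (Finset.mem_univ _)
    rw [div_eq_zero_iff, or_iff_left (hz _).ne', sq_eq_zero_iff, sub_eq_zero] at this
    exact this
  have h9 : φ 0 = 0 := by
    rw [Finset.sum_congr rfl fun v _ => h8 v] at h6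
    simp only [Finset.sum_const, Finset.card_univ, Fintype.card_fin, nsmul_eq_mul,
      mul_eq_zero] at h6
    rcases h6 with h6 | h6
    · norm_cast at h6
    · exact h6
  ext v
  rw [h8 v, h9]; rfl

/-- The unit current along the lepton path, as an external current. -/
def pathCurrent (h : ℕ) : Fin (2 * h + 1) → ℝ :=
  fun v => (if v = Fin.last (2 * h) then 1 else 0) - (if v = 0 then 1 else 0)

/-- The potential of the unit current along the lepton path. -/
noncomputable def pathPotential (G : VertexGraph h) (z : Line h → ℝ) : Fin (2 * h + 1) → ℝ :=
  (G.groundedLaplacian z)⁻¹ *ᵥ pathCurrent h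

theorem sum_pathCurrent_mul (φ : Fin (2 * h + 1) → ℝ) :
    ∑ v, φ v * pathCurrent h v = φ (Fin.last (2 * h)) - φ 0 := by
  simp [pathCurrent, mul_sub, Finset.sum_sub_distrib]

/-- In the sum of the grounded equations over all vertices the line currents cancel. Since
`pathCurrent` has total zero, so has the potential, and the grounding term disappears. -/
theorem isPotential_pathPotential (G : VertexGraph h) {z : Line h → ℝ} (hz : ∀ l, 0 < z l) :
    G.IsPotential z (pathCurrent h) (G.pathPotential z) := by
  have hdet := (Matrix.isUnit_iff_isUnit_det _).1 (G.isUnit_groundedLaplacian hz)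
  have h1 : G.groundedLaplacian z *ᵥ G.pathPotential z = pathCurrent h := by
    rw [pathPotential, Matrix.mulVec_mulVec, Matrix.mul_nonsing_inv _ hdet, Matrix.one_mulVec]
  have h2 : ∑ u, G.pathPotential z u = 0 := by
    have h3 : ∑ v, (1 : ℝ) * (G.groundedLaplacian z *ᵥ G.pathPotential z) v = 0 := by
      rw [h1, sum_pathCurrent_mul (fun _ => (1 : ℝ))]; simp
    rw [Finset.sum_congr rfl fun v _ => by rw [groundedLaplacian_mulVec, mul_sub],
      Finset.sum_sub_distrib] at h3
    rw [G.sum_mul_netCurrent (fun _ => (1 : ℝ))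
      (fun l => (G.pathPotential z (G.tail l) - G.pathPotential z (G.head l)) / z l)] at h3
    simp only [sub_self, zero_mul, Finset.sum_const_zero, one_mul, Finset.sum_const,
      Finset.card_univ, Fintype.card_fin, nsmul_eq_mul, zero_sub, neg_eq_zero, mul_eq_zero] at h3
    rcases h3 with h3 | h3
    · norm_cast at h3
    · exact h3
  intro v
  rw [← h1, groundedLaplacian_mulVec, h2, sub_zero]

/-- The power absorbed in the lepton lines carrying the whole current, in excess of the power
absorbed within the circuit. -/
noncomputable def excessPower (G : VertexGraph h) (z : Line h → ℝ) : ℝ :=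
  ∑ k : Fin (2 * h), z (Sum.inl k)
    - (G.pathPotential z 0 - G.pathPotential z (Fin.last (2 * h)))

theorem IsPotential.smul {G : VertexGraph h} {z : Line h → ℝ} {J φ : Fin (2 * h + 1) → ℝ}
    (H : G.IsPotential z J φ) (a : ℝ) :
    G.IsPotential z (fun v => a * J v) (fun v => a * φ v) := by
  intro v
  show _ = a * J v
  rw [← H v, Finset.mul_sum]
  refine Finset.sum_congr rfl fun l _ => ?_
  split_ifs <;> ring

/-- Reciprocity: each of the two powers equals the mixed sum of both potentials, which is symmetric.
The potential chosen in `circuitPower` is therefore immaterial. -/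
theorem IsPotential.power_unique {G : VertexGraph h} {z : Line h → ℝ}
    {J φ φ' : Fin (2 * h + 1) → ℝ} (H : G.IsPotential z J φ) (H' : G.IsPotential z J φ') :
    ∑ l, (φ (G.tail l) - φ (G.head l)) ^ 2 / z l
      = ∑ l, (φ' (G.tail l) - φ' (G.head l)) ^ 2 / z l := by
  rw [H.power_eq, H'.power_eq, H.sum_mul φ', H'.sum_mul φ]
  congr 1
  exact Finset.sum_congr rfl fun l _ => by ring

theorem IsPotential.circuitPower_eq {G : VertexGraph h} {z : Line h → ℝ}
    {J φ : Fin (2 * h + 1) → ℝ} (H : G.IsPotential z J φ) :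
    G.circuitPower z J = -∑ v, φ v * J v := by
  have hex : ∃ φ, G.IsPotential z J φ := ⟨φ, H⟩
  rw [circuitPower, dif_pos hex, ← H.power_eq]
  exact hex.choose_spec.power_unique H

theorem outMomentum_self (G : VertexGraph h) (p : FourVector) (v : Fin (2 * h + 1)) (μ : Fin 4) :
    G.outMomentum p p v μ = p μ * pathCurrent h v := by
  simp only [outMomentum, pathCurrent, sub_self, ite_self, Pi.sub_apply, Pi.zero_apply, sub_zero]
  split_ifs <;> simp

theorem circuitPower_outMomentum (G : VertexGraph h) {z : Line h → ℝ} (hz : ∀ l, 0 < z l)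
    (p : FourVector) (μ : Fin 4) :
    G.circuitPower z (fun v => G.outMomentum p p v μ)
      = p μ ^ 2 * (G.pathPotential z 0 - G.pathPotential z (Fin.last (2 * h))) := by
  simp_rw [outMomentum_self]
  rw [((G.isPotential_pathPotential hz).smul (p μ)).circuitPower_eq]
  have := sum_pathCurrent_mul (G.pathPotential z)
  calc -∑ v, p μ * G.pathPotential z v * (p μ * pathCurrent h v)
      = -(p μ ^ 2 * ∑ v, G.pathPotential z v * pathCurrent h v) := by
        rw [Finset.mul_sum]
        congr 1
        exact Finset.sum_congr rfl fun v _ => by ring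
    _ = _ := by rw [this]; ring

/-- At `q = 0` in the rest frame the external current is `m` times `pathCurrent`, in the time
component only. The power is thus `m²` times the effective resistance between the ends of the path.
-/
theorem W_eq (G : VertexGraph h) (m : ℝ) {z : Line h → ℝ} (hz : ∀ l, 0 < z l) :
    G.W m z = -(m ^ 2 * G.excessPower z) := by
  rw [W, Wfull]
  simp_rw [circuitPower_outMomentum G hz]
  rw [excessPower, ← Finset.sum_mul]
  simp [Fin.sum_univ_four, metric]
  ring

/-- Thomson's principle: the unit flow along the lepton path and the true current have the same
sources, so their difference is a circulation and is orthogonal to the true current in the energy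
product. -/
theorem excessPower_eq_sum_sq (G : VertexGraph h) {z : Line h → ℝ} (hz : ∀ l, 0 < z l) :
    G.excessPower z = ∑ l, z l * ((if l.isLeft = true then (1 : ℝ) else 0)
      - (G.pathPotential z (G.tail l) - G.pathPotential z (G.head l)) / z l) ^ 2 := by
  set φ := G.pathPotential z with hφ
  have h1 := (G.isPotential_pathPotential hz).power_eq
  rw [sum_pathCurrent_mul, ← hφ] at h1
  have h2 : ∀ l, z l * ((if l.isLeft = true then (1 : ℝ) else 0)
      - (φ (G.tail l) - φ (G.head l)) / z l) ^ 2
      = (if l.isLeft = true then z l - 2 * (φ (G.tail l) - φ (G.head l)) else 0)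
        + (φ (G.tail l) - φ (G.head l)) ^ 2 / z l := by
    intro l
    have := (hz l).ne'
    split_ifs
    · field_simp; ring
    · field_simp; ring
  simp_rw [h2, Finset.sum_add_distrib, h1]
  rw [Fintype.sum_sum_type]
  simp only [Sum.isLeft_inl, if_true, Sum.isLeft_inr, Bool.false_eq_true, if_false,
    Finset.sum_const_zero, add_zero, Finset.sum_sub_distrib, ← Finset.mul_sum]
  have h3 := sum_range_telescope φ (Fin.zero_le (Fin.last (2 * h)))
  have h4 : ∀ k : Fin (2 * h), (0 : Fin (2 * h + 1)).val ≤ k.val ∧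
    k.val < (Fin.last (2 * h)).val := fun k => ⟨Nat.zero_le _, k.2⟩
  simp only [h4, and_self, if_true, one_mul, Finset.sum_sub_distrib] at h3
  simp only [tail, head, Sum.elim_inl]
  rw [excessPower]
  linarith

theorem exists_crossSign_eq (G : VertexGraph h) (i : Fin h) : ∃ ε : ℝ, ε ^ 2 = 1 ∧
    ∀ k, (G.Crosses i k → G.crossSign i k = ε) ∧ (¬ G.Crosses i k → G.crossSign i k = 0) := by
  rcases le_total (G.fst i).val (G.snd i).val with hle | hle
  · refine ⟨1, by norm_num, fun k => ⟨fun hk => ?_, G.crossSign_eq_zero⟩⟩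
    have h1 : (G.fst i).val ≤ k.val ∧ k.val < (G.snd i).val := by
      simp only [Crosses] at hk; omega
    have h2 : ¬ ((G.snd i).val ≤ k.val ∧ k.val < (G.fst i).val) := by omega
    simp [crossSign, h1, h2]
  · refine ⟨-1, by norm_num, fun k => ⟨fun hk => ?_, G.crossSign_eq_zero⟩⟩
    have h1 : (G.snd i).val ≤ k.val ∧ k.val < (G.fst i).val := by
      simp only [Crosses] at hk; omega
    have h2 : ¬ ((G.fst i).val ≤ k.val ∧ k.val < (G.snd i).val) := by omega
    simp [crossSign, h1, h2]

-- Cauchy–Schwarz in the energy product between the difference flow of `excessPower_eq_sum_sq` and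
-- the loop made of the photon line `i` and the lepton lines under it. The potential drops cancel
-- around the loop, so only the lepton resistances under `i` survive.
open Classical in
theorem sq_sum_crossed_le (G : VertexGraph h) {z : Line h → ℝ} (hz : ∀ l, 0 < z l) (i : Fin h) :
    (∑ k, if G.Crosses i k then z (Sum.inl k) else 0) ^ 2
      ≤ ((∑ k, if G.Crosses i k then z (Sum.inl k) else 0) + z (Sum.inr i)) * G.excessPower z := by
  obtain ⟨ε, hε, hσ⟩ := G.exists_crossSign_eq i
  set φ := G.pathPotential z with hφ
  rw [G.excessPower_eq_sum_sq hz, ← hφ]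
  set g : Line h → ℝ := fun l => (if l.isLeft = true then (1 : ℝ) else 0)
      - (φ (G.tail l) - φ (G.head l)) / z l with hg
  let c : Line h → ℝ := Sum.elim (fun k => G.crossSign i k) (fun j => if j = i then -1 else 0)
  have hσ' : ∀ k, G.crossSign i k = ε * if G.Crosses i k then 1 else 0 := by
    intro k
    by_cases hk : G.Crosses i k
    · simp [hk, (hσ k).1 hk]
    · simp [hk, (hσ k).2 hk]
  have h1 : ∑ l, z l * (c l * g l) = ε * ∑ k, if G.Crosses i k then z (Sum.inl k) else 0 := by
    have e : ∀ l, z l * (c l * g l) = c l * ((if l.isLeft = true then z l else 0)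
        + (φ (G.head l) - φ (G.tail l))) := by
      intro l
      have := (hz l).ne'
      simp only [hg]
      split_ifs <;> field_simp <;> ring
    simp_rw [e]
    rw [Fintype.sum_sum_type]
    simp only [c, Sum.elim_inl, Sum.elim_inr, Sum.isLeft_inl, Sum.isLeft_inr, if_true,
      Bool.false_eq_true, if_false, mul_add, Finset.sum_add_distrib]
    have h3 := G.sum_crossSign_mul i φ
    simp only [head, tail, Sum.elim_inl, Sum.elim_inr]
    rw [h3, Finset.mul_sum]
    have h4 : ∀ k, G.crossSign i k * z (Sum.inl k)
        = ε * if G.Crosses i k then z (Sum.inl k) else 0 := by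
      intro k; rw [hσ' k]; split_ifs <;> ring
    simp_rw [h4, ← Finset.mul_sum]
    simp only [ite_mul, neg_mul, one_mul, zero_mul, mul_zero, Finset.sum_ite_eq',
      Finset.mem_univ, if_true, Finset.sum_const_zero]
    ring
  have h2 : ∑ l, z l * c l ^ 2
      = (∑ k, if G.Crosses i k then z (Sum.inl k) else 0) + z (Sum.inr i) := by
    rw [Fintype.sum_sum_type]
    congr 1
    · refine Finset.sum_congr rfl fun k _ => ?_
      simp only [c, Sum.elim_inl]
      rw [hσ' k, mul_pow, hε]
      split_ifs <;> simp
    · simp [c]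
  have h3 : (∑ l, z l * (c l * g l)) ^ 2 ≤ (∑ l, z l * c l ^ 2) * ∑ l, z l * g l ^ 2 := by
    have := Finset.sum_mul_sq_le_sq_mul_sq Finset.univ (fun l => √(z l) * c l)
      (fun l => √(z l) * g l)
    have e1 : ∀ l, √(z l) * c l * (√(z l) * g l) = z l * (c l * g l) := fun l => by
      have := Real.mul_self_sqrt (hz l).le
      linear_combination (c l * g l) * this
    have e2 : ∀ (x : Line h → ℝ) l, (√(z l) * x l) ^ 2 = z l * x l ^ 2 := fun x l => by
      rw [mul_pow, Real.sq_sqrt (hz l).le]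
    simpa only [e1, e2] using this
  rw [h1, h2, mul_pow, hε, one_mul] at h3
  exact h3

theorem excessPower_nonneg (G : VertexGraph h) {z : Line h → ℝ} (hz : ∀ l, 0 < z l) :
    0 ≤ G.excessPower z := by
  rw [G.excessPower_eq_sum_sq hz]
  exact Finset.sum_nonneg fun l _ => mul_nonneg (hz l).le (sq_nonneg _)

/-- The bound for the sum `d` of all lepton parameters under `i` passes to a single one of them,
because `d² / (d + y)` increases with `d`. -/
theorem sq_le_of_crosses (G : VertexGraph h) {z : Line h → ℝ} (hz : ∀ l, 0 < z l) {i : Fin h}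
    {k : Fin (2 * h)} (hik : G.Crosses i k) :
    z (Sum.inl k) ^ 2 ≤ (z (Sum.inl k) + z (Sum.inr i)) * G.excessPower z := by
  classical
  have h1 := G.sq_sum_crossed_le hz i
  set d := ∑ k, if G.Crosses i k then z (Sum.inl k) else 0 with hd
  have h2 : z (Sum.inl k) ≤ d := by
    have := Finset.single_le_sum (f := fun k => if G.Crosses i k then z (Sum.inl k) else 0)
      (fun k _ => by split_ifs; exacts [(hz _).le, le_rfl]) (Finset.mem_univ k)
    simpa [hik] using this
  have hk := hz (Sum.inl k)
  have hy := hz (Sum.inr i)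
  have hw := G.excessPower_nonneg hz
  set x := z (Sum.inl k)
  set y := z (Sum.inr i)
  have hdy : 0 < d + y := by linarith
  have h3 : x ^ 2 * (d + y) ≤ d ^ 2 * (x + y) := by
    have e1 : 0 ≤ x * d * (d - x) :=
      mul_nonneg (mul_nonneg hk.le (hk.le.trans h2)) (sub_nonneg.2 h2)
    have e2 : x ^ 2 * y ≤ d ^ 2 * y :=
      mul_le_mul_of_nonneg_right (pow_le_pow_left₀ hk.le h2 2) hy.le
    linarith [show x * d * (d - x) = d ^ 2 * x - x ^ 2 * d by ring]
  have h4 : x ^ 2 * (d + y) ≤ (x + y) * G.excessPower z * (d + y) :=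
    h3.trans ((mul_le_mul_of_nonneg_right h1 (by linarith)).trans (le_of_eq (by ring)))
  exact le_of_mul_le_mul_right h4 hdy

theorem excessPower_pos (G : VertexGraph h) (hh : 1 ≤ h) {z : Line h → ℝ} (hz : ∀ l, 0 < z l) :
    0 < G.excessPower z := by
  obtain ⟨k, hk⟩ := G.exists_crosses ⟨0, hh⟩
  refine (G.excessPower_nonneg hz).lt_of_ne fun H => ?_
  have := G.sq_le_of_crosses hz hk
  rw [← H, mul_zero] at this
  have := hz (Sum.inl k)
  nlinarith

/-- Serves the measurability of the integrand. By Cramer's rule the potential is a polynomial in the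
matrix entries divided by a determinant that does not vanish. -/
theorem continuousOn_excessPower (G : VertexGraph h) :
    ContinuousOn G.excessPower {z : Line h → ℝ | ∀ l, 0 < z l} := by
  have hL : ContinuousOn (fun z => G.groundedLaplacian z) {z : Line h → ℝ | ∀ l, 0 < z l} := by
    refine continuousOn_pi.2 fun v => continuousOn_pi.2 fun u => ?_
    simp only [groundedLaplacian, Matrix.of_apply]
    have key : ∀ l : Line h, ContinuousOn (fun z : Line h → ℝ =>
        ((if G.head l = v then (1 : ℝ) else 0) - (if G.tail l = v then 1 else 0))
        * ((if G.tail l = u then (1 : ℝ) else 0) - (if G.head l = u then 1 else 0)) * (z l)⁻¹)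
        {z : Line h → ℝ | ∀ l, 0 < z l} := fun l =>
      continuousOn_const.mul (ContinuousOn.inv₀ (f := fun z : Line h → ℝ => z l)
        (continuous_apply l).continuousOn fun z hz => (hz l).ne')
    exact (continuousOn_finsetSum _ fun l _ => key l).sub continuousOn_const
  have hφ : ContinuousOn (fun z => G.pathPotential z) {z : Line h → ℝ | ∀ l, 0 < z l} := by
    have e : ∀ z, G.pathPotential z
        = ((G.groundedLaplacian z).det)⁻¹ • ((G.groundedLaplacian z).adjugate *ᵥ pathCurrent h) := by
      intro z
      rw [pathPotential, Matrix.inv_def, Ring.inverse_eq_inv', Matrix.smul_mulVec]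
    simp_rw [e]
    have c1 : Continuous fun M : Matrix (Fin (2 * h + 1)) (Fin (2 * h + 1)) ℝ => M.det :=
      Continuous.matrix_det continuous_id
    have c2 : Continuous fun M : Matrix (Fin (2 * h + 1)) (Fin (2 * h + 1)) ℝ =>
        M.adjugate *ᵥ pathCurrent h :=
      Continuous.matrix_mulVec (Continuous.matrix_adjugate continuous_id) continuous_const
    exact ((c1.comp_continuousOn hL).inv₀ fun z hz => ((Matrix.isUnit_iff_isUnit_det _).1
      (G.isUnit_groundedLaplacian hz)).ne_zero).smul (c2.comp_continuousOn hL)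
  have hφ' := continuousOn_pi.1 hφ
  have hs : Continuous fun z : Line h → ℝ => ∑ k : Fin (2 * h), z (Sum.inl k) := by fun_prop
  exact hs.continuousOn.sub ((hφ' _).sub (hφ' _))

end VertexGraph
end QED

/-! ### Bounds for the graph polynomials and the line momenta -/

namespace QED
namespace VertexGraph

variable {h : ℕ}

open Classical in
/-- The finite set of the 1-trees. -/
noncomputable def oneTrees (G : VertexGraph h) : Finset (Finset (Line h)) :=
  Finset.univ.filter (fun T : Finset (Line h) => G.IsOneTree T)

theorem mem_oneTrees {G : VertexGraph h} {T : Finset (Line h)} :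
    T ∈ G.oneTrees ↔ G.IsOneTree T := by simp [oneTrees]

theorem D_eq (G : VertexGraph h) (z : Line h → ℝ) : G.D z = ∑ T ∈ G.oneTrees, ∏ l ∈ Tᶜ, z l := by
  unfold D oneTrees
  congr!

theorem prod_compl_le_D (G : VertexGraph h) {z : Line h → ℝ} (hz : ∀ l, 0 < z l)
    {T : Finset (Line h)} (hT : G.IsOneTree T) : ∏ l ∈ Tᶜ, z l ≤ G.D z := by
  rw [D_eq]
  exact Finset.single_le_sum (f := fun T : Finset (Line h) => ∏ l ∈ Tᶜ, z l)
    (fun T _ => Finset.prod_nonneg fun l _ => (hz l).le) (mem_oneTrees.2 hT)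

theorem D_pos (G : VertexGraph h) {z : Line h → ℝ} (hz : ∀ l, 0 < z l) : 0 < G.D z :=
  (Finset.prod_pos fun l _ => hz l).trans_le (G.prod_compl_le_D hz G.leptonPath_isOneTree)

theorem continuous_D (G : VertexGraph h) : Continuous G.D := by
  unfold D; fun_prop

theorem continuous_B (G : VertexGraph h) (k k' : Fin (2 * h)) : Continuous (G.B k k') := by
  unfold B; fun_prop

theorem prod_compl_erase {z : Line h → ℝ} {T : Finset (Line h)} {l : Line h} (hl : l ∈ T) :
    ∏ j ∈ (T.erase l)ᶜ, z j = z l * ∏ j ∈ Tᶜ, z j := by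
  rw [Finset.compl_erase, Finset.prod_insert (by simpa using hl)]

/-- Deleting the cycle line `j` makes a 1-tree of each tree with cycle and multiplies its monomial
by `z_j`. As `j` can be put back, distinct terms of `B` go to distinct terms of `D`. -/
theorem abs_B_mul_le (G : VertexGraph h) {z : Line h → ℝ} (hz : ∀ l, 0 < z l)
    (k k' j : Fin (2 * h)) (hj : j = k ∨ j = k') :
    |G.B k k' z| * z (Sum.inl j) ≤ G.D z := by
  classical
  unfold B
  set S := Finset.univ.filter (fun T : Finset (Line h) =>
      ∃ c, G.IsTreeWithCycle T c ∧ Sum.inl k ∈ c ∧ Sum.inl k' ∈ c) with hS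
  have hmem : ∀ T ∈ S, Sum.inl j ∈ T ∧ G.IsOneTree (T.erase (Sum.inl j)) := by
    intro T hT
    obtain ⟨c, hc, hk, hk'⟩ := (Finset.mem_filter.1 hT).2
    have hjc : Sum.inl j ∈ c := by rcases hj with rfl | rfl <;> assumption
    exact ⟨hc.1 hjc, hc.2.2 _ hjc⟩
  have h1 : |∑ T ∈ S, (if G.Joined ((T.erase (Sum.inl k)).erase (Sum.inl k'))
        (G.head (Sum.inl k)) (G.tail (Sum.inl k')) then 1 else -1) * ∏ l ∈ Tᶜ, z l|
      ≤ ∑ T ∈ S, ∏ l ∈ Tᶜ, z l := by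
    refine (Finset.abs_sum_le_sum_abs _ _).trans (Finset.sum_le_sum fun T _ => ?_)
    have hp : 0 ≤ ∏ l ∈ Tᶜ, z l := Finset.prod_nonneg fun l _ => (hz l).le
    rw [abs_mul, abs_of_nonneg hp]
    split_ifs <;> simp
  have h2 : (∑ T ∈ S, ∏ l ∈ Tᶜ, z l) * z (Sum.inl j)
      = ∑ T ∈ S.image (fun T => T.erase (Sum.inl j)), ∏ l ∈ Tᶜ, z l := by
    rw [Finset.sum_image, Finset.sum_mul]
    · refine Finset.sum_congr rfl fun T hT => ?_
      rw [prod_compl_erase (hmem T hT).1, mul_comm]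
    · intro T hT T' hT' e
      have e' : T.erase (Sum.inl j) = T'.erase (Sum.inl j) := e
      rw [← Finset.insert_erase (hmem T hT).1, e', Finset.insert_erase (hmem T' hT').1]
  refine (mul_le_mul_of_nonneg_right h1 (hz _).le).trans ?_
  rw [h2, D_eq]
  refine Finset.sum_le_sum_of_subset_of_nonneg ?_
    fun T _ _ => Finset.prod_nonneg fun l _ => (hz l).le
  intro T hT
  obtain ⟨T', hT', rfl⟩ := Finset.mem_image.1 hT
  exact mem_oneTrees.2 (hmem T' hT').2

/-- The geometric mean of the bounds `1 / z_k` and `1 / z_k'`. In this symmetric form each paired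
line carries its own exponent `-1/2`. -/
theorem abs_B_div_D_le (G : VertexGraph h) {z : Line h → ℝ} (hz : ∀ l, 0 < z l)
    (k k' : Fin (2 * h)) :
    |G.B k k' z / G.D z| ≤ (√(z (Sum.inl k)))⁻¹ * (√(z (Sum.inl k')))⁻¹ := by
  have hD := G.D_pos hz
  have h1 := G.abs_B_mul_le hz k k' k (Or.inl rfl)
  have h2 := G.abs_B_mul_le hz k k' k' (Or.inr rfl)
  have hk := hz (Sum.inl k)
  have hk' := hz (Sum.inl k')
  rw [abs_div, abs_of_pos hD, ← mul_inv, ← Real.sqrt_mul hk.le, div_le_iff₀ hD,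
    inv_mul_eq_div, le_div_iff₀ (Real.sqrt_pos.2 (mul_pos hk hk'))]
  refine abs_le_of_sq_le_sq' ?_ hD.le |>.2
  rw [mul_pow, Real.sq_sqrt (mul_pos hk hk').le]
  have := mul_le_mul h1 h2 (mul_nonneg (abs_nonneg _) hk'.le) hD.le
  nlinarith

open Classical in
/-- The coefficients of `p₁` and `p₂` in the momentum of the lepton line `k` in the tree `T`. -/
noncomputable def treeCoeff (G : VertexGraph h) (k : Fin (2 * h)) (T : Finset (Line h)) : ℝ × ℝ :=
  let C := fun v => if G.Joined (T.erase (Sum.inl k)) (G.head (Sum.inl k)) v then (1 : ℝ) else 0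
  (C G.ext - C 0, C (Fin.last (2 * h)) - C G.ext)

theorem treeMomentum_eq (G : VertexGraph h) (k : Fin (2 * h)) (T : Finset (Line h))
    (p₁ p₂ : FourVector) :
    G.treeMomentum k T p₁ p₂ = (G.treeCoeff k T).1 • p₁ + (G.treeCoeff k T).2 • p₂ := by
  classical
  simp only [treeMomentum, outMomentum, treeCoeff, Finset.sum_sub_distrib, Finset.sum_ite_eq',
    Finset.mem_filter, Finset.mem_univ, true_and]
  split_ifs <;> module

theorem abs_treeCoeff_le (G : VertexGraph h) (k : Fin (2 * h)) (T : Finset (Line h)) :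
    |(G.treeCoeff k T).1| ≤ 1 ∧ |(G.treeCoeff k T).2| ≤ 1 := by
  classical
  simp only [treeCoeff]
  split_ifs <;> simp

open Classical in
/-- The coefficients of `p₁` and `p₂` in `Q_k / D`. -/
noncomputable def lineCoeff (G : VertexGraph h) (z : Line h → ℝ) (k : Fin (2 * h)) : ℝ × ℝ :=
  (G.D z)⁻¹ • ∑ T ∈ G.oneTrees.filter (fun T => Sum.inl k ∈ T),
    (∏ l ∈ Tᶜ, z l) • G.treeCoeff k T

theorem Q_div_D (G : VertexGraph h) (z : Line h → ℝ) (k : Fin (2 * h)) (p₁ p₂ : FourVector) :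
    (G.D z)⁻¹ • G.Q k z p₁ p₂ = (G.lineCoeff z k).1 • p₁ + (G.lineCoeff z k).2 • p₂ := by
  classical
  have e : G.oneTrees.filter (fun T => Sum.inl k ∈ T) = Finset.univ.filter
      (fun T : Finset (Line h) => G.IsOneTree T ∧ Sum.inl k ∈ T) := by
    ext T; simp [mem_oneTrees]
  rw [lineCoeff, e]
  simp only [Q, treeMomentum_eq, Prod.smul_fst, Prod.smul_snd, Prod.fst_sum, Prod.snd_sum,
    smul_add, Finset.sum_add_distrib, smul_assoc, Finset.sum_smul]

/-- The coefficients of `p₁` and `p₂` in the lepton path. -/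
noncomputable def pathCoeff (G : VertexGraph h) (k : Fin (2 * h)) : ℝ × ℝ :=
  if k.val < G.ext.val then (1, 0) else (0, 1)

/-- Cutting the path at `k` leaves the vertices after `k` on the head side; whether `ext` is among
them decides between `p₁` and `p₂`. -/
theorem treeCoeff_leptonPath (G : VertexGraph h) (k : Fin (2 * h)) :
    G.treeCoeff k (leptonPath h) = G.pathCoeff k := by
  classical
  have key : ∀ v, G.Joined ((leptonPath h).erase (Sum.inl k)) (G.head (Sum.inl k)) v
      ↔ k.val < v.val := by
    intro v
    constructor
    · have H : ∀ a b, G.Joined ((leptonPath h).erase (Sum.inl k)) a b →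
          (k.val < a.val ↔ k.val < b.val) := by
        intro a b hab
        induction hab with
        | rel a b hab =>
          obtain ⟨l, hl, rfl, rfl⟩ := hab
          rw [Finset.mem_erase] at hl
          cases l with
          | inl j =>
            have : j.val ≠ k.val := fun e => hl.1 (by rw [Fin.ext e])
            simp only [tail, head, Sum.elim_inl, Fin.val_castSucc, Fin.val_succ]
            omega
          | inr i => exact absurd hl.2 (inr_notMem_leptonPath i)
        | refl a => rfl
        | symm a b _ ih => exact ih.symm
        | trans a b c _ _ ih1 ih2 => exact ih1.trans ih2
      intro hv
      rw [← H _ _ hv]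
      simp [head]
    · have H : ∀ n (hn : n < 2 * h + 1), k.val < n →
          G.Joined ((leptonPath h).erase (Sum.inl k)) (G.head (Sum.inl k)) ⟨n, hn⟩ := by
        intro n
        induction n with
        | zero => intro _ hk; omega
        | succ n ih =>
          intro hn hk
          rcases (Nat.lt_succ_iff.1 hk).eq_or_lt with e | hlt
          · have : G.head (Sum.inl k) = ⟨n + 1, hn⟩ := by
              ext; simp [head, e]
            rw [this]
            exact Relation.EqvGen.refl _
          · refine (ih (by omega) hlt).trans ?_
            exact Joined.of_mem (G := G) (s := (leptonPath h).erase (Sum.inl k))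
              (l := Sum.inl (⟨n, by omega⟩ : Fin (2 * h)))
              (Finset.mem_erase.2 ⟨by simp [Fin.ext_iff]; omega, inl_mem_leptonPath _⟩)
      exact H v v.2
  simp only [treeCoeff, key, pathCoeff]
  have h1 : k.val < (Fin.last (2 * h)).val := k.2
  have h0 : ¬ k.val < (0 : Fin (2 * h + 1)).val := Nat.not_lt_zero _
  simp only [h1, h0, if_true, if_false]
  split_ifs <;> simp

theorem abs_lineCoeff_le (G : VertexGraph h) {z : Line h → ℝ} (hz : ∀ l, 0 < z l)
    (k : Fin (2 * h)) : |(G.lineCoeff z k).1| ≤ 1 ∧ |(G.lineCoeff z k).2| ≤ 1 := by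
  classical
  have hD := G.D_pos hz
  have hp : ∀ T : Finset (Line h), 0 ≤ ∏ l ∈ Tᶜ, z l :=
    fun T => Finset.prod_nonneg fun l _ => (hz l).le
  have key : ∀ c : Finset (Line h) → ℝ, (∀ T, |c T| ≤ 1) →
      |(G.D z)⁻¹ * ∑ T ∈ G.oneTrees.filter (fun T => Sum.inl k ∈ T), (∏ l ∈ Tᶜ, z l) * c T|
        ≤ 1 := by
    intro c hc
    rw [abs_mul, abs_of_pos (inv_pos.2 hD), inv_mul_eq_div, div_le_one hD, D_eq]
    refine (Finset.abs_sum_le_sum_abs _ _).trans (le_trans (Finset.sum_le_sum fun T _ => ?_)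
      (Finset.sum_le_sum_of_subset_of_nonneg (Finset.filter_subset _ _) fun T _ _ => hp T))
    rw [abs_mul, abs_of_nonneg (hp T)]
    exact mul_le_of_le_one_right (hp T) (hc T)
  simp only [lineCoeff, Prod.smul_fst, Prod.smul_snd, Prod.fst_sum, Prod.snd_sum, smul_eq_mul]
  exact ⟨key _ fun T => (G.abs_treeCoeff_le k T).1, key _ fun T => (G.abs_treeCoeff_le k T).2⟩

/-- The trees that avoid the lepton line `j`. -/
theorem sum_oneTrees_avoiding_le (G : VertexGraph h) {z : Line h → ℝ} (hz : ∀ l, 0 < z l)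
    {δ : ℝ} (hδ : ∀ i k, G.Crosses i k → z (Sum.inl k) ≤ δ * z (Sum.inr i)) (j : Fin (2 * h)) :
    ∑ T ∈ G.oneTrees.filter (fun T => Sum.inl j ∉ T), ∏ l ∈ Tᶜ, z l ≤ h * (δ * G.D z) := by
  classical
  have hp : ∀ T : Finset (Line h), 0 ≤ ∏ l ∈ Tᶜ, z l :=
    fun T => Finset.prod_nonneg fun l _ => (hz l).le
  -- A tree avoiding `j` contains a photon line `i` over `j`. Swapping them multiplies the monomial
  -- by `z_i / z_j`, which is at least `1 / δ`. The swap is injective once `i` is recorded, at the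
  -- cost of the factor `h`.
  have hex : ∀ T : Finset (Line h), ∃ i, G.IsOneTree T → Sum.inl j ∉ T →
      G.Crosses i j ∧ Sum.inr i ∈ T ∧ G.IsOneTree (insert (Sum.inl j) (T.erase (Sum.inr i))) := by
    intro T
    by_cases hT : G.IsOneTree T ∧ Sum.inl j ∉ T
    · obtain ⟨i, hi⟩ := hT.1.exchange_lepton hT.2
      exact ⟨i, fun _ _ => hi⟩
    · obtain ⟨i, -⟩ : ∃ i : Fin h, True := by
        have := j.2
        exact ⟨⟨0, by omega⟩, trivial⟩
      exact ⟨i, fun h1 h2 => absurd ⟨h1, h2⟩ hT⟩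
  choose i hi using hex
  set S := G.oneTrees.filter (fun T => Sum.inl j ∉ T) with hS
  have hi' : ∀ T ∈ S, G.Crosses (i T) j ∧ Sum.inr (i T) ∈ T ∧
      G.IsOneTree (insert (Sum.inl j) (T.erase (Sum.inr (i T)))) := fun T hT =>
    hi T (mem_oneTrees.1 (Finset.mem_filter.1 hT).1) (Finset.mem_filter.1 hT).2
  have h1 : ∀ T ∈ S, ∏ l ∈ Tᶜ, z l
      ≤ δ * ∏ l ∈ (insert (Sum.inl j) (T.erase (Sum.inr (i T))))ᶜ, z l := by
    intro T hT
    obtain ⟨hc, hiT, -⟩ := hi' T hT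
    have hj := (Finset.mem_filter.1 hT).2
    set T' := insert (Sum.inl j) (T.erase (Sum.inr (i T))) with hT'
    have e1 := prod_compl_erase (z := z) (T := T') (Finset.mem_insert_self _ _)
    have e2 := prod_compl_erase (z := z) hiT
    rw [hT', Finset.erase_insert (fun H => hj (Finset.mem_of_mem_erase H)), ← hT', e2] at e1
    have h3 := mul_le_mul_of_nonneg_right (hδ _ _ hc) (hp T')
    rw [← e1] at h3
    have hy := hz (Sum.inr (i T))
    refine le_of_mul_le_mul_left (a := z (Sum.inr (i T))) ?_ hy
    linarith
  have h2 : ∑ T ∈ S, ∏ l ∈ (insert (Sum.inl j) (T.erase (Sum.inr (i T))))ᶜ, z l ≤ h * G.D z := by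
    have hinj : Set.InjOn (fun T => (i T, insert (Sum.inl j) (T.erase (Sum.inr (i T))))) S := by
      intro T hT T' hT' e
      simp only [Prod.mk.injEq] at e
      have hj := (Finset.mem_filter.1 hT).2
      have hj' := (Finset.mem_filter.1 hT').2
      have e2 : T.erase (Sum.inr (i T)) = T'.erase (Sum.inr (i T')) := by
        rw [← Finset.erase_insert (s := T.erase (Sum.inr (i T)))
          (fun H => hj (Finset.mem_of_mem_erase H)), e.2,
          Finset.erase_insert (fun H => hj' (Finset.mem_of_mem_erase H))]
      rw [← Finset.insert_erase (hi' T hT).2.1, e2, e.1, Finset.insert_erase (hi' T' hT').2.1]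
    calc ∑ T ∈ S, ∏ l ∈ (insert (Sum.inl j) (T.erase (Sum.inr (i T))))ᶜ, z l
        = ∑ x ∈ S.image (fun T => (i T, insert (Sum.inl j) (T.erase (Sum.inr (i T))))),
            ∏ l ∈ x.2ᶜ, z l := by rw [Finset.sum_image hinj]
      _ ≤ ∑ x ∈ (Finset.univ : Finset (Fin h)) ×ˢ G.oneTrees, ∏ l ∈ x.2ᶜ, z l := by
          refine Finset.sum_le_sum_of_subset_of_nonneg ?_ fun x _ _ => hp x.2
          intro x hx
          obtain ⟨T, hT, rfl⟩ := Finset.mem_image.1 hx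
          exact Finset.mem_product.2 ⟨Finset.mem_univ _, mem_oneTrees.2 (hi' T hT).2.2⟩
      _ = h * G.D z := by
          rw [Finset.sum_product, D_eq]; simp
  have hδ0 : 0 ≤ δ := by
    have hj := j.2
    obtain ⟨k, hk⟩ := G.exists_crosses ⟨0, by omega⟩
    have h3 := hδ _ _ hk
    have h4 := hz (Sum.inl k)
    by_contra hneg
    have := mul_neg_of_neg_of_pos (not_le.1 hneg) (hz (Sum.inr ⟨0, by omega⟩))
    linarith
  calc ∑ T ∈ S, ∏ l ∈ Tᶜ, z l
      ≤ ∑ T ∈ S, δ * ∏ l ∈ (insert (Sum.inl j) (T.erase (Sum.inr (i T))))ᶜ, z l :=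
        Finset.sum_le_sum h1
    _ ≤ δ * (h * G.D z) := by
        rw [← Finset.mul_sum]; exact mul_le_mul_of_nonneg_left h2 hδ0
    _ = _ := by ring

theorem eq_leptonPath {G : VertexGraph h} {T : Finset (Line h)} (hT : G.IsOneTree T)
    (H : ∀ j, Sum.inl j ∈ T) : T = leptonPath h := by
  refine (Finset.eq_of_subset_of_card_le ?_ ?_).symm
  · intro l hl
    cases l with
    | inl j => exact H j
    | inr i => exact absurd hl (inr_notMem_leptonPath i)
  · rw [hT.card_eq, card_leptonPath]

/-- When the photon resistances dominate, the current stays on the lepton path: every other tree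
avoids some lepton line, and the trees avoiding a given one make up at most the fraction `h δ` of
`D`. The constant is `2h` lepton lines times `h` times the bound `2` for a difference of
coefficients. -/
theorem norm_lineCoeff_sub_le (G : VertexGraph h) {z : Line h → ℝ} (hz : ∀ l, 0 < z l)
    {δ : ℝ} (hδ : ∀ i k, G.Crosses i k → z (Sum.inl k) ≤ δ * z (Sum.inr i)) (k : Fin (2 * h)) :
    ‖G.lineCoeff z k - G.pathCoeff k‖ ≤ 4 * h ^ 2 * δ := by
  classical
  have hD := G.D_pos hz
  have hp : ∀ T : Finset (Line h), 0 ≤ ∏ l ∈ Tᶜ, z l :=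
    fun T => Finset.prod_nonneg fun l _ => (hz l).le
  let c : Finset (Line h) → ℝ × ℝ := fun T => if Sum.inl k ∈ T then G.treeCoeff k T else 0
  have e1 : G.lineCoeff z k = (G.D z)⁻¹ • ∑ T ∈ G.oneTrees, (∏ l ∈ Tᶜ, z l) • c T := by
    rw [lineCoeff, Finset.sum_filter]
    congr 1
    refine Finset.sum_congr rfl fun T _ => ?_
    simp only [c]; split_ifs <;> simp
  have e2 : G.pathCoeff k = (G.D z)⁻¹ • ∑ T ∈ G.oneTrees, (∏ l ∈ Tᶜ, z l) • G.pathCoeff k := by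
    rw [← Finset.sum_smul, ← D_eq, smul_smul, inv_mul_cancel₀ hD.ne', one_smul]
  have hc : ∀ T, ‖c T - G.pathCoeff k‖ ≤ 2 := by
    intro T
    have hb := G.abs_treeCoeff_le k T
    have h1 : ‖c T‖ ≤ 1 := by
      simp only [c]
      split_ifs
      · rw [Prod.norm_def, Real.norm_eq_abs, Real.norm_eq_abs]
        exact max_le hb.1 hb.2
      · simp
    have h2 : ‖G.pathCoeff k‖ ≤ 1 := by
      rw [pathCoeff]; split_ifs <;> simp [Prod.norm_def]
    exact (norm_sub_le _ _).trans (by linarith)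
  have hc0 : ∀ T, G.IsOneTree T → (∀ j, Sum.inl j ∈ T) → c T - G.pathCoeff k = 0 := by
    intro T hT H
    have : Sum.inl k ∈ T := H k
    rw [eq_leptonPath hT H]
    simp [c, inl_mem_leptonPath, treeCoeff_leptonPath]
  have h3 : ‖∑ T ∈ G.oneTrees, (∏ l ∈ Tᶜ, z l) • (c T - G.pathCoeff k)‖
      ≤ 2 * ∑ j : Fin (2 * h), ∑ T ∈ G.oneTrees.filter (fun T => Sum.inl j ∉ T),
        ∏ l ∈ Tᶜ, z l := by
    simp_rw [Finset.sum_filter]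
    rw [Finset.sum_comm, Finset.mul_sum]
    refine (norm_sum_le _ _).trans (Finset.sum_le_sum fun T hT => ?_)
    rw [norm_smul, Real.norm_of_nonneg (hp T), mul_comm]
    by_cases H : ∀ j, Sum.inl j ∈ T
    · simp [hc0 T (mem_oneTrees.1 hT) H, H]
    · push Not at H
      obtain ⟨j, hj⟩ := H
      have := Finset.single_le_sum (f := fun j : Fin (2 * h) =>
        if (Sum.inl j : Line h) ∉ T then ∏ l ∈ Tᶜ, z l else 0)
        (fun j _ => by split_ifs; exacts [le_rfl, hp T]) (Finset.mem_univ j)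
      simp only [hj, not_false_eq_true, if_true] at this
      exact mul_le_mul (hc T) this (hp T) (by norm_num)
  rw [e1]
  nth_rewrite 1 [e2]
  rw [← smul_sub, ← Finset.sum_sub_distrib]
  simp_rw [← smul_sub]
  rw [norm_smul, norm_inv, Real.norm_of_nonneg hD.le, inv_mul_le_iff₀ hD]
  refine h3.trans ?_
  have h4 := Finset.sum_le_sum fun (j : Fin (2 * h)) (_ : j ∈ Finset.univ) =>
    G.sum_oneTrees_avoiding_le hz hδ j
  simp only [Finset.sum_const, Finset.card_univ, Fintype.card_fin, nsmul_eq_mul] at h4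
  push_cast at h4
  linarith

theorem continuousOn_lineCoeff (G : VertexGraph h) :
    ContinuousOn G.lineCoeff {z : Line h → ℝ | ∀ l, 0 < z l} := by
  classical
  refine continuousOn_pi.2 fun k => ?_
  refine ContinuousOn.smul (ContinuousOn.inv₀ G.continuous_D.continuousOn
    fun z hz => (G.D_pos hz).ne') (Continuous.continuousOn ?_)
  fun_prop

end VertexGraph
end QED

namespace QED

/-! ### The Clifford algebra -/

theorem slash_add (γ : Fin 4 → SpinorMatrix) (p q : FourVector) :
    slash γ (p + q) = slash γ p + slash γ q := by
  simp [slash, add_smul, Finset.sum_add_distrib]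

theorem slash_smul (γ : Fin 4 → SpinorMatrix) (a : ℝ) (p : FourVector) :
    slash γ (a • p) = (a : ℂ) • slash γ p := by
  rw [slash, slash, Finset.smul_sum]
  refine Finset.sum_congr rfl fun ν _ => ?_
  rw [smul_smul, Pi.smul_apply, smul_eq_mul, Complex.ofReal_mul]

theorem slash_sub (γ : Fin 4 → SpinorMatrix) (p q : FourVector) :
    slash γ (p - q) = slash γ p - slash γ q := by
  simp [slash, sub_smul, Finset.sum_sub_distrib]

theorem slash_single (γ : Fin 4 → SpinorMatrix) (ν : Fin 4) :
    slash γ (Pi.single ν 1) = γ ν := by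
  rw [slash, Finset.sum_eq_single ν]
  · simp
  · intro b _ hb; simp [hb]
  · simp

theorem mdot_eq (p q : FourVector) : mdot p q = ∑ μ, metric μ μ * p μ * q μ := by
  refine Finset.sum_congr rfl fun μ _ => ?_
  rw [Finset.sum_eq_single μ]
  · intro ν _ hν; simp [metric, hν.symm]
  · simp

theorem metric_self_mul_self (μ : Fin 4) : metric μ μ * metric μ μ = 1 := by
  simp only [metric, if_true]; split_ifs <;> norm_num

theorem sum_metric_self : ∑ μ : Fin 4, metric μ μ = -2 := by
  simp [metric, Fin.sum_univ_four]; norm_num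

theorem mdot_comm (p q : FourVector) : mdot p q = mdot q p := by
  rw [mdot_eq, mdot_eq]; exact Finset.sum_congr rfl fun μ _ => by ring

theorem mdot_sub_self (p q : FourVector) :
    2 * mdot q p = mdot p p + mdot q q - mdot (p - q) (p - q) := by
  simp only [mdot_eq, Fin.sum_univ_four, Pi.sub_apply]; ring

theorem mdot_single_left (ν : Fin 4) (p : FourVector) :
    mdot (Pi.single ν 1) p = metric ν ν * p ν := by
  rw [mdot_eq, Finset.sum_eq_single ν]
  · simp
  · intro b _ hb; simp [hb]
  · simp

variable {γ : Fin 4 → SpinorMatrix}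

theorem IsDirac.slash_mul_slash (hγ : IsDirac γ) (p q : FourVector) :
    slash γ p * slash γ q + slash γ q * slash γ p = ((2 * mdot p q : ℝ) : ℂ) • 1 := by
  have h1 : slash γ q * slash γ p
      = ∑ μ, ∑ ν, ((p μ : ℂ) * (q ν : ℂ)) • (γ ν * γ μ) := by
    rw [slash, slash, Finset.sum_mul_sum, Finset.sum_comm]
    refine Finset.sum_congr rfl fun μ _ => Finset.sum_congr rfl fun ν _ => ?_
    rw [smul_mul_smul_comm, mul_comm]
  have h2 : slash γ p * slash γ q
      = ∑ μ, ∑ ν, ((p μ : ℂ) * (q ν : ℂ)) • (γ μ * γ ν) := by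
    rw [slash, slash, Finset.sum_mul_sum]
    refine Finset.sum_congr rfl fun μ _ => Finset.sum_congr rfl fun ν _ => ?_
    rw [smul_mul_smul_comm]
  rw [h1, h2, ← Finset.sum_add_distrib]
  simp_rw [← Finset.sum_add_distrib, ← smul_add, hγ _ _, smul_smul]
  rw [mdot, Finset.mul_sum]
  push_cast
  rw [Finset.sum_smul]
  refine Finset.sum_congr rfl fun μ _ => ?_
  rw [Finset.mul_sum, Finset.sum_smul]
  refine Finset.sum_congr rfl fun ν _ => ?_
  congr 1
  ring

theorem IsDirac.slash_sq (hγ : IsDirac γ) (p : FourVector) :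
    slash γ p * slash γ p = ((mdot p p : ℝ) : ℂ) • 1 := by
  have := hγ.slash_mul_slash p p
  rw [← two_smul ℂ] at this
  have h2 : (2 : ℂ) ≠ 0 := two_ne_zero
  apply smul_right_injective _ h2
  simp only
  rw [this, smul_smul]
  push_cast
  rfl

/-- Contraction of an index with a four-vector. -/
theorem sum_metric_mdot_smul (p : FourVector) :
    ∑ ν, ((metric ν ν * mdot (Pi.single ν 1) p : ℝ) : ℂ) • γ ν = slash γ p := by
  refine Finset.sum_congr rfl fun ν _ => ?_
  rw [mdot_single_left, ← mul_assoc, metric_self_mul_self, one_mul]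

/-- The sum over a contracted adjacent pair of indices. -/
theorem IsDirac.sum_metric_sq (hγ : IsDirac γ) :
    ∑ ν, ((metric ν ν : ℝ) : ℂ) • (γ ν * γ ν) = (4 : ℂ) • 1 := by
  have h1 : ∀ ν, ((metric ν ν : ℝ) : ℂ) • (γ ν * γ ν) = 1 := by
    intro ν
    have h2 := hγ.slash_sq (Pi.single ν 1)
    rw [slash_single, mdot_single_left] at h2
    rw [h2, smul_smul]
    simp only [Pi.single_eq_same, mul_one]
    rw [← Complex.ofReal_mul, metric_self_mul_self]
    simp
  simp_rw [h1]
  rw [Finset.sum_const, Finset.card_univ, Fintype.card_fin, ← Nat.cast_smul_eq_nsmul ℂ]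
  norm_num

/-! ### Words of Dirac matrices -/

/-- Letters: `inl k` is the propagator of the line `k`, `inr (inl i)` is a Dirac matrix whose index
is the summation index `i`, and `inr (inr j)` is a slashed four-vector. -/
abbrev Letter (κ ι : Type) := κ ⊕ (ι ⊕ Fin 3)

/-- The four-vector whose slashed form is the letter. -/
def letterVec {ι : Type} (a : ι → Fin 4) (w : Fin 3 → FourVector) : ι ⊕ Fin 3 → FourVector :=
  Sum.elim (fun i => Pi.single (a i) 1) w

/-- The matrix belonging to a letter. -/
noncomputable def evalLetter {κ ι : Type} (γ : Fin 4 → SpinorMatrix) (c : κ → ℝ × ℝ)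
    (w : Fin 3 → FourVector) (a : ι → Fin 4) : Letter κ ι → SpinorMatrix :=
  Sum.elim (fun k => 1 + slash γ ((c k).1 • w 1 + (c k).2 • w 2))
    (fun l => slash γ (letterVec a w l))

/-- The product of the matrices of the word `L`. -/
noncomputable def evalWord {κ ι : Type} (γ : Fin 4 → SpinorMatrix) (c : κ → ℝ × ℝ)
    (w : Fin 3 → FourVector) (a : ι → Fin 4) (L : List (Letter κ ι)) : SpinorMatrix :=
  (L.map (evalLetter γ c w a)).prod

/-- The word `L` with all its summation indices contracted. -/
noncomputable def contractWord {κ ι : Type} [Fintype ι] [DecidableEq ι]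
    (γ : Fin 4 → SpinorMatrix) (L : List (Letter κ ι)) (c : κ → ℝ × ℝ)
    (w : Fin 3 → FourVector) : SpinorMatrix :=
  ∑ a : ι → Fin 4, ((∏ i, metric (a i) (a i) : ℝ) : ℂ) • evalWord γ c w a L

section words

variable {κ ι : Type} (c : κ → ℝ × ℝ) (w : Fin 3 → FourVector)

theorem evalWord_append (a : ι → Fin 4) (A B : List (Letter κ ι)) :
    evalWord γ c w a (A ++ B) = evalWord γ c w a A * evalWord γ c w a B := by
  simp [evalWord]

theorem evalWord_cons (a : ι → Fin 4) (l : Letter κ ι) (A : List (Letter κ ι)) :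
    evalWord γ c w a (l :: A) = evalLetter γ c w a l * evalWord γ c w a A := by
  simp [evalWord]

variable [DecidableEq ι]

theorem evalWord_update (a : ι → Fin 4) {i : ι} (ν : Fin 4) {A : List (Letter κ ι)}
    (hA : Sum.inr (Sum.inl i) ∉ A) :
    evalWord γ c w (Function.update a i ν) A = evalWord γ c w a A := by
  unfold evalWord
  congr 1
  refine List.map_congr_left fun l hl => ?_
  rcases l with k | j | j
  · rfl
  · have : j ≠ i := fun e => hA (e ▸ hl)
    simp [evalLetter, letterVec, this]
  · rfl

variable [Fintype ι]

/-- Every assignment is reached from the four that agree with it away from `i`. This isolates the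
sum over one index inside the sum over all of them. -/
theorem sum_update {M : Type*} [AddCommGroup M] [Module ℂ M] (i : ι) (f : (ι → Fin 4) → M) :
    ∑ a : ι → Fin 4, ∑ ν, f (Function.update a i ν) = (4 : ℂ) • ∑ a, f a := by
  have h1 : ∀ ν : Fin 4, ∑ a : ι → Fin 4, f (Function.update a i ν)
      = ∑ a : ι → Fin 4, (4 : ℂ) • if a i = ν then f a else 0 := by
    intro ν
    have h2 : ∀ a : ι → Fin 4, f (Function.update a i ν)
        = ∑ b, if b = Function.update a i ν then f b else 0 := fun a => by simp
    simp_rw [h2]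
    rw [Finset.sum_comm]
    refine Finset.sum_congr rfl fun b _ => ?_
    rw [← Finset.sum_filter]
    by_cases hb : b i = ν
    · have : Finset.univ.filter (fun a : ι → Fin 4 => b = Function.update a i ν)
          = Finset.univ.image (fun μ => Function.update b i μ) := by
        ext a
        simp only [Finset.mem_filter, Finset.mem_univ, true_and, Finset.mem_image]
        constructor
        · rintro rfl
          exact ⟨a i, by simp⟩
        · rintro ⟨μ, rfl⟩
          simp [← hb]
      rw [this, Finset.sum_const, Finset.card_image_of_injective _
        (Function.update_injective b i)]
      rw [if_pos hb, Finset.card_univ, Fintype.card_fin, ← Nat.cast_smul_eq_nsmul ℂ]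
      norm_num
    · have : Finset.univ.filter (fun a : ι → Fin 4 => b = Function.update a i ν) = ∅ := by
        ext a
        simp only [Finset.mem_filter, Finset.mem_univ, true_and, Finset.notMem_empty, iff_false]
        rintro rfl
        simp at hb
      rw [this]; simp [hb]
  rw [Finset.sum_comm]
  simp_rw [h1]
  rw [Finset.sum_comm, Finset.smul_sum]
  refine Finset.sum_congr rfl fun a _ => ?_
  rw [← Finset.smul_sum]
  simp

theorem prod_metric_update (a : ι → Fin 4) (i : ι) (ν : Fin 4) :
    (∏ j, metric (Function.update a i ν j) (Function.update a i ν j))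
      = metric ν ν * ∏ j ∈ Finset.univ.erase i, metric (a j) (a j) := by
  rw [← Finset.mul_prod_erase _ _ (Finset.mem_univ i)]
  simp only [Function.update_self]
  congr 1
  refine Finset.prod_congr rfl fun j hj => ?_
  rw [Function.update_of_ne (Finset.ne_of_mem_erase hj)]

/-- Summation over one index `i` of a sum over all indices. -/
theorem sum_metric_smul_eq (i : ι) (X Y Z : (ι → Fin 4) → SpinorMatrix)
    (R : (ι → Fin 4) → SpinorMatrix)
    (hX : ∀ a ν, X (Function.update a i ν) = X a) (hZ : ∀ a ν, Z (Function.update a i ν) = Z a)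
    (hY : ∀ a, ∑ ν, ((metric ν ν : ℝ) : ℂ) • Y (Function.update a i ν) = (-2 : ℂ) • R a)
    (hR : ∀ a ν, R (Function.update a i ν) = R a) :
    ∑ a : ι → Fin 4, ((∏ j, metric (a j) (a j) : ℝ) : ℂ) • (X a * Y a * Z a)
      = ∑ a : ι → Fin 4, ((∏ j, metric (a j) (a j) : ℝ) : ℂ) • (X a * R a * Z a) := by
  have h4 : (4 : ℂ) ≠ 0 := by norm_num
  apply smul_right_injective _ h4
  simp only
  rw [← sum_update i, ← sum_update i]
  refine Finset.sum_congr rfl fun a _ => ?_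
  simp_rw [prod_metric_update, hX, hZ, hR]
  have h1 : ∀ (y : Fin 4 → SpinorMatrix), ∑ ν, ((metric ν ν
        * ∏ j ∈ Finset.univ.erase i, metric (a j) (a j) : ℝ) : ℂ) • (X a * y ν * Z a)
      = ((∏ j ∈ Finset.univ.erase i, metric (a j) (a j) : ℝ) : ℂ) •
        (X a * (∑ ν, ((metric ν ν : ℝ) : ℂ) • y ν) * Z a) := by
    intro y
    rw [Finset.mul_sum, Finset.sum_mul, Finset.smul_sum]
    refine Finset.sum_congr rfl fun ν _ => ?_
    rw [mul_smul_comm, smul_mul_assoc, smul_smul]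
    push_cast
    rw [mul_comm]
  rw [h1 fun ν => Y (Function.update a i ν), h1 fun _ => R a, hY, ← Finset.sum_smul]
  -- An index that no longer occurs is still summed with its metric weight and yields `1 - 1 - 1 - 1
  -- = -2`. This is the factor required in `hY`.
  congr 4
  rw [← Complex.ofReal_sum, sum_metric_self]
  norm_num

/-- An adjacent contracted pair can be deleted. -/
theorem IsDirac.contractWord_pair (hγ : IsDirac γ) (A B : List (Letter κ ι)) (i : ι)
    (hA : Sum.inr (Sum.inl i) ∉ A) (hB : Sum.inr (Sum.inl i) ∉ B) :
    contractWord γ (A ++ Sum.inr (Sum.inl i) :: Sum.inr (Sum.inl i) :: B) c w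
      = (-2 : ℂ) • contractWord γ (A ++ B) c w := by
  -- The contraction `γ_ν γ^ν` gives `4 = (-2) * (-2)`: one factor is what the index, now unused,
  -- contributes to the shorter word, the other stands in the conclusion.
  have h1 := sum_metric_smul_eq i (fun a => evalWord γ c w a A) (fun a => γ (a i) * γ (a i))
    (fun a => evalWord γ c w a B) (fun _ => (-2 : ℂ) • 1)
    (fun a ν => evalWord_update c w a ν hA) (fun a ν => evalWord_update c w a ν hB)
    (fun a => by
      simp only [Function.update_self, hγ.sum_metric_sq, smul_smul]; norm_num) (fun a ν => rfl)
  rw [contractWord, contractWord, Finset.smul_sum]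
  convert h1 using 2 with a _ a _
  · rw [evalWord_append, evalWord_cons, evalWord_cons]
    simp only [evalLetter, Sum.elim_inr, letterVec, Sum.elim_inl, slash_single, mul_assoc]
  · rw [evalWord_append]
    simp only [mul_smul_comm, smul_mul_assoc, mul_one]
    rw [smul_comm]

/-- Anticommutation of a contracted index with another letter. -/
theorem IsDirac.contractWord_swap (hγ : IsDirac γ) (A B C C' : List (Letter κ ι)) (i : ι)
    (y : ι ⊕ Fin 3) (hy : y ≠ Sum.inl i) (hAB : A ++ B = C ++ Sum.inr (Sum.inl i) :: C')
    (hC : Sum.inr (Sum.inl i) ∉ C) (hC' : Sum.inr (Sum.inl i) ∉ C') :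
    contractWord γ (A ++ Sum.inr (Sum.inl i) :: Sum.inr y :: B) c w
      + contractWord γ (A ++ Sum.inr y :: Sum.inr (Sum.inl i) :: B) c w
      = -contractWord γ (C ++ Sum.inr y :: C') c w := by
  have hyu : ∀ (a : ι → Fin 4) ν, letterVec (Function.update a i ν) w y = letterVec a w y := by
    intro a ν
    rcases y with j | j
    · have : j ≠ i := fun e => hy (by rw [e])
      simp [letterVec, this]
    · rfl
  -- The anticommutator is a metric tensor which, contracted with the other occurrence of `i`, puts
  -- `y` in its place. Here `2 ŷ = (-2) • (-ŷ)`, where `-2` again accounts for the unused index.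
  have h1 := sum_metric_smul_eq i (fun a => evalWord γ c w a C)
    (fun a => ((2 * mdot (Pi.single (a i) 1) (letterVec a w y) : ℝ) : ℂ) • γ (a i))
    (fun a => evalWord γ c w a C') (fun a => -slash γ (letterVec a w y))
    (fun a ν => evalWord_update c w a ν hC) (fun a ν => evalWord_update c w a ν hC')
    (fun a => by
      simp only [Function.update_self, hyu, smul_neg]
      rw [← neg_smul, neg_neg, ← sum_metric_mdot_smul, Finset.smul_sum]
      refine Finset.sum_congr rfl fun ν _ => ?_
      rw [smul_smul, smul_smul]
      push_cast
      ring_nf) (fun a ν => by rw [hyu])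
  simp only [contractWord]
  rw [← Finset.sum_add_distrib, ← Finset.sum_neg_distrib]
  convert h1 using 2 with a _ a _
  · rw [← smul_add]
    congr 1
    rw [evalWord_append, evalWord_append, evalWord_cons, evalWord_cons, evalWord_cons,
      evalWord_cons, ← mul_add, ← mul_assoc (evalLetter _ _ _ _ _), ← mul_assoc (evalLetter _ _ _ _ _),
      ← add_mul]
    have h2 := hγ.slash_mul_slash (Pi.single (a i) 1) (letterVec a w y)
    have h3 : evalWord γ c w a A * evalWord γ c w a B
        = evalWord γ c w a C * γ (a i) * evalWord γ c w a C' := by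
      rw [← evalWord_append, hAB, evalWord_append, evalWord_cons]
      simp only [evalLetter, Sum.elim_inr, letterVec, Sum.elim_inl, slash_single, mul_assoc]
    have h4 : evalLetter γ c w a (Sum.inr (Sum.inl i)) = slash γ (Pi.single (a i) 1) := rfl
    have h5 : evalLetter γ c w a (Sum.inr y) = slash γ (letterVec a w y) := rfl
    rw [h4, h5, h2, smul_mul_assoc, one_mul, mul_smul_comm, h3, mul_smul_comm, smul_mul_assoc]
  · rw [evalWord_append, evalWord_cons]
    have h5 : evalLetter γ c w a (Sum.inr y) = slash γ (letterVec a w y) := rfl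
    rw [h5, mul_neg, neg_mul, smul_neg, mul_assoc]

/-- Anticommutation of slashed vectors. -/
theorem IsDirac.contractWord_swap_vec (hγ : IsDirac γ) (A B : List (Letter κ ι)) (x y : Fin 3) :
    contractWord γ (A ++ Sum.inr (Sum.inr x) :: Sum.inr (Sum.inr y) :: B) c w
      = ((2 * mdot (w x) (w y) : ℝ) : ℂ) • contractWord γ (A ++ B) c w
        - contractWord γ (A ++ Sum.inr (Sum.inr y) :: Sum.inr (Sum.inr x) :: B) c w := by
  rw [eq_sub_iff_add_eq]
  simp only [contractWord]
  rw [← Finset.sum_add_distrib, Finset.smul_sum]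
  refine Finset.sum_congr rfl fun a _ => ?_
  rw [← smul_add, smul_comm]
  congr 1
  simp only [evalWord_append, evalWord_cons]
  rw [← mul_add, ← mul_assoc (evalLetter _ _ _ _ _), ← mul_assoc (evalLetter _ _ _ _ _), ← add_mul]
  have h2 := hγ.slash_mul_slash (w x) (w y)
  have h4 : ∀ x : Fin 3, evalLetter γ c w a (Sum.inr (Sum.inr x)) = slash γ (w x) := fun _ => rfl
  rw [h4, h4, h2, smul_mul_assoc, one_mul, mul_smul_comm]

/-- Expansion of a propagator. -/
theorem contractWord_line (A B : List (Letter κ ι)) (k : κ) :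
    contractWord γ (A ++ Sum.inl k :: B) c w
      = contractWord γ (A ++ B) c w
        + ((c k).1 : ℂ) • contractWord γ (A ++ Sum.inr (Sum.inr 1) :: B) c w
        + ((c k).2 : ℂ) • contractWord γ (A ++ Sum.inr (Sum.inr 2) :: B) c w := by
  simp only [contractWord]
  rw [Finset.smul_sum, Finset.smul_sum, ← Finset.sum_add_distrib, ← Finset.sum_add_distrib]
  refine Finset.sum_congr rfl fun a _ => ?_
  rw [smul_comm ((c k).1 : ℂ), smul_comm ((c k).2 : ℂ), ← smul_add, ← smul_add]
  congr 1
  simp only [evalWord_append, evalWord_cons]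
  have h4 : ∀ x : Fin 3, evalLetter γ c w a (Sum.inr (Sum.inr x)) = slash γ (w x) := fun _ => rfl
  have h5 : evalLetter γ c w a (Sum.inl k)
      = 1 + (((c k).1 : ℂ) • slash γ (w 1) + ((c k).2 : ℂ) • slash γ (w 2)) := by
    rw [← slash_smul, ← slash_smul, ← slash_add]; rfl
  rw [h4, h4, h5]
  simp only [add_mul, mul_add, one_mul, smul_mul_assoc, mul_smul_comm, add_assoc]

end words

end QED

namespace QED

/-! ### Form factors -/

/-- The matrix element of `M` between the spinors `ψ₂` and `ψ₁`. -/
def sandwich (ψ₂ : Fin 4 → ℂ) (M : SpinorMatrix) (ψ₁ : Fin 4 → ℂ) : ℂ := ψ₂ ⬝ᵥ (M *ᵥ ψ₁)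

theorem sandwich_add (ψ₂ : Fin 4 → ℂ) (M N : SpinorMatrix) (ψ₁ : Fin 4 → ℂ) :
    sandwich ψ₂ (M + N) ψ₁ = sandwich ψ₂ M ψ₁ + sandwich ψ₂ N ψ₁ := by
  simp [sandwich, Matrix.add_mulVec, dotProduct_add]

theorem sandwich_smul (ψ₂ : Fin 4 → ℂ) (a : ℂ) (M : SpinorMatrix) (ψ₁ : Fin 4 → ℂ) :
    sandwich ψ₂ (a • M) ψ₁ = a * sandwich ψ₂ M ψ₁ := by
  simp [sandwich, Matrix.smul_mulVec, dotProduct_smul]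

theorem sandwich_neg (ψ₂ : Fin 4 → ℂ) (M : SpinorMatrix) (ψ₁ : Fin 4 → ℂ) :
    sandwich ψ₂ (-M) ψ₁ = -sandwich ψ₂ M ψ₁ := by
  simp [sandwich, Matrix.neg_mulVec]

theorem sandwich_sub (ψ₂ : Fin 4 → ℂ) (M N : SpinorMatrix) (ψ₁ : Fin 4 → ℂ) :
    sandwich ψ₂ (M - N) ψ₁ = sandwich ψ₂ M ψ₁ - sandwich ψ₂ N ψ₁ := by
  rw [sub_eq_add_neg, sandwich_add, sandwich_neg, sub_eq_add_neg]

/-- The two Dirac equations. -/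
def DiracPair (m : ℝ) (γ : Fin 4 → SpinorMatrix) (p₁ p₂ : FourVector) (ψ₁ ψ₂ : Fin 4 → ℂ) : Prop :=
  (slash γ p₁ - (m : ℂ) • (1 : SpinorMatrix)) *ᵥ ψ₁ = 0 ∧
    ψ₂ ᵥ* (slash γ p₂ - (m : ℂ) • (1 : SpinorMatrix)) = 0

section

variable {m : ℝ} {γ : Fin 4 → SpinorMatrix} {p₁ p₂ : FourVector} {ψ₁ ψ₂ : Fin 4 → ℂ}

theorem DiracPair.right (H : DiracPair m γ p₁ p₂ ψ₁ ψ₂) : slash γ p₁ *ᵥ ψ₁ = (m : ℂ) • ψ₁ := by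
  have := H.1
  rwa [Matrix.sub_mulVec, sub_eq_zero, Matrix.smul_mulVec, Matrix.one_mulVec] at this

theorem DiracPair.left (H : DiracPair m γ p₁ p₂ ψ₁ ψ₂) : ψ₂ ᵥ* slash γ p₂ = (m : ℂ) • ψ₂ := by
  have := H.2
  rwa [Matrix.vecMul_sub, sub_eq_zero, Matrix.vecMul_smul, Matrix.vecMul_one] at this

theorem DiracPair.sandwich_mul (H : DiracPair m γ p₁ p₂ ψ₁ ψ₂) (M : SpinorMatrix) :
    sandwich ψ₂ (M * slash γ p₁) ψ₁ = m * sandwich ψ₂ M ψ₁ := by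
  rw [sandwich, ← Matrix.mulVec_mulVec, H.right, Matrix.mulVec_smul, dotProduct_smul, smul_eq_mul,
    sandwich]

theorem DiracPair.mul_sandwich (H : DiracPair m γ p₁ p₂ ψ₁ ψ₂) (M : SpinorMatrix) :
    sandwich ψ₂ (slash γ p₂ * M) ψ₁ = m * sandwich ψ₂ M ψ₁ := by
  rw [sandwich, ← Matrix.mulVec_mulVec, Matrix.dotProduct_mulVec, H.left, smul_dotProduct,
    smul_eq_mul, sandwich]

/-- Squaring the Dirac equation puts `p₁` on the mass shell. The matrix element has to stay as a
factor, since for zero spinors the equations do not restrict the momenta. -/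
theorem DiracPair.mass_right (H : DiracPair m γ p₁ p₂ ψ₁ ψ₂) (hγ : IsDirac γ) (M : SpinorMatrix) :
    ((mdot p₁ p₁ : ℝ) : ℂ) * sandwich ψ₂ M ψ₁ = m ^ 2 * sandwich ψ₂ M ψ₁ := by
  rw [← sandwich_smul, show ((mdot p₁ p₁ : ℝ) : ℂ) • M = M * slash γ p₁ * slash γ p₁ by
    rw [mul_assoc, hγ.slash_sq, mul_smul_comm, mul_one], H.sandwich_mul, H.sandwich_mul]
  ring

theorem DiracPair.mass_left (H : DiracPair m γ p₁ p₂ ψ₁ ψ₂) (hγ : IsDirac γ) (M : SpinorMatrix) :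
    ((mdot p₂ p₂ : ℝ) : ℂ) * sandwich ψ₂ M ψ₁ = m ^ 2 * sandwich ψ₂ M ψ₁ := by
  rw [← sandwich_smul, show ((mdot p₂ p₂ : ℝ) : ℂ) • M = slash γ p₂ * (slash γ p₂ * M) by
    rw [← mul_assoc, hγ.slash_sq, smul_mul_assoc, one_mul], H.mul_sandwich, H.mul_sandwich]
  ring

theorem DiracPair.mdot (H : DiracPair m γ p₁ p₂ ψ₁ ψ₂) (hγ : IsDirac γ) (M : SpinorMatrix) :
    ((2 * QED.mdot p₁ p₂ : ℝ) : ℂ) * sandwich ψ₂ M ψ₁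
      = (2 * m ^ 2 - (QED.mdot (p₂ - p₁) (p₂ - p₁) : ℝ)) * sandwich ψ₂ M ψ₁ := by
  rw [mdot_sub_self]
  push_cast
  rw [sub_mul, add_mul, H.mass_left hγ, H.mass_right hγ]
  ring

end

/-- A family `Γ` of vertex functions (with parameter `c`, at unit mass) whose matrix elements between
solutions of the Dirac equations are combinations of those of the structures `S i`, with
coefficients that are smooth functions of `c` and `q²`. -/
def HasFormFactors {Θ I : Type} [NormedAddCommGroup Θ] [NormedSpace ℝ Θ] [Fintype I]
    (γ : Fin 4 → SpinorMatrix) (S : I → Fin 4 → FourVector → FourVector → SpinorMatrix)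
    (Γ : Θ → Fin 4 → FourVector → FourVector → SpinorMatrix) : Prop :=
  ∃ F : I → Θ × ℝ → ℂ, (∀ i, ContDiff ℝ 1 (F i)) ∧
    ∀ c p₁ p₂ ψ₁ ψ₂ μ, DiracPair 1 γ p₁ p₂ ψ₁ ψ₂ →
      sandwich ψ₂ (Γ c μ p₁ p₂) ψ₁
        = ∑ i, F i (c, mdot (p₂ - p₁) (p₂ - p₁)) * sandwich ψ₂ (S i μ p₁ p₂) ψ₁

section

variable {Θ I : Type} [NormedAddCommGroup Θ] [NormedSpace ℝ Θ] [Fintype I]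
  {γ : Fin 4 → SpinorMatrix} {S : I → Fin 4 → FourVector → FourVector → SpinorMatrix}
  {Γ Γ' : Θ → Fin 4 → FourVector → FourVector → SpinorMatrix}

theorem HasFormFactors.add (H : HasFormFactors γ S Γ) (H' : HasFormFactors γ S Γ') :
    HasFormFactors γ S (fun c μ p₁ p₂ => Γ c μ p₁ p₂ + Γ' c μ p₁ p₂) := by
  obtain ⟨F, hF, h1⟩ := H
  obtain ⟨F', hF', h1'⟩ := H'
  refine ⟨fun i x => F i x + F' i x, fun i => (hF i).add (hF' i), fun c p₁ p₂ ψ₁ ψ₂ μ hψ => ?_⟩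
  rw [sandwich_add, h1 _ _ _ _ _ _ hψ, h1' _ _ _ _ _ _ hψ, ← Finset.sum_add_distrib]
  exact Finset.sum_congr rfl fun i _ => by ring

/-- Multiplication by a function that agrees on the mass shell with a smooth function of `c` and
`q²`. -/
theorem HasFormFactors.mul (H : HasFormFactors γ S Γ) (f : Θ × ℝ → ℂ) (hf : ContDiff ℝ 1 f)
    (hΓ : ∀ c p₁ p₂ ψ₁ ψ₂ μ, DiracPair 1 γ p₁ p₂ ψ₁ ψ₂ → sandwich ψ₂ (Γ' c μ p₁ p₂) ψ₁
      = f (c, mdot (p₂ - p₁) (p₂ - p₁)) * sandwich ψ₂ (Γ c μ p₁ p₂) ψ₁) :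
    HasFormFactors γ S Γ' := by
  obtain ⟨F, hF, h1⟩ := H
  refine ⟨fun i x => f x * F i x, fun i => hf.mul (hF i), fun c p₁ p₂ ψ₁ ψ₂ μ hψ => ?_⟩
  rw [hΓ _ _ _ _ _ _ hψ, h1 _ _ _ _ _ _ hψ, Finset.mul_sum]
  exact Finset.sum_congr rfl fun i _ => by ring

theorem HasFormFactors.congr (H : HasFormFactors γ S Γ)
    (hΓ : ∀ c p₁ p₂ ψ₁ ψ₂ μ, DiracPair 1 γ p₁ p₂ ψ₁ ψ₂ →
      sandwich ψ₂ (Γ' c μ p₁ p₂) ψ₁ = sandwich ψ₂ (Γ c μ p₁ p₂) ψ₁) :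
    HasFormFactors γ S Γ' :=
  H.mul (fun _ => 1) contDiff_const fun c p₁ p₂ ψ₁ ψ₂ μ hψ => by rw [hΓ _ _ _ _ _ _ hψ, one_mul]

theorem HasFormFactors.smul (H : HasFormFactors γ S Γ) (f : Θ → ℂ) (hf : ContDiff ℝ 1 f) :
    HasFormFactors γ S (fun c μ p₁ p₂ => f c • Γ c μ p₁ p₂) :=
  H.mul (fun x => f x.1) (hf.comp contDiff_fst) fun c p₁ p₂ ψ₁ ψ₂ μ _ => by rw [sandwich_smul]

theorem HasFormFactors.neg (H : HasFormFactors γ S Γ) :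
    HasFormFactors γ S (fun c μ p₁ p₂ => -Γ c μ p₁ p₂) := by
  have := H.smul (fun _ => -1) contDiff_const
  simpa using this

theorem HasFormFactors.sub (H : HasFormFactors γ S Γ) (H' : HasFormFactors γ S Γ') :
    HasFormFactors γ S (fun c μ p₁ p₂ => Γ c μ p₁ p₂ - Γ' c μ p₁ p₂) := by
  simpa only [sub_eq_add_neg] using H.add H'.neg

end

/-- The structure of a scalar matrix element. -/
def scalarStructure : Unit → Fin 4 → FourVector → FourVector → SpinorMatrix := fun _ _ _ _ => 1

/-- The structures of a vector matrix element: `γ_μ` and the two momenta. -/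
def vectorStructure (γ : Fin 4 → SpinorMatrix) :
    Fin 3 → Fin 4 → FourVector → FourVector → SpinorMatrix :=
  fun i μ p₁ p₂ => ![γ μ, ((metric μ μ * p₁ μ : ℝ) : ℂ) • 1, ((metric μ μ * p₂ μ : ℝ) : ℂ) • 1] i

section

variable {Θ : Type} [NormedAddCommGroup Θ] [NormedSpace ℝ Θ]
  {γ : Fin 4 → SpinorMatrix} {Γ : Θ → Fin 4 → FourVector → FourVector → SpinorMatrix}

/-- The passage from scalar to vector structures: the anticommutator of `γ_μ` with a slashed
momentum is `2 p_μ`, and it multiplies a word without the index `μ`. -/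
theorem HasFormFactors.momentum (H : HasFormFactors γ scalarStructure Γ) (j : Fin 2) :
    HasFormFactors γ (vectorStructure γ) (fun c μ p₁ p₂ =>
      ((2 * (metric μ μ * (![p₁, p₂] j) μ) : ℝ) : ℂ) • Γ c μ p₁ p₂) := by
  obtain ⟨F, hF, h1⟩ := H
  refine ⟨fun i x => if i = j.succ then 2 * F () x else 0, fun i => ?_,
    fun c p₁ p₂ ψ₁ ψ₂ μ hψ => ?_⟩
  · dsimp only
    split_ifs
    · exact contDiff_const.mul (hF ())
    · exact contDiff_const
  · rw [sandwich_smul, h1 _ _ _ _ _ _ hψ]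
    fin_cases j <;> simp [vectorStructure, scalarStructure, sandwich_smul] <;>
      ring

end

/-- A vertex function built of words in which the vector letter occurs `n` times. -/
def ReducibleWord {Θ : Type} [NormedAddCommGroup Θ] [NormedSpace ℝ Θ] (n : ℕ)
    (γ : Fin 4 → SpinorMatrix) (Γ : Θ → Fin 4 → FourVector → FourVector → SpinorMatrix) : Prop :=
  if n = 0 then HasFormFactors γ scalarStructure Γ else HasFormFactors γ (vectorStructure γ) Γ

section

variable {κ ι : Type}

/-- The complexity of a word: propagators count twice. -/
def wordWeight (L : List (Letter κ ι)) : ℕ := (L.map (fun l => if l.isLeft then 2 else 1)).sum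

theorem wordWeight_perm {L L' : List (Letter κ ι)} (hp : L.Perm L') :
    wordWeight L = wordWeight L' := (hp.map _).sum_eq

theorem wordWeight_append (A B : List (Letter κ ι)) :
    wordWeight (A ++ B) = wordWeight A + wordWeight B := by simp [wordWeight]

theorem wordWeight_cons (l : Letter κ ι) (B : List (Letter κ ι)) :
    wordWeight (l :: B) = (if l.isLeft then 2 else 1) + wordWeight B := by simp [wordWeight]

variable [DecidableEq ι]

section

variable [Fintype ι] {γ : Fin 4 → SpinorMatrix}

/-- A word as a vertex function. -/
noncomputable def wordVertex (γ : Fin 4 → SpinorMatrix) (L : List (Letter κ ι))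
    (c : κ → ℝ × ℝ) (μ : Fin 4) (p₁ p₂ : FourVector) : SpinorMatrix :=
  contractWord γ L c ![Pi.single μ 1, p₁, p₂]

theorem sandwich_wordVertex_append_one {c : κ → ℝ × ℝ} {p₁ p₂ : FourVector} {ψ₁ ψ₂ : Fin 4 → ℂ}
    {μ : Fin 4} (H : DiracPair 1 γ p₁ p₂ ψ₁ ψ₂) (A : List (Letter κ ι)) :
    sandwich ψ₂ (wordVertex γ (A ++ [Sum.inr (Sum.inr 1)]) c μ p₁ p₂) ψ₁
      = sandwich ψ₂ (wordVertex γ A c μ p₁ p₂) ψ₁ := by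
  have : wordVertex γ (A ++ [Sum.inr (Sum.inr 1)]) c μ p₁ p₂
      = wordVertex γ A c μ p₁ p₂ * slash γ p₁ := by
    simp only [wordVertex, contractWord, Finset.sum_mul]
    refine Finset.sum_congr rfl fun a _ => ?_
    rw [evalWord_append, smul_mul_assoc]
    simp [evalWord, evalLetter, letterVec]
  rw [this, H.sandwich_mul]; simp

theorem sandwich_wordVertex_cons_two {c : κ → ℝ × ℝ} {p₁ p₂ : FourVector} {ψ₁ ψ₂ : Fin 4 → ℂ}
    {μ : Fin 4} (H : DiracPair 1 γ p₁ p₂ ψ₁ ψ₂) (A : List (Letter κ ι)) :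
    sandwich ψ₂ (wordVertex γ (Sum.inr (Sum.inr 2) :: A) c μ p₁ p₂) ψ₁
      = sandwich ψ₂ (wordVertex γ A c μ p₁ p₂) ψ₁ := by
  have : wordVertex γ (Sum.inr (Sum.inr 2) :: A) c μ p₁ p₂
      = slash γ p₂ * wordVertex γ A c μ p₁ p₂ := by
    simp only [wordVertex, contractWord, Finset.mul_sum]
    refine Finset.sum_congr rfl fun a _ => ?_
    rw [evalWord_cons, mul_smul_comm]
    simp [evalLetter, letterVec]
  rw [this, H.mul_sandwich]; simp

end

variable [DecidableEq κ]

/-- The number of occurrences of a letter in a word. -/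
def occ (l : Letter κ ι) (L : List (Letter κ ι)) : ℕ := L.countP (fun x => decide (x = l))

theorem occ_append (l : Letter κ ι) (A B : List (Letter κ ι)) :
    occ l (A ++ B) = occ l A + occ l B := by simp [occ]

theorem occ_cons (l x : Letter κ ι) (A : List (Letter κ ι)) :
    occ l (x :: A) = occ l A + if x = l then 1 else 0 := by simp [occ, List.countP_cons]

theorem occ_nil (l : Letter κ ι) : occ l [] = 0 := rfl

theorem occ_eq_zero {l : Letter κ ι} {A : List (Letter κ ι)} : occ l A = 0 ↔ l ∉ A := by
  rw [occ, List.countP_eq_zero]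
  exact ⟨fun H hl => H l hl (by simp), fun H x hx e => H (of_decide_eq_true e ▸ hx)⟩

theorem occ_perm (l : Letter κ ι) {A B : List (Letter κ ι)} (hp : A.Perm B) :
    occ l A = occ l B := hp.countP_eq _

/-- Every summation index occurs twice or not at all, and the vector letter at most once. -/
def ProperWord (L : List (Letter κ ι)) : Prop :=
  (∀ i, occ (Sum.inr (Sum.inl i)) L = 0 ∨ occ (Sum.inr (Sum.inl i)) L = 2) ∧
    occ (Sum.inr (Sum.inr 0)) L ≤ 1

theorem ProperWord.perm {L L' : List (Letter κ ι)} (H : ProperWord L) (hp : L.Perm L') :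
    ProperWord L' := by
  unfold ProperWord
  simp only [← occ_perm _ hp]
  exact H

variable [Fintype ι] [Fintype κ]

/-- The word `L` can be reduced. -/
def Reduces (γ : Fin 4 → SpinorMatrix) (L : List (Letter κ ι)) : Prop :=
  ReducibleWord (occ (Sum.inr (Sum.inr 0)) L) γ (wordVertex γ L)

/-- The step common to all anticommutations: a word equals a coefficient times a shorter word minus
the word with two letters exchanged. -/
theorem reducible_ind {Θ : Type} [NormedAddCommGroup Θ] [NormedSpace ℝ Θ]
    {γ : Fin 4 → SpinorMatrix} {Γ Γ' Γ'' : Θ → Fin 4 → FourVector → FourVector → SpinorMatrix} {n : ℕ}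
    (f : Θ × ℝ → ℂ) (hf : ContDiff ℝ 1 f)
    (H : ReducibleWord n γ Γ) (H' : ReducibleWord n γ Γ')
    (hΓ : ∀ c p₁ p₂ ψ₁ ψ₂ μ, DiracPair 1 γ p₁ p₂ ψ₁ ψ₂ → sandwich ψ₂ (Γ'' c μ p₁ p₂) ψ₁
      = f (c, mdot (p₂ - p₁) (p₂ - p₁)) * sandwich ψ₂ (Γ c μ p₁ p₂) ψ₁
        - sandwich ψ₂ (Γ' c μ p₁ p₂) ψ₁) : ReducibleWord n γ Γ'' := by
  have key : ∀ {I : Type} [Fintype I] {S : I → Fin 4 → FourVector → FourVector → SpinorMatrix},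
      HasFormFactors γ S Γ → HasFormFactors γ S Γ' → HasFormFactors γ S Γ'' := by
    intro I _ S h1 h2
    obtain ⟨F, hF, h1⟩ := h1
    obtain ⟨F', hF', h2⟩ := h2
    refine ⟨fun i x => f x * F i x - F' i x, fun i => (hf.mul (hF i)).sub (hF' i),
      fun c p₁ p₂ ψ₁ ψ₂ μ hψ => ?_⟩
    rw [hΓ _ _ _ _ _ _ hψ, h1 _ _ _ _ _ _ hψ, h2 _ _ _ _ _ _ hψ, Finset.mul_sum,
      ← Finset.sum_sub_distrib]
    exact Finset.sum_congr rfl fun i _ => by ring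
  unfold ReducibleWord at *
  split_ifs at * with hn
  · exact key H H'
  · exact key H H'

theorem ReducibleWord.congr {Θ : Type} [NormedAddCommGroup Θ] [NormedSpace ℝ Θ]
    {γ : Fin 4 → SpinorMatrix} {Γ Γ' : Θ → Fin 4 → FourVector → FourVector → SpinorMatrix} {n : ℕ}
    (H : ReducibleWord n γ Γ)
    (hΓ : ∀ c p₁ p₂ ψ₁ ψ₂ μ, DiracPair 1 γ p₁ p₂ ψ₁ ψ₂ → sandwich ψ₂ (Γ' c μ p₁ p₂) ψ₁
      = sandwich ψ₂ (Γ c μ p₁ p₂) ψ₁) : ReducibleWord n γ Γ' := by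
  unfold ReducibleWord at *
  split_ifs at * with hn
  · exact HasFormFactors.congr H hΓ
  · exact HasFormFactors.congr H hΓ

theorem ReducibleWord.zero_sub {Θ : Type} [NormedAddCommGroup Θ] [NormedSpace ℝ Θ]
    {γ : Fin 4 → SpinorMatrix} {Γ Γ' : Θ → Fin 4 → FourVector → FourVector → SpinorMatrix} {n : ℕ}
    (a : ℂ) (H : ReducibleWord n γ Γ)
    (hΓ : ∀ c p₁ p₂ ψ₁ ψ₂ μ, DiracPair 1 γ p₁ p₂ ψ₁ ψ₂ → sandwich ψ₂ (Γ' c μ p₁ p₂) ψ₁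
      = a * sandwich ψ₂ (Γ c μ p₁ p₂) ψ₁) : ReducibleWord n γ Γ' := by
  -- The factor `a` is written as `(a + 1) - 1`, with the same vertex function in both terms.
  refine reducible_ind (fun _ => a + 1) contDiff_const H H fun c p₁ p₂ ψ₁ ψ₂ μ hψ => ?_
  rw [hΓ _ _ _ _ _ _ hψ]; ring

variable {γ : Fin 4 → SpinorMatrix}

theorem reduces_of_line {A B : List (Letter κ ι)} {k : κ} (h0 : Reduces γ (A ++ B))
    (h1 : Reduces γ (A ++ Sum.inr (Sum.inr 1) :: B))
    (h2 : Reduces γ (A ++ Sum.inr (Sum.inr 2) :: B)) : Reduces γ (A ++ Sum.inl k :: B) := by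
  have key : ∀ {I : Type} [Fintype I] {S : I → Fin 4 → FourVector → FourVector → SpinorMatrix},
      HasFormFactors γ S (wordVertex γ (A ++ B)) →
      HasFormFactors γ S (wordVertex γ (A ++ Sum.inr (Sum.inr 1) :: B)) →
      HasFormFactors γ S (wordVertex γ (A ++ Sum.inr (Sum.inr 2) :: B)) →
      HasFormFactors γ S (wordVertex γ (A ++ Sum.inl k :: B)) := by
    intro I _ S h0 h1 h2
    have e1 : ContDiff ℝ 1 fun c : κ → ℝ × ℝ => (((c k).1 : ℝ) : ℂ) :=
      Complex.ofRealCLM.contDiff.comp (contDiff_fst.comp (contDiff_apply ℝ (ℝ × ℝ) k))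
    have e2 : ContDiff ℝ 1 fun c : κ → ℝ × ℝ => (((c k).2 : ℝ) : ℂ) :=
      Complex.ofRealCLM.contDiff.comp (contDiff_snd.comp (contDiff_apply ℝ (ℝ × ℝ) k))
    have := (h0.add (h1.smul _ e1)).add (h2.smul _ e2)
    refine this.congr fun c p₁ p₂ ψ₁ ψ₂ μ _ => ?_
    simp only [wordVertex]
    rw [contractWord_line]
  unfold Reduces ReducibleWord at *
  have c0 : occ (Sum.inr (Sum.inr 0)) (A ++ Sum.inl k :: B) = occ (Sum.inr (Sum.inr 0)) (A ++ B) := by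
    simp [occ_append, occ_cons]
  have c1 : occ (Sum.inr (Sum.inr 0)) (A ++ Sum.inr (Sum.inr 1) :: B)
      = occ (Sum.inr (Sum.inr 0)) (A ++ B) := by
    simp [occ_append, occ_cons]
  have c2 : occ (Sum.inr (Sum.inr 0)) (A ++ Sum.inr (Sum.inr 2) :: B)
      = occ (Sum.inr (Sum.inr 0)) (A ++ B) := by
    simp [occ_append, occ_cons]
  rw [c0]; rw [c1] at h1; rw [c2] at h2
  split_ifs at * with hn
  · exact key h0 h1 h2
  · exact key h0 h1 h2

theorem reduces_nil (γ : Fin 4 → SpinorMatrix) : Reduces γ ([] : List (Letter κ ι)) := by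
  refine ⟨fun _ _ => ∑ a : ι → Fin 4, ((∏ i, metric (a i) (a i) : ℝ) : ℂ), fun _ => contDiff_const,
    fun c p₁ p₂ ψ₁ ψ₂ μ _ => ?_⟩
  simp only [wordVertex, contractWord, evalWord, List.map_nil, List.prod_nil]
  rw [← Finset.sum_smul, sandwich_smul]
  simp [scalarStructure]

theorem reduces_vec (γ : Fin 4 → SpinorMatrix) :
    Reduces γ ([Sum.inr (Sum.inr 0)] : List (Letter κ ι)) := by
  refine ⟨fun j _ => if j = 0 then ∑ a : ι → Fin 4, ((∏ i, metric (a i) (a i) : ℝ) : ℂ) else 0,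
    fun _ => contDiff_const, fun c p₁ p₂ ψ₁ ψ₂ μ _ => ?_⟩
  simp only [wordVertex, contractWord, evalWord, List.map_cons, List.map_nil, List.prod_cons,
    List.prod_nil, evalLetter, Sum.elim_inr, letterVec, Matrix.cons_val_zero, mul_one, slash_single]
  rw [← Finset.sum_smul, sandwich_smul]
  simp [vectorStructure]

/-- Exchange of two adjacent slashed vectors, at least one of which is a momentum. -/
theorem IsDirac.reduces_swap (hγ : IsDirac γ) {A B : List (Letter κ ι)} (x y : Fin 3)
    (hxy : x ≠ 0 ∨ y ≠ 0) (hcount : occ (Sum.inr (Sum.inr 0)) (A ++ Sum.inr (Sum.inr x) :: Sum.inr (Sum.inr y) :: B) ≤ 1)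
    (h0 : Reduces γ (A ++ B))
    (h1 : Reduces γ (A ++ Sum.inr (Sum.inr y) :: Sum.inr (Sum.inr x) :: B)) :
    Reduces γ (A ++ Sum.inr (Sum.inr x) :: Sum.inr (Sum.inr y) :: B) := by
  have hp : (A ++ Sum.inr (Sum.inr y) :: Sum.inr (Sum.inr x) :: B).Perm
      (A ++ Sum.inr (Sum.inr x) :: Sum.inr (Sum.inr y) :: B) :=
    (List.Perm.swap _ _ _).append_left A
  have hc := occ_perm (Sum.inr (Sum.inr 0)) hp
  have hsw := fun c μ p₁ p₂ => hγ.contractWord_swap_vec c ![Pi.single μ 1, p₁, p₂] A B x y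
  -- If one of the letters is `γ_μ`, the anticommutator is a momentum component times a scalar word.
  -- Otherwise it is twice a product of momenta, which on the shell is `2` or `2 - q²`.
  by_cases hvec : x = 0 ∨ y = 0
  · have hAB : occ (Sum.inr (Sum.inr 0)) (A ++ B) = 0 := by
      rcases hvec with rfl | rfl <;> simp [occ_append, occ_cons] at hcount ⊢ <;> omega
    have hL : occ (Sum.inr (Sum.inr 0)) (A ++ Sum.inr (Sum.inr x) :: Sum.inr (Sum.inr y) :: B) ≠ 0 := by
      rcases hvec with rfl | rfl <;> simp [occ_append, occ_cons]
    unfold Reduces ReducibleWord at *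
    rw [if_pos hAB] at h0
    rw [hc, if_neg hL] at h1
    rw [if_neg hL]
    obtain ⟨j, hj⟩ : ∃ j : Fin 2, ∀ (μ : Fin 4) (p₁ p₂ : FourVector),
        mdot ((![Pi.single μ 1, p₁, p₂] : Fin 3 → FourVector) x)
          ((![Pi.single μ 1, p₁, p₂] : Fin 3 → FourVector) y) = metric μ μ * (![p₁, p₂] j) μ := by
      have key : ∀ x : Fin 3, x ≠ 0 → ∃ j : Fin 2, ∀ (μ : Fin 4) (p₁ p₂ : FourVector),
          (![Pi.single μ 1, p₁, p₂] : Fin 3 → FourVector) x = ![p₁, p₂] j := by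
        intro x hx
        fin_cases x
        · exact absurd rfl hx
        · exact ⟨0, fun _ _ _ => rfl⟩
        · exact ⟨1, fun _ _ _ => rfl⟩
      rcases hvec with rfl | rfl
      · obtain ⟨j, hj⟩ := key y (by simpa using hxy)
        exact ⟨j, fun μ p₁ p₂ => by rw [hj, ← mdot_single_left]; rfl⟩
      · obtain ⟨j, hj⟩ := key x (by simpa using hxy)
        exact ⟨j, fun μ p₁ p₂ => by rw [hj, ← mdot_single_left, mdot_comm]; rfl⟩
    refine ((h0.momentum j).sub h1).congr fun c p₁ p₂ ψ₁ ψ₂ μ _ => ?_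
    simp only [wordVertex]
    rw [hsw, hj]
  · push Not at hvec
    unfold Reduces at *
    have hAB : occ (Sum.inr (Sum.inr 0)) (A ++ Sum.inr (Sum.inr x) :: Sum.inr (Sum.inr y) :: B) = occ (Sum.inr (Sum.inr 0)) (A ++ B) := by
      simp [occ_append, occ_cons, hvec.1, hvec.2]
    rw [hc] at h1
    rw [← hAB] at h0
    obtain ⟨f, hf, hf'⟩ : ∃ f : (κ → ℝ × ℝ) × ℝ → ℂ, ContDiff ℝ 1 f ∧
        ∀ c p₁ p₂ ψ₁ ψ₂ μ (M : SpinorMatrix), DiracPair 1 γ p₁ p₂ ψ₁ ψ₂ →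
          ((2 * mdot ((![Pi.single μ 1, p₁, p₂] : Fin 3 → FourVector) x)
          ((![Pi.single μ 1, p₁, p₂] : Fin 3 → FourVector) y) : ℝ) : ℂ) * sandwich ψ₂ M ψ₁
            = f (c, mdot (p₂ - p₁) (p₂ - p₁)) * sandwich ψ₂ M ψ₁ := by
      have hx : x = 1 ∨ x = 2 := by have := hvec.1; omega
      have hy : y = 1 ∨ y = 2 := by have := hvec.2; omega
      have hcd : ContDiff ℝ 1 fun x : (κ → ℝ × ℝ) × ℝ => (2 * (1 : ℂ) ^ 2 - (x.2 : ℂ)) :=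
        contDiff_const.sub (Complex.ofRealCLM.contDiff.comp contDiff_snd)
      rcases hx with rfl | rfl <;> rcases hy with rfl | rfl
      · refine ⟨fun _ => 2, contDiff_const, fun c p₁ p₂ ψ₁ ψ₂ μ M H => ?_⟩
        have := H.mass_right hγ M
        simp only [Matrix.cons_val_one, Matrix.cons_val_zero, Complex.ofReal_one] at this ⊢
        push_cast
        linear_combination 2 * this
      · refine ⟨_, hcd, fun c p₁ p₂ ψ₁ ψ₂ μ M H => ?_⟩
        have := H.mdot hγ M
        simpa using this
      · refine ⟨_, hcd, fun c p₁ p₂ ψ₁ ψ₂ μ M H => ?_⟩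
        have := H.mdot hγ M
        rw [mdot_comm p₁ p₂] at this
        simpa using this
      · refine ⟨fun _ => 2, contDiff_const, fun c p₁ p₂ ψ₁ ψ₂ μ M H => ?_⟩
        have := H.mass_left hγ M
        simp only [Matrix.cons_val, Complex.ofReal_one] at this ⊢
        push_cast
        linear_combination 2 * this
    refine reducible_ind f hf h0 h1 fun c p₁ p₂ ψ₁ ψ₂ μ hψ => ?_
    rw [← hf' c p₁ p₂ ψ₁ ψ₂ μ _ hψ]
    simp only [wordVertex]
    rw [hsw, sandwich_sub, sandwich_smul]

end

end QED

/-! ### Reduction of contracted words by induction on their weight -/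

namespace QED

section

variable {κ ι : Type} [DecidableEq ι] [DecidableEq κ] [Fintype ι] [Fintype κ]
  {γ : Fin 4 → SpinorMatrix}

/-- Elimination of a contracted pair of indices. -/
theorem IsDirac.reduces_pair (hγ : IsDirac γ) {n : ℕ}
    (ih : ∀ L : List (Letter κ ι), wordWeight L < n → ProperWord L → Reduces γ L) (i : ι)
    (C : List (Letter κ ι)) (B : List (Letter κ ι)) :
    ∀ A : List (Letter κ ι), (∀ k, Sum.inl k ∉ B) →
      wordWeight (A ++ Sum.inr (Sum.inl i) :: (B ++ Sum.inr (Sum.inl i) :: C)) ≤ n →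
      ProperWord (A ++ Sum.inr (Sum.inl i) :: (B ++ Sum.inr (Sum.inl i) :: C)) →
      Reduces γ (A ++ Sum.inr (Sum.inl i) :: (B ++ Sum.inr (Sum.inl i) :: C)) := by
  induction B with
  | nil =>
    intro A _ hw hp
    have ho := hp.1 i
    simp only [List.nil_append, occ_append, occ_cons, if_true] at ho hw hp ⊢
    have hA : occ (Sum.inr (Sum.inl i)) A = 0 := by omega
    have hC : occ (Sum.inr (Sum.inl i)) C = 0 := by omega
    have hAC : Reduces γ (A ++ C) := by
      refine ih _ ?_ ⟨fun j => ?_, ?_⟩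
      · simp only [wordWeight_append, wordWeight_cons] at hw ⊢
        simp at hw
        omega
      · by_cases hj : j = i
        · subst hj; left; rw [occ_append, hA, hC]
        · have := hp.1 j
          have hne : i ≠ j := fun e => hj e.symm
          simpa [occ_append, occ_cons, hne] using this
      · have := hp.2
        simpa [occ_append, occ_cons] using this
    unfold Reduces at *
    have hc : occ (Sum.inr (Sum.inr 0)) (A ++ Sum.inr (Sum.inl i) :: Sum.inr (Sum.inl i) :: C)
        = occ (Sum.inr (Sum.inr 0)) (A ++ C) := by simp [occ_append, occ_cons]
    rw [hc]
    refine hAC.zero_sub (-2) fun c p₁ p₂ ψ₁ ψ₂ μ _ => ?_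
    simp only [wordVertex]
    rw [hγ.contractWord_pair _ _ A C i (occ_eq_zero.1 hA) (occ_eq_zero.1 hC), sandwich_smul]
  | cons y B ihB =>
    intro A hB hw hp
    obtain ⟨y, rfl⟩ : ∃ y', y = Sum.inr y' := by
      cases y with
      | inl k => exact absurd List.mem_cons_self (hB k)
      | inr y' => exact ⟨y', rfl⟩
    have ho := hp.1 i
    simp only [List.cons_append, occ_append, occ_cons, if_true] at ho
    have hy : y ≠ Sum.inl i := by
      rintro rfl
      simp at ho
      omega
    have hy' : (Sum.inr y : Letter κ ι) ≠ Sum.inr (Sum.inl i) := fun e => hy (Sum.inr_injective e)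
    rw [if_neg hy'] at ho
    have hA : occ (Sum.inr (Sum.inl i)) A = 0 := by omega
    have hB0 : occ (Sum.inr (Sum.inl i)) B = 0 := by omega
    have hC : occ (Sum.inr (Sum.inl i)) C = 0 := by omega
    have hperm : (A ++ Sum.inr (Sum.inl i) :: (Sum.inr y :: B ++ Sum.inr (Sum.inl i) :: C)).Perm
        ((A ++ [Sum.inr y]) ++ Sum.inr (Sum.inl i) :: (B ++ Sum.inr (Sum.inl i) :: C)) := by
      rw [List.append_assoc]
      exact (List.Perm.swap _ _ _).append_left A
    have h1 := ihB (A ++ [Sum.inr y]) (fun k hk => hB k (List.mem_cons_of_mem _ hk))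
      (by rwa [← wordWeight_perm hperm]) (hp.perm hperm)
    -- The anticommutator term: both occurrences of `i` are gone and `y` stands where the second one
    -- was, so the word is shorter by two letters.
    have h2 : Reduces γ ((A ++ B) ++ Sum.inr y :: C) := by
      refine ih _ ?_ ⟨fun j => ?_, ?_⟩
      · simp only [wordWeight_append, wordWeight_cons, List.cons_append] at hw ⊢
        simp at hw ⊢
        omega
      · by_cases hj : j = i
        · subst hj; left; simp [occ_append, occ_cons, hA, hB0, hC, hy]
        · have := hp.1 j
          have hne : i ≠ j := fun e => hj e.symm
          simp only [occ_append, occ_cons, List.cons_append, Sum.inr.injEq, Sum.inl.injEq, hne,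
            if_false] at this ⊢
          omega
      · have := hp.2
        simp only [occ_append, occ_cons, List.cons_append, Sum.inr.injEq, reduceCtorEq,
            if_false] at this ⊢
        omega
    unfold Reduces at *
    rw [← occ_perm _ hperm] at h1
    have hc : occ (Sum.inr (Sum.inr 0)) (A ++ Sum.inr (Sum.inl i) :: (Sum.inr y :: B ++ Sum.inr (Sum.inl i) :: C))
        = occ (Sum.inr (Sum.inr 0)) ((A ++ B) ++ Sum.inr y :: C) := by
      simp only [occ_append, occ_cons, List.cons_append, Sum.inr.injEq, reduceCtorEq, if_false]
      omega
    rw [← hc] at h2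
    refine reducible_ind (fun _ => -1) contDiff_const h2 h1 fun c p₁ p₂ ψ₁ ψ₂ μ _ => ?_
    have hsw := hγ.contractWord_swap c ![Pi.single μ 1, p₁, p₂] A (B ++ Sum.inr (Sum.inl i) :: C)
      (A ++ B) C i y hy (by simp) (by
        rw [List.mem_append]
        exact not_or_intro (occ_eq_zero.1 hA) (occ_eq_zero.1 hB0)) (occ_eq_zero.1 hC)
    have hsw' := eq_sub_of_add_eq hsw
    simp only [wordVertex, List.cons_append, List.append_assoc, List.nil_append] at hsw' ⊢
    rw [hsw', sandwich_sub, sandwich_neg]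
    ring

/-- Elimination of `p̂₁`, which is moved to the right. -/
theorem IsDirac.reduces_one (hγ : IsDirac γ) {n : ℕ}
    (ih : ∀ L : List (Letter κ ι), wordWeight L < n → ProperWord L → Reduces γ L)
    (B : List (Letter κ ι)) :
    ∀ A : List (Letter κ ι), (∀ l ∈ B, ∃ x, l = Sum.inr (Sum.inr x)) →
      wordWeight (A ++ Sum.inr (Sum.inr 1) :: B) ≤ n →
      ProperWord (A ++ Sum.inr (Sum.inr 1) :: B) → Reduces γ (A ++ Sum.inr (Sum.inr 1) :: B) := by
  induction B with
  | nil =>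
    intro A _ hw hp
    have hA : Reduces γ A := by
      refine ih _ ?_ ⟨fun j => ?_, ?_⟩
      · simp only [wordWeight_append, wordWeight_cons] at hw
        simp at hw
        omega
      · have := hp.1 j
        simpa [occ_append, occ_cons, occ_nil] using this
      · have := hp.2
        simpa [occ_append, occ_cons, occ_nil] using this
    unfold Reduces at *
    have hc : occ (Sum.inr (Sum.inr 0)) (A ++ [Sum.inr (Sum.inr 1)])
        = occ (Sum.inr (Sum.inr 0)) A := by simp [occ_append, occ_cons, occ_nil]
    rw [hc]
    exact hA.congr fun c p₁ p₂ ψ₁ ψ₂ μ H => sandwich_wordVertex_append_one H A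
  | cons y B ihB =>
    intro A hB hw hp
    obtain ⟨y, rfl⟩ := hB y List.mem_cons_self
    have hperm : (A ++ Sum.inr (Sum.inr 1) :: Sum.inr (Sum.inr y) :: B).Perm
        ((A ++ [Sum.inr (Sum.inr y)]) ++ Sum.inr (Sum.inr 1) :: B) := by
      rw [List.append_assoc]
      exact (List.Perm.swap _ _ _).append_left A
    have h1 := ihB (A ++ [Sum.inr (Sum.inr y)]) (fun k hk => hB k (List.mem_cons_of_mem _ hk))
      (by rwa [← wordWeight_perm hperm]) (hp.perm hperm)
    refine hγ.reduces_swap 1 y (Or.inl (by decide)) hp.2 (ih _ ?_ ⟨fun j => ?_, ?_⟩)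
      (by simpa using h1)
    · simp only [wordWeight_append, wordWeight_cons] at hw ⊢
      simp at hw
      omega
    · have := hp.1 j
      simpa [occ_append, occ_cons, occ_nil] using this
    · have := hp.2
      simp only [occ_append, occ_cons] at this ⊢
      omega

/-- Elimination of `p̂₂`, which is moved to the left. -/
theorem IsDirac.reduces_two (hγ : IsDirac γ) {n : ℕ}
    (ih : ∀ L : List (Letter κ ι), wordWeight L < n → ProperWord L → Reduces γ L)
    (A : List (Letter κ ι)) :
    ∀ B : List (Letter κ ι), (∀ l ∈ A, ∃ x, l = Sum.inr (Sum.inr x)) →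
      wordWeight (A ++ Sum.inr (Sum.inr 2) :: B) ≤ n →
      ProperWord (A ++ Sum.inr (Sum.inr 2) :: B) → Reduces γ (A ++ Sum.inr (Sum.inr 2) :: B) := by
  induction A using List.reverseRecOn with
  | nil =>
    intro B _ hw hp
    have hB : Reduces γ B := by
      refine ih _ ?_ ⟨fun j => ?_, ?_⟩
      · simp only [wordWeight_append, wordWeight_cons] at hw
        simp at hw
        omega
      · have := hp.1 j
        simpa [occ_append, occ_cons, occ_nil] using this
      · have := hp.2
        simpa [occ_append, occ_cons, occ_nil] using this
    unfold Reduces at *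
    have hc : occ (Sum.inr (Sum.inr 0)) ([] ++ Sum.inr (Sum.inr 2) :: B)
        = occ (Sum.inr (Sum.inr 0)) B := by simp [occ_cons]
    rw [hc]
    exact hB.congr fun c p₁ p₂ ψ₁ ψ₂ μ H => sandwich_wordVertex_cons_two H B
  | append_singleton A y ihA =>
    intro B hA hw hp
    obtain ⟨y, rfl⟩ := hA y (by simp)
    simp only [List.append_assoc, List.singleton_append] at hw hp ⊢
    have hperm : (A ++ Sum.inr (Sum.inr y) :: Sum.inr (Sum.inr 2) :: B).Perm
        (A ++ Sum.inr (Sum.inr 2) :: Sum.inr (Sum.inr y) :: B) :=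
      (List.Perm.swap _ _ _).append_left A
    have h1 := ihA (Sum.inr (Sum.inr y) :: B) (fun k hk => hA k (List.mem_append_left _ hk))
      (by rwa [← wordWeight_perm hperm]) (hp.perm hperm)
    refine hγ.reduces_swap y 2 (Or.inr (by decide)) hp.2 (ih _ ?_ ⟨fun j => ?_, ?_⟩) h1
    · simp only [wordWeight_append, wordWeight_cons] at hw ⊢
      simp at hw
      omega
    · have := hp.1 j
      simpa [occ_append, occ_cons, occ_nil] using this
    · have := hp.2
      simp only [occ_append, occ_cons] at this ⊢
      omega

/-- Every proper word can be reduced. -/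
theorem IsDirac.reduces (hγ : IsDirac γ) (L : List (Letter κ ι)) (hL : ProperWord L) :
    Reduces γ L := by
  -- The weight drops in every anticommutator, and also when a propagator (weight 2) is expanded
  -- into the unit matrix and single momenta. Propagators go first, then contracted indices, then
  -- `p̂₁` towards `ψ₁` and `p̂₂` towards `ψ₂`; in this order a letter being moved meets only
  -- letters with known anticommutators.
  induction hn : wordWeight L using Nat.strong_induction_on generalizing L with
  | _ n IH =>
  have ih : ∀ L : List (Letter κ ι), wordWeight L < n → ProperWord L → Reduces γ L :=
    fun L hw hp => IH _ hw L hp rfl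
  by_cases h1 : ∃ k, Sum.inl k ∈ L
  · obtain ⟨k, hk⟩ := h1
    obtain ⟨A, B, rfl⟩ := List.append_of_mem hk
    simp only [wordWeight_append, wordWeight_cons, Sum.isLeft_inl, if_true] at hn
    refine reduces_of_line (ih _ ?_ ⟨fun j => ?_, ?_⟩) (ih _ ?_ ⟨fun j => ?_, ?_⟩)
      (ih _ ?_ ⟨fun j => ?_, ?_⟩)
    · simp only [wordWeight_append]; omega
    · simpa [occ_append, occ_cons] using hL.1 j
    · simpa [occ_append, occ_cons] using hL.2
    · simp only [wordWeight_append, wordWeight_cons, Sum.isLeft_inr, Bool.false_eq_true, if_false]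
      omega
    · simpa [occ_append, occ_cons] using hL.1 j
    · simpa [occ_append, occ_cons] using hL.2
    · simp only [wordWeight_append, wordWeight_cons, Sum.isLeft_inr, Bool.false_eq_true, if_false]
      omega
    · simpa [occ_append, occ_cons] using hL.1 j
    · simpa [occ_append, occ_cons] using hL.2
  by_cases h2 : ∃ i, Sum.inr (Sum.inl i) ∈ L
  · obtain ⟨i, hi⟩ := h2
    have h2 := (hL.1 i).resolve_left fun e => occ_eq_zero.1 e hi
    obtain ⟨A, D, rfl, hA⟩ := List.eq_append_cons_of_mem hi
    simp only [occ_append, occ_cons, if_true, occ_eq_zero.2 hA] at h2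
    have hD : Sum.inr (Sum.inl i) ∈ D := by
      by_contra H
      rw [occ_eq_zero.2 H] at h2
      omega
    obtain ⟨B, C, rfl⟩ := List.append_of_mem hD
    refine hγ.reduces_pair ih i C B A (fun k hk => h1 ⟨k, ?_⟩) hn.le hL
    simp [hk]
  have hvec : ∀ l ∈ L, ∃ x, l = Sum.inr (Sum.inr x) := by
    intro l hl
    rcases l with k | i | x
    · exact absurd ⟨k, hl⟩ h1
    · exact absurd ⟨i, hl⟩ h2
    · exact ⟨x, rfl⟩
  by_cases h3 : Sum.inr (Sum.inr 1) ∈ L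
  · obtain ⟨A, B, rfl⟩ := List.append_of_mem h3
    exact hγ.reduces_one ih B A (fun l hl => hvec l (by simp [hl])) hn.le hL
  by_cases h4 : Sum.inr (Sum.inr 2) ∈ L
  · obtain ⟨A, B, rfl⟩ := List.append_of_mem h4
    exact hγ.reduces_two ih A B (fun l hl => hvec l (by simp [hl])) hn.le hL
  have hall : ∀ l ∈ L, l = Sum.inr (Sum.inr 0) := by
    intro l hl
    obtain ⟨x, rfl⟩ := hvec l hl
    fin_cases x
    · rfl
    · exact absurd hl h3
    · exact absurd hl h4
  -- Only letters `γ_μ` are left, and a proper word has at most one.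
  match L, hL, hall with
  | [], _, _ => exact reduces_nil γ
  | [a], _, hall =>
    rw [hall a (by simp)]
    exact reduces_vec γ
  | a :: b :: L, hL, hall =>
    have := hL.2
    rw [hall a (by simp), hall b (by simp)] at this
    simp only [occ_cons, if_true] at this
    omega

end

end QED

/-! ### The magnetic moment: existence, uniqueness, change of scale -/

namespace QED

variable {γ : Fin 4 → SpinorMatrix}

theorem sum_smul_sigma (γ : Fin 4 → SpinorMatrix) (q : FourVector) (μ : Fin 4) :
    ∑ ν, ((q ν : ℝ) : ℂ) • sigma γ μ ν = (1 / 2 : ℂ) • (γ μ * slash γ q - slash γ q * γ μ) := by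
  simp only [sigma, slash, Finset.mul_sum, Finset.sum_mul, ← Finset.sum_sub_distrib,
    Finset.smul_sum]
  refine Finset.sum_congr rfl fun ν _ => ?_
  rw [mul_smul_comm, smul_mul_assoc, ← smul_sub, smul_comm]

theorem IsDirac.mul_slash (hγ : IsDirac γ) (μ : Fin 4) (p : FourVector) :
    γ μ * slash γ p = ((2 * (metric μ μ * p μ) : ℝ) : ℂ) • 1 - slash γ p * γ μ := by
  have := hγ.slash_mul_slash (Pi.single μ 1) p
  rw [slash_single, mdot_single_left] at this
  exact eq_sub_of_add_eq this

/-- The Gordon identity. -/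
theorem DiracPair.gordon {m : ℝ} {p₁ p₂ : FourVector} {ψ₁ ψ₂ : Fin 4 → ℂ}
    (H : DiracPair m γ p₁ p₂ ψ₁ ψ₂) (hγ : IsDirac γ) (μ : Fin 4) :
    sandwich ψ₂ (∑ ν, (((p₂ - p₁) ν : ℝ) : ℂ) • sigma γ μ ν) ψ₁
      = ((metric μ μ * (p₁ μ + p₂ μ) : ℝ) : ℂ) * sandwich ψ₂ 1 ψ₁ - 2 * m * sandwich ψ₂ (γ μ) ψ₁ := by
  have e1 : slash γ p₁ * γ μ = ((2 * (metric μ μ * p₁ μ) : ℝ) : ℂ) • 1 - γ μ * slash γ p₁ := by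
    rw [hγ.mul_slash]; abel
  rw [sum_smul_sigma, slash_sub, mul_sub, sub_mul, e1, hγ.mul_slash μ p₂, sandwich_smul]
  simp only [sandwich_sub, sandwich_smul, H.sandwich_mul, H.mul_sandwich]
  push_cast
  ring

theorem sum_metric_mul (μ : Fin 4) (q : FourVector) : ∑ ν, metric μ ν * q ν = metric μ μ * q μ := by
  rw [Finset.sum_eq_single μ]
  · intro ν _ hν; simp [metric, hν.symm]
  · simp

/-- The Gordon identity trades the `σ` term for `γ_μ` and the total momentum; this is why `γ_μ`
receives the coefficient `f + g`. -/
theorem DiracPair.sandwich_formFactorMatrix {m : ℝ} (hm : 0 < m) {p₁ p₂ : FourVector}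
    {ψ₁ ψ₂ : Fin 4 → ℂ} (H : DiracPair m γ p₁ p₂ ψ₁ ψ₂) (hγ : IsDirac γ) (μ : Fin 4) (f g k : ℂ) :
    sandwich ψ₂ (formFactorMatrix m γ f g k (p₂ - p₁) μ) ψ₁
      = (f + g) * sandwich ψ₂ (γ μ) ψ₁
        + (-(g / (2 * m)) * ((metric μ μ * (p₁ μ + p₂ μ) : ℝ) : ℂ)
          + k * ((metric μ μ * (p₂ μ - p₁ μ) : ℝ) : ℂ)) * sandwich ψ₂ 1 ψ₁ := by
  have hm' : (m : ℂ) ≠ 0 := by exact_mod_cast hm.ne'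
  rw [formFactorMatrix, sandwich_add, sandwich_sub, sandwich_smul, sandwich_smul, sandwich_smul,
    H.gordon hγ, sum_metric_mul]
  simp only [Pi.sub_apply]
  field_simp
  ring

theorem HasFormFactors.exists_magneticMoment {Θ : Type} [NormedAddCommGroup Θ] [NormedSpace ℝ Θ]
    {Γ : Θ → Fin 4 → FourVector → FourVector → SpinorMatrix} (hγ : IsDirac γ)
    (H : HasFormFactors γ (vectorStructure γ) Γ) :
    ∃ A : Θ → ℂ, ContDiff ℝ 1 A ∧ ∀ c, HasMagneticMoment 1 γ (Γ c) (A c) := by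
  obtain ⟨F, hF, h1⟩ := H
  -- Comparing coefficients of `γ_μ`, `p₁` and `p₂` at unit mass gives `f + g = F 0`, `-g/2 - h = F
  -- 1` and `-g/2 + h = F 2`.
  refine ⟨fun c => -(F 1 (c, 0) + F 2 (c, 0)), ?_, fun c =>
    ⟨fun t => F 0 (c, t) + (F 1 (c, t) + F 2 (c, t)), fun t => -(F 1 (c, t) + F 2 (c, t)),
      fun t => (F 2 (c, t) - F 1 (c, t)) / 2, fun p₁ p₂ ψ₁ ψ₂ μ hψ₁ hψ₂ => ?_, ?_⟩⟩
  · have hc : ContDiff ℝ 1 fun c : Θ => (c, (0 : ℝ)) := contDiff_id.prodMk contDiff_const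
    exact (((hF 1).comp hc).add ((hF 2).comp hc)).neg
  · have hψ : DiracPair 1 γ p₁ p₂ ψ₁ ψ₂ := ⟨hψ₁, hψ₂⟩
    have h2 := h1 c p₁ p₂ ψ₁ ψ₂ μ hψ
    change sandwich _ _ _ = sandwich _ _ _
    rw [hψ.sandwich_formFactorMatrix one_pos hγ, h2]
    simp only [Fin.sum_univ_three, vectorStructure, Matrix.cons_val, sandwich_smul]
    push_cast
    ring
  · have hcont : Continuous fun t : ℝ => -(F 1 (c, t) + F 2 (c, t)) :=
      (((hF 1).continuous.comp (Continuous.prodMk_right c)).add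
        ((hF 2).continuous.comp (Continuous.prodMk_right c))).neg
    exact (hcont.tendsto 0).mono_left nhdsWithin_le_nhds

theorem IsDirac.gamma_sq (hγ : IsDirac γ) (ν : Fin 4) :
    γ ν * γ ν = ((metric ν ν : ℝ) : ℂ) • 1 := by
  have := hγ.slash_sq (Pi.single ν 1)
  rwa [slash_single, mdot_single_left, Pi.single_eq_same, mul_one] at this

/-- Any other `γ_ν` anticommutes with `γ_μ` and has square `±1`, so cyclicity makes the trace equal
to its own negative. -/
theorem IsDirac.trace_gamma (hγ : IsDirac γ) (μ : Fin 4) : (γ μ).trace = 0 := by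
  obtain ⟨ν, hν⟩ : ∃ ν : Fin 4, μ ≠ ν := ⟨μ + 1, by simp⟩
  have h1 : γ μ * γ ν = -(γ ν * γ μ) := by
    have := hγ μ ν
    simp only [metric, if_neg hν, mul_zero, Complex.ofReal_zero, zero_smul] at this
    exact eq_neg_of_add_eq_zero_left this
  have h2 : (γ μ * (γ ν * γ ν)).trace = -(γ μ * (γ ν * γ ν)).trace := by
    conv_lhs => rw [← mul_assoc, h1, neg_mul, Matrix.trace_neg, mul_assoc, Matrix.trace_mul_comm,
      mul_assoc]
  rw [self_eq_neg, hγ.gamma_sq, mul_smul_comm, mul_one, Matrix.trace_smul, smul_eq_mul,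
    mul_eq_zero] at h2
  refine h2.resolve_left fun e => ?_
  have := metric_self_mul_self ν
  rw [Complex.ofReal_eq_zero] at e
  rw [e] at this
  norm_num at this

theorem IsDirac.trace_slash (hγ : IsDirac γ) (p : FourVector) : (slash γ p).trace = 0 := by
  simp [slash, Matrix.trace_sum, Matrix.trace_smul, hγ.trace_gamma]

theorem IsDirac.trace_slash_mul (hγ : IsDirac γ) (p q : FourVector) :
    (slash γ p * slash γ q).trace = 4 * (mdot p q : ℝ) := by
  have h1 := congrArg Matrix.trace (hγ.slash_mul_slash p q)
  rw [Matrix.trace_add, Matrix.trace_mul_comm (slash γ q), Matrix.trace_smul, Matrix.trace_one,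
    Fintype.card_fin, smul_eq_mul] at h1
  push_cast at h1
  linear_combination h1 / 2

/-- Momenta on the mass shell with space-like momentum transfer. -/
theorem exists_shell_momenta (m : ℝ) {t : ℝ} (ht : t < 0) :
    ∃ p₁ p₂ : FourVector, mdot p₁ p₁ = m ^ 2 ∧ mdot p₂ p₂ = m ^ 2 ∧
      mdot (p₂ - p₁) (p₂ - p₁) = t ∧ p₁ 2 = 0 ∧ p₂ 2 = 0 ∧ p₁ 0 = p₂ 0 ∧
      m ^ 2 < p₁ 0 ^ 2 ∧ mdot p₁ p₂ = m ^ 2 - t / 2 := by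
  set s := √(-t) / 2
  have hs : s ^ 2 = -t / 4 := by
    rw [div_pow, Real.sq_sqrt (by linarith)]; norm_num
  have hE : √(m ^ 2 + s ^ 2) ^ 2 = m ^ 2 + s ^ 2 := Real.sq_sqrt (by positivity)
  -- The Breit frame: equal energies and opposite momenta `±s` along one axis, so that `q = (0, -2s,
  -- 0, 0)` and `q² = -4s² = t`.
  refine ⟨![√(m ^ 2 + s ^ 2), s, 0, 0], ![√(m ^ 2 + s ^ 2), -s, 0, 0], ?_, ?_, ?_, rfl, rfl, rfl,
    ?_, ?_⟩
  · simp [mdot_eq, Fin.sum_univ_four, metric]; nlinarith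
  · simp [mdot_eq, Fin.sum_univ_four, metric]; nlinarith
  · simp [mdot_eq, Fin.sum_univ_four, metric]; nlinarith
  · simp only [Matrix.cons_val_zero]; nlinarith
  · simp [mdot_eq, Fin.sum_univ_four, metric]; nlinarith

/-- Since `(p̂ - m)(p̂ + m) = p² - m²`, the matrix `p̂ + m` maps every spinor to a solution.
Identities between solutions thereby become matrix identities, whose traces can be taken. -/
theorem IsDirac.diracPair (hγ : IsDirac γ) {m : ℝ} {p₁ p₂ : FourVector} (h1 : mdot p₁ p₁ = m ^ 2)
    (h2 : mdot p₂ p₂ = m ^ 2) (u v : Fin 4 → ℂ) :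
    DiracPair m γ p₁ p₂ ((slash γ p₁ + (m : ℂ) • 1) *ᵥ v) (u ᵥ* (slash γ p₂ + (m : ℂ) • 1)) := by
  have e1 : ∀ (M : SpinorMatrix) (a : ℂ), (M - a • 1) * (M + a • 1) = M * M - (a * a) • 1 := by
    intro M a
    rw [sub_mul, mul_add, mul_add, smul_one_mul, smul_one_mul, mul_smul_comm, mul_one, smul_smul]
    abel
  have e2 : ∀ (M : SpinorMatrix) (a : ℂ), (M + a • 1) * (M - a • 1) = M * M - (a * a) • 1 := by
    intro M a
    rw [add_mul, mul_sub, mul_sub, smul_one_mul, smul_one_mul, mul_smul_comm, mul_one, smul_smul]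
    abel
  constructor
  · rw [Matrix.mulVec_mulVec, e1, hγ.slash_sq, h1, pow_two, Complex.ofReal_mul, sub_self,
      Matrix.zero_mulVec]
  · rw [Matrix.vecMul_vecMul, e2, hγ.slash_sq, h2, pow_two, Complex.ofReal_mul, sub_self,
      Matrix.vecMul_zero]

theorem eq_zero_of_sandwich {M : SpinorMatrix} (H : ∀ u v, sandwich u M v = 0) : M = 0 := by
  ext i j
  have := H (Pi.single i 1) (Pi.single j 1)
  simpa [sandwich] using this

theorem sandwich_vecMul_mulVec (u v : Fin 4 → ℂ) (M N K : SpinorMatrix) :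
    sandwich (u ᵥ* N) M (K *ᵥ v) = sandwich u (N * M * K) v := by
  rw [sandwich, sandwich, ← Matrix.dotProduct_mulVec, Matrix.mulVec_mulVec, Matrix.mulVec_mulVec,
    mul_assoc]

/-- The form factors are unique for space-like momentum transfer. -/
theorem IsDirac.formFactor_unique (hγ : IsDirac γ) {m : ℝ} (hm : 0 < m) {t : ℝ} (ht : t < 0)
    {f g k f' g' k' : ℂ}
    (H : ∀ p₁ p₂ ψ₁ ψ₂ μ, DiracPair m γ p₁ p₂ ψ₁ ψ₂ → mdot (p₂ - p₁) (p₂ - p₁) = t →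
      sandwich ψ₂ (formFactorMatrix m γ f g k (p₂ - p₁) μ) ψ₁
        = sandwich ψ₂ (formFactorMatrix m γ f' g' k' (p₂ - p₁) μ) ψ₁) : g = g' := by
  obtain ⟨p₁, p₂, h1, h2, hq, hp1, hp2, hp0, hE, h12⟩ := exists_shell_momenta m ht
  have hm' : (m : ℂ) ≠ 0 := by exact_mod_cast hm.ne'
  have key : ∀ μ u v, ((f + g) - (f' + g')) * sandwich u ((slash γ p₂ + (m : ℂ) • 1) * γ μ
        * (slash γ p₁ + (m : ℂ) • 1)) v
      + ((g' - g) / (2 * m) * ((metric μ μ * (p₁ μ + p₂ μ) : ℝ) : ℂ)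
        + (k - k') * ((metric μ μ * (p₂ μ - p₁ μ) : ℝ) : ℂ))
        * sandwich u ((slash γ p₂ + (m : ℂ) • 1) * (slash γ p₁ + (m : ℂ) • 1)) v = 0 := by
    intro μ u v
    have hd := hγ.diracPair h1 h2 u v
    have h3 := H _ _ _ _ μ hd hq
    rw [hd.sandwich_formFactorMatrix hm hγ, hd.sandwich_formFactorMatrix hm hγ,
      sandwich_vecMul_mulVec, sandwich_vecMul_mulVec, mul_one] at h3
    linear_combination h3
  -- At `μ = 2` both momenta have component zero and only the `γ_μ` term remains. Moving `γ₂` to the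
  -- left flips the sign of `p̂₂`, and the resulting trace `4(m² - p₁·p₂) = 2t` is not zero.
  have hα : (f + g) - (f' + g') = 0 := by
    by_contra hne
    have hM : (slash γ p₂ + (m : ℂ) • 1) * γ 2 * (slash γ p₁ + (m : ℂ) • 1) = 0 := by
      refine eq_zero_of_sandwich fun u v => ?_
      have := key 2 u v
      rw [hp1, hp2] at this
      simpa [hne] using this
    have h3 : γ 2 * slash γ p₂ = -(slash γ p₂ * γ 2) := by
      rw [hγ.mul_slash, hp2]; simp
    have hM2 : γ 2 * (((m : ℂ) • 1 - slash γ p₂) * (slash γ p₁ + (m : ℂ) • 1)) = 0 := by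
      rw [← hM, ← mul_assoc, mul_sub, h3, add_mul]
      simp [add_comm]
    have hM3 : ((m : ℂ) • 1 - slash γ p₂) * (slash γ p₁ + (m : ℂ) • 1) = 0 := by
      have := congrArg (fun N => γ 2 * N) hM2
      simp only [mul_zero] at this
      rw [← mul_assoc, hγ.gamma_sq] at this
      simpa [metric] using this
    have h4 := congrArg Matrix.trace hM3
    simp only [sub_mul, mul_add, smul_mul_assoc, mul_smul_comm, one_mul, mul_one, Matrix.trace_add,
      Matrix.trace_sub, Matrix.trace_smul, hγ.trace_slash, hγ.trace_slash_mul, Matrix.trace_one,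
      Fintype.card_fin, Matrix.trace_zero, smul_eq_mul, mul_zero] at h4
    rw [mdot_comm, h12] at h4
    have h5 : m * (m * 4) - (4 * (m ^ 2 - t / 2)) = (0 : ℝ) := by
      have h4' : ((m * (m * 4) - (4 * (m ^ 2 - t / 2)) : ℝ) : ℂ) = 0 := by
        push_cast; push_cast at h4; linear_combination h4
      exact_mod_cast h4'
    nlinarith
  -- At `μ = 0` the momentum transfer has component zero but `p₁ + p₂` has not. The remaining trace
  -- is `4(m² + p₁·p₂) = 8m² - 2t > 0`.
  by_contra hne
  have hE0 : p₁ 0 ≠ 0 := fun e => by rw [e] at hE; nlinarith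
  have hM : (slash γ p₂ + (m : ℂ) • 1) * (slash γ p₁ + (m : ℂ) • 1) = 0 := by
    refine eq_zero_of_sandwich fun u v => ?_
    have := key 0 u v
    rw [hα, ← hp0, sub_self, mul_zero, Complex.ofReal_zero, mul_zero, add_zero, zero_mul, zero_add,
      mul_eq_zero] at this
    refine this.resolve_left ?_
    refine mul_ne_zero (div_ne_zero (sub_ne_zero.2 fun e => hne e.symm) (by simpa using hm'))
      (Complex.ofReal_ne_zero.2 ?_)
    have : metric 0 0 = 1 := by simp [metric]
    rw [this, one_mul, ← two_mul]
    exact mul_ne_zero two_ne_zero hE0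
  have h4 := congrArg Matrix.trace hM
  simp only [add_mul, mul_add, smul_mul_assoc, mul_smul_comm, one_mul, mul_one, Matrix.trace_add,
    Matrix.trace_smul, hγ.trace_slash, hγ.trace_slash_mul, Matrix.trace_one,
    Fintype.card_fin, Matrix.trace_zero, smul_eq_mul, mul_zero, zero_add, add_zero] at h4
  rw [mdot_comm, h12] at h4
  have h5 : (4 * (m ^ 2 - t / 2)) + m * (m * 4) = (0 : ℝ) := by
    have h4' : (((4 * (m ^ 2 - t / 2)) + m * (m * 4) : ℝ) : ℂ) = 0 := by
      push_cast; push_cast at h4; linear_combination h4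
    exact_mod_cast h4'
  nlinarith [mul_pos hm hm]

/-- The form factor `g` is determined at every negative `q²`, and the limit is taken along these
values only. -/
theorem IsDirac.hasMagneticMoment_unique (hγ : IsDirac γ) {m : ℝ} (hm : 0 < m)
    {Γ : Fin 4 → FourVector → FourVector → SpinorMatrix} {a a' : ℂ}
    (H : HasMagneticMoment m γ Γ a) (H' : HasMagneticMoment m γ Γ a') : a = a' := by
  obtain ⟨f, g, k, h1, h2⟩ := H
  obtain ⟨f', g', k', h1', h2'⟩ := H'
  refine tendsto_nhds_unique h2 (h2'.congr' ?_)
  filter_upwards [self_mem_nhdsWithin] with t ht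
  refine (hγ.formFactor_unique hm (t := t) ht (f := f t) (k := k t) (f' := f' t) (k' := k' t)
    fun p₁ p₂ ψ₁ ψ₂ μ hψ hq => ?_).symm
  have e := h1 p₁ p₂ ψ₁ ψ₂ μ hψ.1 hψ.2
  have e' := h1' p₁ p₂ ψ₁ ψ₂ μ hψ.1 hψ.2
  rw [hq] at e e'
  exact e.symm.trans e'

theorem IsDirac.magneticMoment_eq (hγ : IsDirac γ) {m : ℝ} (hm : 0 < m)
    {Γ : Fin 4 → FourVector → FourVector → SpinorMatrix} {a : ℂ}
    (H : HasMagneticMoment m γ Γ a) : magneticMoment m γ Γ = a := by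
  have hex : ∃ a, HasMagneticMoment m γ Γ a := ⟨a, H⟩
  rw [magneticMoment, dif_pos hex]
  exact hγ.hasMagneticMoment_unique hm hex.choose_spec H

theorem mdot_smul_smul (a : ℝ) (p q : FourVector) : mdot (a • p) (a • q) = a ^ 2 * mdot p q := by
  simp only [mdot_eq, Pi.smul_apply, smul_eq_mul, Finset.mul_sum]
  exact Finset.sum_congr rfl fun μ _ => by ring

/-- Change of the mass scale. -/
theorem HasMagneticMoment.scale {m : ℝ} (hm : 0 < m)
    {Γ Γ' : Fin 4 → FourVector → FourVector → SpinorMatrix} {a : ℂ} (b : ℂ)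
    (H : HasMagneticMoment 1 γ Γ a)
    (hΓ : ∀ μ p₁ p₂, Γ' μ (m • p₁) (m • p₂) = b • Γ μ p₁ p₂) :
    HasMagneticMoment m γ Γ' (b * a) := by
  obtain ⟨f, g, k, h1, h2⟩ := H
  have hm' : (m : ℂ) ≠ 0 := by exact_mod_cast hm.ne'
  -- In units of `m` the combination `σ q / (2m)` is invariant while `q_μ` scales with `m`; hence
  -- the additional `1 / m` in the third form factor.
  refine ⟨fun t => b * f (t / m ^ 2), fun t => b * g (t / m ^ 2), fun t => b / m * k (t / m ^ 2),
    fun p₁ p₂ ψ₁ ψ₂ μ hψ₁ hψ₂ => ?_, ?_⟩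
  · obtain ⟨p₁, rfl⟩ : ∃ p, p₁ = m • p := ⟨m⁻¹ • p₁, by rw [smul_inv_smul₀ hm.ne']⟩
    obtain ⟨p₂, rfl⟩ : ∃ p, p₂ = m • p := ⟨m⁻¹ • p₂, by rw [smul_inv_smul₀ hm.ne']⟩
    rw [slash_smul, ← smul_sub] at hψ₁ hψ₂
    rw [Matrix.smul_mulVec, smul_eq_zero, or_iff_right hm'] at hψ₁
    rw [Matrix.vecMul_smul, smul_eq_zero, or_iff_right hm'] at hψ₂
    have h3 := h1 p₁ p₂ ψ₁ ψ₂ μ (by simpa using hψ₁) (by simpa using hψ₂)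
    have hm2 : m ^ 2 ≠ 0 := pow_ne_zero 2 hm.ne'
    rw [hΓ, ← smul_sub, mdot_smul_smul]
    simp only [mul_div_cancel_left₀ _ hm2]
    change sandwich _ _ _ = sandwich _ _ _ at h3
    change sandwich _ _ _ = sandwich _ _ _
    rw [sandwich_smul, h3]
    rw [formFactorMatrix, formFactorMatrix, sum_smul_sigma, sum_smul_sigma, slash_smul]
    simp only [sandwich_add, sandwich_sub, sandwich_smul, sum_metric_mul, mul_smul_comm,
      smul_mul_assoc]
    simp only [Pi.smul_apply, smul_eq_mul]
    push_cast
    field_simp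
  · refine Filter.Tendsto.const_mul b (h2.comp ?_)
    refine tendsto_nhdsWithin_iff.2 ⟨?_, ?_⟩
    · have : Filter.Tendsto (fun t : ℝ => t / m ^ 2) (𝓝 0) (𝓝 (0 / m ^ 2)) :=
        (continuous_id.div_const _).tendsto 0
      rw [zero_div] at this
      exact this.mono_left nhdsWithin_le_nhds
    · filter_upwards [self_mem_nhdsWithin] with t ht
      exact div_neg_of_neg_of_pos (b := m ^ 2) (Set.mem_Iio.1 ht) (by positivity)

end QED

/-! ### The lepton path as a contracted word -/

namespace QED

variable {γ : Fin 4 → SpinorMatrix}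

/-- Disjoint pairs `{u i, v i}`, `i : I`, of elements of `S`. -/
structure PairedSlots (S I : Type) where
  u : I → S
  v : I → S
  slot : S → Option I
  slot_u : ∀ i, slot (u i) = some i
  slot_v : ∀ i, slot (v i) = some i
  eq_or_eq : ∀ s i, slot s = some i → s = u i ∨ s = v i
  ne : ∀ i, u i ≠ v i

namespace PairedSlots

variable {S I : Type} [Fintype S] [DecidableEq S] [DecidableEq I] (σ : PairedSlots S I)

theorem filter_slot_eq (i : I) : Finset.univ.filter (fun s => σ.slot s = some i) = {σ.u i, σ.v i} := by
  ext s
  simp only [Finset.mem_filter, Finset.mem_univ, true_and, Finset.mem_insert, Finset.mem_singleton]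
  constructor
  · exact σ.eq_or_eq s i
  · rintro (rfl | rfl)
    exacts [σ.slot_u i, σ.slot_v i]

theorem card_filter_slot (i : I) : (Finset.univ.filter (fun s => σ.slot s = some i)).card = 2 := by
  rw [filter_slot_eq, Finset.card_pair (σ.ne i)]

variable [Fintype I]

theorem card_slot_ne_none :
    (Finset.univ.filter (fun s => σ.slot s ≠ none)).card = 2 * Fintype.card I := by
  have : Finset.univ.filter (fun s => σ.slot s ≠ none)
      = Finset.univ.biUnion (fun i => Finset.univ.filter (fun s => σ.slot s = some i)) := by
    ext s
    simp [Option.ne_none_iff_exists']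
  rw [this, Finset.card_biUnion]
  · simp [card_filter_slot, mul_comm]
  · intro i _ j _ hij
    rw [Function.onFun, Finset.disjoint_left]
    intro s h1 h2
    simp only [Finset.mem_filter, Finset.mem_univ, true_and] at h1 h2
    exact hij (Option.some_injective _ (h1.symm.trans h2))

/-- Contraction with the metric along the pairs. -/
theorem sum_contract (d : Fin 4) (g : (S → Fin 4) → SpinorMatrix) :
    ∑ a ∈ Finset.univ.filter (fun a : S → Fin 4 => ∀ s, σ.slot s = none → a s = d),
        ((∏ i, metric (a (σ.u i)) (a (σ.v i)) : ℝ) : ℂ) • g a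
      = ∑ x : I → Fin 4, ((∏ i, metric (x i) (x i) : ℝ) : ℂ) •
        g (fun s => (σ.slot s).elim d x) := by
  symm
  refine Finset.sum_of_injOn (fun x s => (σ.slot s).elim d x) ?_ ?_ ?_ ?_
  · intro x _ y _ hxy
    funext i
    have := congrFun hxy (σ.u i)
    simpa [σ.slot_u] using this
  · intro x _
    simp only [Finset.coe_filter, Finset.mem_univ, true_and, Set.mem_ofPred_eq]
    intro s hs
    simp [hs]
  · intro a ha hna
    simp only [Finset.mem_filter, Finset.mem_univ, true_and] at ha
    -- An assignment outside the image takes different values at the ends of some pair, and its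
    -- weight is zero because the metric is diagonal.
    obtain ⟨i, hi⟩ : ∃ i, a (σ.u i) ≠ a (σ.v i) := by
      by_contra! hall
      refine hna ⟨fun i => a (σ.u i), by simp, funext fun s => ?_⟩
      rcases hs : σ.slot s with _ | i
      · simp [hs, ha s hs]
      · rcases σ.eq_or_eq s i hs with rfl | rfl
        · simp [hs]
        · simp [hs, hall]
    rw [Finset.prod_eq_zero (Finset.mem_univ i) (by simp [metric, hi])]
    simp
  · intro x _
    simp [σ.slot_u, σ.slot_v]

end PairedSlots

/-- The product of the multipliers along the lepton path. -/
noncomputable def pathProd (γ : Fin 4 → SpinorMatrix) {n : ℕ} (a : Fin (n + 1) → Fin 4)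
    (Λ : Fin n → SpinorMatrix) : SpinorMatrix :=
  ((List.finRange n).reverse.map (fun k => γ (a k.succ) * Λ k)).prod * γ (a 0)

theorem pathProd_succ (γ : Fin 4 → SpinorMatrix) {n : ℕ} (a : Fin (n + 2) → Fin 4)
    (Λ : Fin (n + 1) → SpinorMatrix) :
    pathProd γ a Λ = γ (a (Fin.last (n + 1))) * Λ (Fin.last n)
      * pathProd γ (fun v => a v.castSucc) (fun k => Λ k.castSucc) := by
  rw [pathProd, pathProd, List.finRange_succ_last]
  simp [mul_assoc, Function.comp_def]

theorem pathProd_smul (γ : Fin 4 → SpinorMatrix) {n : ℕ} (a : Fin (n + 1) → Fin 4)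
    (Λ : Fin n → SpinorMatrix) (c : Fin n → ℂ) :
    pathProd γ a (fun k => c k • Λ k) = (∏ k, c k) • pathProd γ a Λ := by
  induction n with
  | zero => simp [pathProd]
  | succ n ih =>
    rw [pathProd_succ, pathProd_succ, ih (fun v => a v.castSucc) (fun k => Λ k.castSucc)
      (fun k => c k.castSucc), Fin.prod_univ_castSucc]
    simp only [mul_smul_comm, smul_mul_assoc, smul_smul]

/-- The word of the lepton path. -/
def pathWord {n : ℕ} {I J : Type} (σ : PairedSlots (Fin (n + 1)) I) (ρ : PairedSlots (Fin n) J) :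
    List (Letter (Fin n) (I ⊕ J)) :=
  (List.finRange n).reverse.flatMap (fun k =>
    [(σ.slot k.succ).elim (Sum.inr (Sum.inr 0)) (fun i => Sum.inr (Sum.inl (Sum.inl i))),
      (ρ.slot k).elim (Sum.inl k) (fun j => Sum.inr (Sum.inl (Sum.inr j)))]) ++
    [(σ.slot 0).elim (Sum.inr (Sum.inr 0)) (fun i => Sum.inr (Sum.inl (Sum.inl i)))]

section

variable {n : ℕ} {I J : Type} (σ : PairedSlots (Fin (n + 1)) I) (ρ : PairedSlots (Fin n) J)

theorem evalWord_pathWord (c : Fin n → ℝ × ℝ) (μ : Fin 4) (p₁ p₂ : FourVector) (a : I ⊕ J → Fin 4) :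
    evalWord γ c ![Pi.single μ 1, p₁, p₂] a (pathWord σ ρ)
      = pathProd γ (fun v => (σ.slot v).elim μ (fun i => a (Sum.inl i)))
        (fun k => (ρ.slot k).elim (1 + slash γ ((c k).1 • p₁ + (c k).2 • p₂))
          (fun j => γ (a (Sum.inr j)))) := by
  have h1 : ∀ o : Option I, evalLetter (κ := Fin n) γ c ![Pi.single μ 1, p₁, p₂] a
      (o.elim (Sum.inr (Sum.inr 0)) (fun i => Sum.inr (Sum.inl (Sum.inl i))))
      = γ (o.elim μ (fun i => a (Sum.inl i))) := by
    rintro (_ | i) <;> simp [evalLetter, letterVec, slash_single]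
  have h2 : ∀ (k : Fin n) (o : Option J), evalLetter (ι := I ⊕ J) γ c ![Pi.single μ 1, p₁, p₂] a
      (o.elim (Sum.inl k) (fun j => Sum.inr (Sum.inl (Sum.inr j))))
      = o.elim (1 + slash γ ((c k).1 • p₁ + (c k).2 • p₂)) (fun j => γ (a (Sum.inr j))) := by
    rintro k (_ | j) <;> simp [evalLetter, letterVec, slash_single]
  rw [pathWord, evalWord_append, pathProd]
  congr 1
  · rw [evalWord]
    induction (List.finRange n).reverse with
    | nil => rfl
    | cons k l ih =>
      simp only [List.flatMap_cons, List.map_append, List.prod_append, List.map_cons, List.prod_cons,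
        List.map_nil, List.prod_nil, ih, h1, h2, mul_one]
  · simp only [evalWord, List.map_cons, List.map_nil, List.prod_cons, List.prod_nil, mul_one, h1]

variable [DecidableEq I] [DecidableEq J]

theorem occ_pathWord (l : Letter (Fin n) (I ⊕ J)) : occ l (pathWord σ ρ)
    = (∑ v, if ((σ.slot v).elim (Sum.inr (Sum.inr 0)) (fun i => Sum.inr (Sum.inl (Sum.inl i))) :
        Letter (Fin n) (I ⊕ J)) = l then 1 else 0)
      + ∑ k, if (ρ.slot k).elim (Sum.inl k) (fun j => Sum.inr (Sum.inl (Sum.inr j))) = l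
        then 1 else 0 := by
  rw [pathWord, occ_append, occ_cons, occ_nil, zero_add, Fin.sum_univ_succ, add_comm, add_assoc]
  congr 1
  rw [← Finset.sum_add_distrib, Fin.sum_univ_def, occ, List.countP_flatMap, List.map_reverse,
    List.sum_reverse]
  congr 1
  refine List.map_congr_left fun k _ => ?_
  simp [List.countP_cons, add_comm]

theorem properWord_pathWord (h0 : (Finset.univ.filter (fun v => σ.slot v = none)).card ≤ 1) :
    ProperWord (pathWord σ ρ) := by
  have e1 : ∀ (o : Option I) (i : I), ((o.elim (Sum.inr (Sum.inr 0))
      (fun i => Sum.inr (Sum.inl (Sum.inl i))) : Letter (Fin n) (I ⊕ J))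
        = Sum.inr (Sum.inl (Sum.inl i))) ↔ o = some i := by
    rintro (_ | j) i <;> simp
  have e2 : ∀ (o : Option I) (j : J), ¬ ((o.elim (Sum.inr (Sum.inr 0))
      (fun i => Sum.inr (Sum.inl (Sum.inl i))) : Letter (Fin n) (I ⊕ J))
        = Sum.inr (Sum.inl (Sum.inr j))) := by
    rintro (_ | j) i <;> simp
  have e3 : ∀ (o : Option I), ((o.elim (Sum.inr (Sum.inr 0))
      (fun i => Sum.inr (Sum.inl (Sum.inl i))) : Letter (Fin n) (I ⊕ J))
        = Sum.inr (Sum.inr 0)) ↔ o = none := by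
    rintro (_ | j) <;> simp
  have e4 : ∀ (k : Fin n) (o : Option J) (i : I), ¬ ((o.elim (Sum.inl k)
      (fun j => Sum.inr (Sum.inl (Sum.inr j))) : Letter (Fin n) (I ⊕ J))
        = Sum.inr (Sum.inl (Sum.inl i))) := by
    rintro k (_ | j) i <;> simp
  have e5 : ∀ (k : Fin n) (o : Option J) (j : J), ((o.elim (Sum.inl k)
      (fun j => Sum.inr (Sum.inl (Sum.inr j))) : Letter (Fin n) (I ⊕ J))
        = Sum.inr (Sum.inl (Sum.inr j))) ↔ o = some j := by
    rintro k (_ | j) i <;> simp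
  have e6 : ∀ (k : Fin n) (o : Option J), ¬ ((o.elim (Sum.inl k)
      (fun j => Sum.inr (Sum.inl (Sum.inr j))) : Letter (Fin n) (I ⊕ J))
        = Sum.inr (Sum.inr 0)) := by
    rintro k (_ | j) <;> simp
  refine ⟨?_, ?_⟩
  · rintro (i | j)
    · right
      rw [occ_pathWord]
      simp only [e1, e4, if_false, Finset.sum_const_zero, add_zero, ← Finset.card_filter]
      exact σ.card_filter_slot i
    · right
      rw [occ_pathWord]
      simp only [e2, e5, if_false, Finset.sum_const_zero, zero_add, ← Finset.card_filter]
      exact ρ.card_filter_slot j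
  · rw [occ_pathWord]
    simp only [e3, e6, if_false, Finset.sum_const_zero, add_zero, ← Finset.card_filter]
    exact h0

variable [Fintype I] [Fintype J]

theorem wordVertex_pathWord (c : Fin n → ℝ × ℝ) (μ : Fin 4) (p₁ p₂ : FourVector) :
    wordVertex γ (pathWord σ ρ) c μ p₁ p₂
      = ∑ x : I → Fin 4, ((∏ i, metric (x i) (x i) : ℝ) : ℂ) •
        ∑ y : J → Fin 4, ((∏ j, metric (y j) (y j) : ℝ) : ℂ) •
          pathProd γ (fun v => (σ.slot v).elim μ x)
            (fun k => (ρ.slot k).elim (1 + slash γ ((c k).1 • p₁ + (c k).2 • p₂))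
              (fun j => γ (y j))) := by
  rw [wordVertex, contractWord, ← (Equiv.sumArrowEquivProdArrow I J (Fin 4)).symm.sum_comp,
    Fintype.sum_prod_type]
  refine Finset.sum_congr rfl fun x _ => ?_
  rw [Finset.smul_sum]
  refine Finset.sum_congr rfl fun y _ => ?_
  rw [evalWord_pathWord, Fintype.prod_sum_type, smul_smul, ← Complex.ofReal_mul]
  rfl

/-- The single unpaired vertex carries the free index. The word therefore contains the vector letter
exactly once, and its reduction ends in the vector structures. -/
theorem IsDirac.exists_magneticMoment_pathWord (hγ : IsDirac γ)
    (h0 : (Finset.univ.filter (fun v => σ.slot v = none)).card = 1) :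
    ∃ A : (Fin n → ℝ × ℝ) → ℂ, ContDiff ℝ 1 A ∧
      ∀ c, HasMagneticMoment 1 γ (wordVertex γ (pathWord σ ρ) c) (A c) := by
  refine HasFormFactors.exists_magneticMoment hγ ?_
  have h1 := hγ.reduces (pathWord σ ρ) (properWord_pathWord σ ρ h0.le)
  have h2 : occ (Sum.inr (Sum.inr 0)) (pathWord σ ρ) ≠ 0 := by
    obtain ⟨v, hv⟩ := Finset.card_pos.1 (h0.symm ▸ Nat.one_pos :
      0 < (Finset.univ.filter (fun v => σ.slot v = none)).card)
    rw [occ_pathWord]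
    refine (Nat.add_pos_left ?_ _).ne'
    refine Finset.sum_pos' (fun _ _ => Nat.zero_le _) ⟨v, Finset.mem_univ v, ?_⟩
    rw [(Finset.mem_filter.1 hv).2]
    simp
  unfold Reduces ReducibleWord at h1
  rwa [if_neg h2] at h1

end

end QED

/-! ### The amplitude, its scaling, and its collapse on the undeformed lepton path -/

namespace QED

variable {γ : Fin 4 → SpinorMatrix}

/-- Anticommutation produces `γ_ν (1 - p̂₁) + 2 p_ν`, and the Dirac equation removes the first term:
a propagator carrying exactly `p₁` disappears together with the vertex next to `ψ₁`. -/
theorem DiracPair.mass_mul_gamma {p₁ p₂ : FourVector} {ψ₁ ψ₂ : Fin 4 → ℂ}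
    (H : DiracPair 1 γ p₁ p₂ ψ₁ ψ₂) (hγ : IsDirac γ) (ν : Fin 4) :
    (1 + slash γ p₁) *ᵥ (γ ν *ᵥ ψ₁) = ((2 * (metric ν ν * p₁ ν) : ℝ) : ℂ) • ψ₁ := by
  have e1 : (1 + slash γ p₁) * γ ν
      = γ ν * (1 - slash γ p₁) + ((2 * (metric ν ν * p₁ ν) : ℝ) : ℂ) • 1 := by
    rw [mul_sub, hγ.mul_slash]; noncomm_ring
  rw [Matrix.mulVec_mulVec, e1, Matrix.add_mulVec, ← Matrix.mulVec_mulVec, Matrix.sub_mulVec, H.right]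
  simp [Matrix.smul_mulVec]

theorem DiracPair.gamma_mul_mass {p₁ p₂ : FourVector} {ψ₁ ψ₂ : Fin 4 → ℂ}
    (H : DiracPair 1 γ p₁ p₂ ψ₁ ψ₂) (hγ : IsDirac γ) (ν : Fin 4) :
    (ψ₂ ᵥ* γ ν) ᵥ* (1 + slash γ p₂) = ((2 * (metric ν ν * p₂ ν) : ℝ) : ℂ) • ψ₂ := by
  have e1 : γ ν * (1 + slash γ p₂)
      = (1 - slash γ p₂) * γ ν + ((2 * (metric ν ν * p₂ ν) : ℝ) : ℂ) • 1 := by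
    rw [mul_add, hγ.mul_slash]; noncomm_ring
  rw [Matrix.vecMul_vecMul, e1, Matrix.vecMul_add, ← Matrix.vecMul_vecMul, Matrix.vecMul_sub, H.left]
  simp [Matrix.vecMul_smul]

/-- The factor of the vertex `v` when the momentum along the lepton path is `p₁` before the vertex
`e` and `p₂` after it. -/
def vertexFactor (e : ℕ) (p₁ p₂ : FourVector) (v : ℕ) (ν : Fin 4) : ℝ :=
  if v < e then 2 * (metric ν ν * p₁ ν) else if v = e then 1 else 2 * (metric ν ν * p₂ ν)

theorem DiracPair.pathProd_mulVec {p₁ p₂ : FourVector} {ψ₁ ψ₂ : Fin 4 → ℂ}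
    (H : DiracPair 1 γ p₁ p₂ ψ₁ ψ₂) (hγ : IsDirac γ) (e : ℕ) {n : ℕ} (hn : n ≤ e)
    (a : Fin (n + 1) → Fin 4) :
    pathProd γ a (fun k => 1 + slash γ (if k.val < e then p₁ else p₂)) *ᵥ ψ₁
      = ((∏ v : Fin n, vertexFactor e p₁ p₂ v (a v.castSucc) : ℝ) : ℂ) •
        (γ (a (Fin.last n)) *ᵥ ψ₁) := by
  induction n with
  | zero => simp [pathProd]
  | succ n ih =>
    rw [pathProd_succ, ← Matrix.mulVec_mulVec]
    have h1 := ih (by omega) (fun v => a v.castSucc)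
    simp only [Fin.val_castSucc] at h1 ⊢
    rw [h1, Matrix.mulVec_smul, ← Matrix.mulVec_mulVec, Fin.val_last, if_pos (by omega),
      H.mass_mul_gamma hγ, Fin.prod_univ_castSucc, Matrix.mulVec_smul, smul_smul]
    simp only [vertexFactor, Fin.val_last, Fin.val_castSucc]
    rw [if_pos (show n < e by omega)]
    push_cast
    rfl

/-- Once the vertices before `e` have collapsed onto `ψ₁`, those after it collapse one by one onto
`ψ₂`, and the matrix at `e` is the only one left. -/
theorem DiracPair.sandwich_pathProd {p₁ p₂ : FourVector} {ψ₁ ψ₂ : Fin 4 → ℂ}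
    (H : DiracPair 1 γ p₁ p₂ ψ₁ ψ₂) (hγ : IsDirac γ) (e : ℕ) {n : ℕ} (hn : e ≤ n)
    (a : Fin (n + 1) → Fin 4) :
    sandwich ψ₂ (pathProd γ a (fun k => 1 + slash γ (if k.val < e then p₁ else p₂))) ψ₁
      = ((∏ v : Fin (n + 1), vertexFactor e p₁ p₂ v (a v) : ℝ) : ℂ) *
        sandwich ψ₂ (γ (a ⟨e, by omega⟩)) ψ₁ := by
  induction n, hn using Nat.le_induction with
  | base =>
    rw [sandwich, H.pathProd_mulVec hγ e le_rfl, Fin.prod_univ_castSucc, dotProduct_smul]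
    simp [vertexFactor, sandwich, Fin.last]
  | succ n hn ih =>
    have h1 := ih (fun v => a v.castSucc)
    rw [pathProd_succ]
    simp only [Fin.val_castSucc, Fin.val_last] at h1 ⊢
    rw [if_neg (by omega), sandwich, ← Matrix.mulVec_mulVec, Matrix.dotProduct_mulVec,
      ← Matrix.vecMul_vecMul, H.gamma_mul_mass hγ, smul_dotProduct, Fin.prod_univ_castSucc]
    change _ • sandwich _ _ _ = _
    simp only [Fin.val_castSucc, Fin.val_last]
    rw [h1]
    have : vertexFactor e p₁ p₂ (n + 1) (a (Fin.last (n + 1)))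
        = 2 * (metric (a (Fin.last (n + 1))) (a (Fin.last (n + 1))) * p₂ (a (Fin.last (n + 1)))) := by
      rw [vertexFactor, if_neg (by omega), if_neg (by omega)]
    rw [this]
    push_cast
    simp only [smul_eq_mul, Fin.castSucc_mk]
    ring

namespace VertexGraph

variable {h : ℕ}

/-- The vertices as the external one and the ends of the photon lines. -/
noncomputable def vertexEquiv (G : VertexGraph h) : Unit ⊕ (Fin h ⊕ Fin h) ≃ Fin (2 * h + 1) :=
  Equiv.ofBijective _ G.bij

theorem vertexEquiv_apply (G : VertexGraph h) (x : Unit ⊕ (Fin h ⊕ Fin h)) :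
    G.vertexEquiv x = Sum.elim (fun _ : Unit => G.ext) (Sum.elim G.fst G.snd) x := rfl

/-- The vertices paired by the photon lines. -/
noncomputable def photonSlots (G : VertexGraph h) : PairedSlots (Fin (2 * h + 1)) (Fin h) where
  u := G.fst
  v := G.snd
  slot := fun s => Sum.elim (fun _ => none) (Sum.elim some some) (G.vertexEquiv.symm s)
  slot_u := fun i => by
    have : G.fst i = G.vertexEquiv (Sum.inr (Sum.inl i)) := rfl
    rw [this, Equiv.symm_apply_apply]; rfl
  slot_v := fun i => by
    have : G.snd i = G.vertexEquiv (Sum.inr (Sum.inr i)) := rfl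
    rw [this, Equiv.symm_apply_apply]; rfl
  eq_or_eq := fun s i hs => by
    obtain ⟨x, rfl⟩ := G.vertexEquiv.surjective s
    rw [Equiv.symm_apply_apply] at hs
    rcases x with _ | j | j
    · simp at hs
    · left; simp only [Sum.elim_inr, Sum.elim_inl, Option.some.injEq] at hs; rw [← hs]; rfl
    · right; simp only [Sum.elim_inr, Option.some.injEq] at hs; rw [← hs]; rfl
  ne := fun i hi => by
    have : G.vertexEquiv (Sum.inr (Sum.inl i)) = G.vertexEquiv (Sum.inr (Sum.inr i)) := hi
    simpa using G.vertexEquiv.injective this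

theorem photonSlots_eq_none (G : VertexGraph h) (s : Fin (2 * h + 1)) :
    G.photonSlots.slot s = none ↔ s = G.ext := by
  obtain ⟨x, rfl⟩ := G.vertexEquiv.surjective s
  have e : G.ext = G.vertexEquiv (Sum.inl ()) := rfl
  rw [e, G.vertexEquiv.injective.eq_iff]
  simp only [photonSlots, Equiv.symm_apply_apply]
  rcases x with _ | j | j <;> simp

theorem card_photonSlots_eq_none (G : VertexGraph h) :
    (Finset.univ.filter (fun v => G.photonSlots.slot v = none)).card = 1 := by
  simp only [photonSlots_eq_none]
  rw [Finset.card_eq_one]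
  exact ⟨G.ext, by ext; simp⟩

open Classical in
/-- The lepton lines paired by `P`. -/
noncomputable def IsPairing.slots {P : Finset (Fin (2 * h) × Fin (2 * h))} (hP : IsPairing P) :
    PairedSlots (Fin (2 * h)) P where
  u := fun c => c.1.1
  v := fun c => c.1.2
  slot := fun k => if H : ∃ c : P, k = c.1.1 ∨ k = c.1.2 then some H.choose else none
  slot_u := fun c => by
    have H : ∃ c' : P, c.1.1 = c'.1.1 ∨ c.1.1 = c'.1.2 := ⟨c, Or.inl rfl⟩
    rw [dif_pos H]
    congr 1
    by_contra hne
    have h1 := hP.2 _ c.2 _ H.choose.2 fun e => hne (Subtype.ext e.symm)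
    exact H.choose_spec.elim h1.1 h1.2.1
  slot_v := fun c => by
    have H : ∃ c' : P, c.1.2 = c'.1.1 ∨ c.1.2 = c'.1.2 := ⟨c, Or.inr rfl⟩
    rw [dif_pos H]
    congr 1
    by_contra hne
    have h1 := hP.2 _ c.2 _ H.choose.2 fun e => hne (Subtype.ext e.symm)
    exact H.choose_spec.elim h1.2.2.1 h1.2.2.2
  eq_or_eq := fun s i hs => by
    split_ifs at hs with H
    rw [← Option.some_injective _ hs]
    exact H.choose_spec
  ne := fun c => (hP.1 _ c.2).ne

theorem IsPairing.slots_eq_none {P : Finset (Fin (2 * h) × Fin (2 * h))} (hP : IsPairing P)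
    (k : Fin (2 * h)) : hP.slots.slot k = none ↔ ¬ IsPaired P k := by
  simp only [IsPairing.slots, IsPaired, dite_eq_right_iff, reduceCtorEq, imp_false, Subtype.exists]
  simp

theorem IsPairing.card_filter {P : Finset (Fin (2 * h) × Fin (2 * h))} (hP : IsPairing P)
    [DecidablePred (IsPaired P)] :
    (Finset.univ.filter (fun k => IsPaired P k)).card = 2 * P.card := by
  have h1 := hP.slots.card_slot_ne_none
  simp only [ne_eq, hP.slots_eq_none, not_not, Fintype.card_coe] at h1
  convert h1

theorem IsPairing.card_le {P : Finset (Fin (2 * h) × Fin (2 * h))} (hP : IsPairing P) :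
    P.card ≤ h := by
  classical
  have h1 := Finset.card_filter_le (Finset.univ : Finset (Fin (2 * h))) (fun k => IsPaired P k)
  rw [hP.card_filter, Finset.card_univ, Fintype.card_fin] at h1
  omega

open Classical in
theorem amplitude_eq_sum_pathProd (G : VertexGraph h) (m : ℝ) {P : Finset (Fin (2 * h) × Fin (2 * h))}
    (hP : IsPairing P) (z : Line h → ℝ) (μ : Fin 4) (p₁ p₂ : FourVector) :
    G.amplitude m γ P z μ p₁ p₂
      = ∑ x : Fin h → Fin 4, ((∏ i, metric (x i) (x i) : ℝ) : ℂ) •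
        ∑ y : P → Fin 4, ((∏ j, metric (y j) (y j) : ℝ) : ℂ) •
          pathProd γ (fun v => (G.photonSlots.slot v).elim μ x)
            (fun k => G.lineFactor m γ P z p₁ p₂ (fun k => (hP.slots.slot k).elim 0 y) k) := by
  rw [amplitude, ← G.photonSlots.sum_contract μ (fun a => ∑ y : P → Fin 4,
    ((∏ j, metric (y j) (y j) : ℝ) : ℂ) • pathProd γ a
      (fun k => G.lineFactor m γ P z p₁ p₂ (fun k => (hP.slots.slot k).elim 0 y) k))]
  have e1 : Finset.univ.filter (fun a : Fin (2 * h + 1) → Fin 4 => a G.ext = μ)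
      = Finset.univ.filter (fun a => ∀ s, G.photonSlots.slot s = none → a s = μ) := by
    ext a; simp [photonSlots_eq_none]
  rw [e1]
  refine Finset.sum_congr (by congr) fun a _ => ?_
  have e2 : Finset.univ.filter (fun b : Fin (2 * h) → Fin 4 => ∀ k, ¬ IsPaired P k → b k = 0)
      = Finset.univ.filter (fun b => ∀ s, hP.slots.slot s = none → b s = 0) := by
    ext a; simp [IsPairing.slots_eq_none]
  rw [e2, ← hP.slots.sum_contract 0 (fun b => pathProd γ a
      (fun k => G.lineFactor m γ P z p₁ p₂ b k)), Finset.smul_sum]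
  refine Finset.sum_congr (by congr) fun b _ => ?_
  rw [smul_smul, ← Complex.ofReal_mul, ← Finset.prod_coe_sort P (fun c => metric (b c.1) (b c.2))]
  rfl

theorem lineFactor_eq (G : VertexGraph h) {P : Finset (Fin (2 * h) × Fin (2 * h))}
    (hP : IsPairing P) (z : Line h → ℝ) (p₁ p₂ : FourVector) (y : P → Fin 4) (k : Fin (2 * h)) :
    G.lineFactor 1 γ P z p₁ p₂ (fun k => (hP.slots.slot k).elim 0 y) k
      = (hP.slots.slot k).elim (1 + slash γ ((G.lineCoeff z k).1 • p₁ + (G.lineCoeff z k).2 • p₂))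
        (fun j => γ (y j)) := by
  rw [lineFactor, Q_div_D]
  rcases hk : hP.slots.slot k with _ | j
  · rw [if_neg ((hP.slots_eq_none k).1 hk)]; simp
  · rw [if_pos]
    · simp
    · by_contra H
      rw [(hP.slots_eq_none k).2 H] at hk
      simp at hk

/-- Shows that the amplitude depends on `z` only through `lineCoeff z`, so that estimates of the
moment become estimates of one fixed function on a compact set. -/
theorem amplitude_eq_wordVertex (G : VertexGraph h) {P : Finset (Fin (2 * h) × Fin (2 * h))}
    (hP : IsPairing P) (z : Line h → ℝ) :
    G.amplitude 1 γ P z = wordVertex γ (pathWord G.photonSlots hP.slots) (G.lineCoeff z) := by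
  funext μ p₁ p₂
  rw [amplitude_eq_sum_pathProd G 1 hP, wordVertex_pathWord]
  simp only [lineFactor_eq]

open Classical in
theorem lineFactor_smul (G : VertexGraph h) (m : ℝ) (P : Finset (Fin (2 * h) × Fin (2 * h)))
    (z : Line h → ℝ) (p₁ p₂ : FourVector) (b : Fin (2 * h) → Fin 4) (k : Fin (2 * h)) :
    G.lineFactor m γ P z (m • p₁) (m • p₂) b k
      = (if IsPaired P k then 1 else (m : ℂ)) • G.lineFactor 1 γ P z p₁ p₂ b k := by
  rw [lineFactor, lineFactor, Q_div_D, Q_div_D]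
  split_ifs
  · simp
  · rw [smul_comm _ m, smul_comm _ m, ← smul_add m, slash_smul]
    simp

/-- Each of the `2h - 2|P|` unpaired lines contributes one power of `m`. -/
theorem amplitude_smul (G : VertexGraph h) (m : ℝ) {P : Finset (Fin (2 * h) × Fin (2 * h))}
    (hP : IsPairing P) (z : Line h → ℝ) (μ : Fin 4) (p₁ p₂ : FourVector) :
    G.amplitude m γ P z μ (m • p₁) (m • p₂)
      = (m : ℂ) ^ (2 * (h - P.card)) • G.amplitude 1 γ P z μ p₁ p₂ := by
  classical
  have h1 : ∏ k, (if IsPaired P k then 1 else (m : ℂ)) = (m : ℂ) ^ (2 * (h - P.card)) := by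
    rw [Finset.prod_ite, Finset.prod_const_one, one_mul, Finset.prod_const]
    congr 1
    have h2 := Finset.card_filter_add_card_filter_not (s := (Finset.univ : Finset (Fin (2 * h))))
      (IsPaired P)
    rw [hP.card_filter, Finset.card_univ, Fintype.card_fin] at h2
    omega
  rw [amplitude_eq_sum_pathProd G m hP, amplitude_eq_sum_pathProd G 1 hP]
  simp only [lineFactor_smul, pathProd_smul, h1, Finset.smul_sum]
  refine Finset.sum_congr rfl fun x _ => Finset.sum_congr rfl fun y _ => ?_
  simp only [smul_smul]
  congr 1
  ring

theorem prod_vertices (G : VertexGraph h) (μ : Fin 4) (x : Fin h → Fin 4)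
    (s : Fin (2 * h + 1) → Fin 4 → ℝ) :
    ∏ v, s v ((G.photonSlots.slot v).elim μ x)
      = s G.ext μ * ∏ i, (s (G.fst i) (x i) * s (G.snd i) (x i)) := by
  rw [← G.vertexEquiv.prod_comp, Fintype.prod_sum_type, Fintype.prod_sum_type,
    Finset.prod_mul_distrib]
  have e0 : G.photonSlots.slot G.ext = none := (G.photonSlots_eq_none _).2 rfl
  have e1 : ∀ i, G.photonSlots.slot (G.fst i) = some i := G.photonSlots.slot_u
  have e2 : ∀ i, G.photonSlots.slot (G.snd i) = some i := G.photonSlots.slot_v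
  simp [vertexEquiv_apply, e0, e1, e2]

/-- Two collapsed vertices contracted along a photon line give `4 p·p'`, a function of `q²` on the
shell. The matrix element stays as a factor for the reason given at `DiracPair.mass_right`. -/
theorem exists_vertexFactor_contract (hγ : IsDirac γ) (e u v : ℕ) (hu : u ≠ e) (hv : v ≠ e) :
    ∃ d : ℝ → ℂ, ∀ p₁ p₂ ψ₁ ψ₂ M, DiracPair 1 γ p₁ p₂ ψ₁ ψ₂ →
      ((∑ ν, metric ν ν * (vertexFactor e p₁ p₂ u ν * vertexFactor e p₁ p₂ v ν) : ℝ) : ℂ)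
        * sandwich ψ₂ M ψ₁ = d (mdot (p₂ - p₁) (p₂ - p₁)) * sandwich ψ₂ M ψ₁ := by
  have key : ∀ p q : FourVector, ∑ ν, metric ν ν * ((2 * (metric ν ν * p ν)) *
      (2 * (metric ν ν * q ν))) = 4 * mdot p q := by
    intro p q
    rw [mdot_eq, Finset.mul_sum]
    refine Finset.sum_congr rfl fun ν _ => ?_
    linear_combination 4 * metric ν ν * p ν * q ν * metric_self_mul_self ν
  rcases lt_or_gt_of_ne hu with hu | hu <;> rcases lt_or_gt_of_ne hv with hv | hv
  · refine ⟨fun _ => 4, fun p₁ p₂ ψ₁ ψ₂ M H => ?_⟩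
    simp only [vertexFactor, if_pos hu, if_pos hv, key]
    have := H.mass_right hγ M
    push_cast at this ⊢
    linear_combination 4 * this
  · refine ⟨fun t => 4 * (1 - t / 2), fun p₁ p₂ ψ₁ ψ₂ M H => ?_⟩
    simp only [vertexFactor, if_pos hu, if_neg hv.ne', if_neg hv.not_gt, key]
    have := H.mdot hγ M
    push_cast at this ⊢
    linear_combination 2 * this
  · refine ⟨fun t => 4 * (1 - t / 2), fun p₁ p₂ ψ₁ ψ₂ M H => ?_⟩
    simp only [vertexFactor, if_pos hv, if_neg hu.ne', if_neg hu.not_gt, key, mdot_comm p₂ p₁]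
    have := H.mdot hγ M
    push_cast at this ⊢
    linear_combination 2 * this
  · refine ⟨fun _ => 4, fun p₁ p₂ ψ₁ ψ₂ M H => ?_⟩
    simp only [vertexFactor, if_neg hu.ne', if_neg hu.not_gt, if_neg hv.ne', if_neg hv.not_gt, key]
    have := H.mass_left hγ M
    push_cast at this ⊢
    linear_combination 4 * this

theorem sandwich_sum {I : Type*} (s : Finset I) (f : I → SpinorMatrix) (ψ₂ ψ₁ : Fin 4 → ℂ) :
    sandwich ψ₂ (∑ i ∈ s, f i) ψ₁ = ∑ i ∈ s, sandwich ψ₂ (f i) ψ₁ := by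
  classical
  induction s using Finset.induction_on with
  | empty => simp [sandwich]
  | insert i s hi ih => rw [Finset.sum_insert hi, Finset.sum_insert hi, sandwich_add, ih]

/-- The undeformed lepton path does not contribute to the magnetic moment. -/
theorem hasMagneticMoment_pathCoeff (G : VertexGraph h) (hγ : IsDirac γ)
    (hP : IsPairing (∅ : Finset (Fin (2 * h) × Fin (2 * h)))) :
    HasMagneticMoment 1 γ (wordVertex γ (pathWord G.photonSlots hP.slots) G.pathCoeff) 0 := by
  classical
  have hne : ∀ i, (G.fst i).val ≠ G.ext.val ∧ (G.snd i).val ≠ G.ext.val := by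
    intro i
    constructor
    · intro e
      have := (G.photonSlots_eq_none (G.fst i)).2 (Fin.ext e)
      rw [show G.fst i = G.photonSlots.u i from rfl, G.photonSlots.slot_u] at this
      simp at this
    · intro e
      have := (G.photonSlots_eq_none (G.snd i)).2 (Fin.ext e)
      rw [show G.snd i = G.photonSlots.v i from rfl, G.photonSlots.slot_v] at this
      simp at this
  choose d hd using fun i => exists_vertexFactor_contract hγ G.ext (G.fst i) (G.snd i)
    (hne i).1 (hne i).2
  -- The whole amplitude is a function of `q²` times `γ_μ`, so the other two form factors may be
  -- taken to be zero.
  refine ⟨fun t => ∏ i, d i t, fun _ => 0, fun _ => 0, fun p₁ p₂ ψ₁ ψ₂ μ h1 h2 => ?_,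
    tendsto_const_nhds⟩
  have H : DiracPair 1 γ p₁ p₂ ψ₁ ψ₂ := ⟨h1, h2⟩
  change sandwich _ _ _ = sandwich _ _ _
  have e1 : ∀ k : Fin (2 * h), (1 : SpinorMatrix) + slash γ ((G.pathCoeff k).1 • p₁
      + (G.pathCoeff k).2 • p₂) = 1 + slash γ (if k.val < G.ext.val then p₁ else p₂) := by
    intro k
    rw [pathCoeff]; split_ifs <;> simp
  have e2 : ∀ k, hP.slots.slot k = none := fun k => by
    rw [hP.slots_eq_none]; simp [IsPaired]
  rw [wordVertex_pathWord]
  simp only [e2, Option.elim_none, e1, Finset.univ_unique, Finset.sum_singleton]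
  simp only [Finset.univ_eq_empty, Finset.prod_empty, Complex.ofReal_one, one_smul]
  rw [sandwich_sum]
  have e3 : ∀ x : Fin h → Fin 4, sandwich ψ₂ (((∏ i, metric (x i) (x i) : ℝ) : ℂ) •
      pathProd γ (fun v => (G.photonSlots.slot v).elim μ x)
        (fun k => 1 + slash γ (if k.val < G.ext.val then p₁ else p₂))) ψ₁
      = ((∏ i, (metric (x i) (x i) * (vertexFactor G.ext p₁ p₂ (G.fst i) (x i)
        * vertexFactor G.ext p₁ p₂ (G.snd i) (x i))) : ℝ) : ℂ) * sandwich ψ₂ (γ μ) ψ₁ := by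
    intro x
    rw [sandwich_smul, H.sandwich_pathProd hγ G.ext (Nat.lt_succ_iff.1 G.ext.2),
      G.prod_vertices μ x (fun v => vertexFactor G.ext p₁ p₂ v)]
    simp only [Finset.prod_mul_distrib]
    have e4 : G.photonSlots.slot ⟨G.ext.val, by omega⟩ = none := by
      rw [photonSlots_eq_none]
    rw [e4]
    simp only [vertexFactor, lt_irrefl, if_true, if_false, Option.elim_none]
    push_cast
    ring
  rw [Finset.sum_congr rfl fun x _ => e3 x, ← Finset.sum_mul, ← Complex.ofReal_sum]
  have e5 := (Finset.prod_univ_sum (fun _ : Fin h => (Finset.univ : Finset (Fin 4)))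
    (fun i ν => metric ν ν * (vertexFactor G.ext p₁ p₂ (G.fst i) ν
        * vertexFactor G.ext p₁ p₂ (G.snd i) ν))).symm
  rw [Fintype.piFinset_univ] at e5
  rw [e5]
  -- The shell values hold only in front of the matrix element, so they are inserted one photon line
  -- at a time.
  have e6 : ∀ s : Finset (Fin h), ((∏ i ∈ s, ∑ ν, metric ν ν * (vertexFactor G.ext p₁ p₂ (G.fst i) ν
        * vertexFactor G.ext p₁ p₂ (G.snd i) ν) : ℝ) : ℂ) * sandwich ψ₂ (γ μ) ψ₁
      = (∏ i ∈ s, d i (mdot (p₂ - p₁) (p₂ - p₁))) * sandwich ψ₂ (γ μ) ψ₁ := by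
    intro s
    induction s using Finset.induction_on with
    | empty => simp
    | insert i s hi ih =>
      rw [Finset.prod_insert hi, Finset.prod_insert hi, Complex.ofReal_mul, mul_assoc, ih,
        mul_left_comm, hd i p₁ p₂ ψ₁ ψ₂ _ H]
      ring
  rw [e6, formFactorMatrix]
  simp [sandwich_smul]

end VertexGraph
end QED

/-! ### Power counting by levels of the logarithms -/

namespace QED

/-- Weights with nonnegative sums below every level and total zero. -/
theorem sum_mul_nonpos_of_levels {J : Type*} [Fintype J] (α y : J → ℝ) (h0 : ∑ j, α j = 0)
    (hl : ∀ τ, 0 ≤ ∑ j, if y j < τ then α j else 0) : ∑ j, α j * y j ≤ 0 := by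
  obtain ⟨R, hR⟩ : ∃ R : ℝ, ∀ j, |y j| ≤ R :=
    ⟨∑ j, |y j|, fun j => Finset.single_le_sum (f := fun j => |y j|) (fun _ _ => abs_nonneg _)
      (Finset.mem_univ j)⟩
  have h1 : ∀ j, IntervalIntegrable (fun τ => if y j < τ then α j else 0) volume (-R) R := by
    intro j
    have : (fun τ => if y j < τ then α j else 0) = (Set.Ioi (y j)).indicator fun _ => α j := by
      ext τ; simp [Set.indicator_apply]
    rw [this, intervalIntegrable_iff]
    exact (integrableOn_const (by simp) (by simp)).indicator measurableSet_Ioi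
  -- Layer cake: integrating the weight below `τ` over `[-R, R]` gives `∑ α_j (R - y_j)`, and `R`
  -- drops out because the total weight is zero.
  have h2 : ∀ j, ∫ τ in (-R)..R, (if y j < τ then α j else 0) = α j * (R - y j) := by
    intro j
    have hj := abs_le.1 (hR j)
    rw [← intervalIntegral.integral_add_adjacent_intervals (b := y j)
      ((h1 j).mono_set (by
        rw [Set.uIcc_of_le hj.1, Set.uIcc_of_le (hj.1.trans hj.2)]
        exact Set.Icc_subset_Icc_right hj.2))
      ((h1 j).mono_set (by
        rw [Set.uIcc_of_le hj.2, Set.uIcc_of_le (hj.1.trans hj.2)]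
        exact Set.Icc_subset_Icc_left hj.1))]
    have e1 : ∫ τ in (-R)..(y j), (if y j < τ then α j else 0) = ∫ τ in (-R)..(y j), (0 : ℝ) := by
      refine intervalIntegral.integral_congr_ae (Filter.Eventually.of_forall fun τ hτ => ?_)
      rw [Set.uIoc_of_le hj.1] at hτ
      exact if_neg hτ.2.not_gt
    have e2 : ∫ τ in (y j)..R, (if y j < τ then α j else 0) = ∫ τ in (y j)..R, α j := by
      refine intervalIntegral.integral_congr_ae (Filter.Eventually.of_forall fun τ hτ => ?_)
      rw [Set.uIoc_of_le hj.2] at hτ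
      exact if_pos hτ.1
    rw [e1, e2]
    simp [mul_comm]
  have hR' : -R ≤ R ∨ IsEmpty J := by
    rcases isEmpty_or_nonempty J with hJ | ⟨⟨j⟩⟩
    · exact Or.inr hJ
    · left; have := abs_le.1 (hR j); linarith
  rcases hR' with hR' | hJ
  · have h3 : 0 ≤ ∫ τ in (-R)..R, ∑ j, (if y j < τ then α j else 0) :=
      intervalIntegral.integral_nonneg hR' fun τ _ => hl τ
    rw [intervalIntegral.integral_finsetSum fun j _ => h1 j] at h3
    simp only [h2, mul_sub, Finset.sum_sub_distrib, ← Finset.sum_mul, h0, zero_mul] at h3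
    linarith
  · simp

end QED

namespace QED
namespace VertexGraph

variable {h : ℕ}

theorem card_filter_line (p : Line h → Prop) [DecidablePred p] :
    (Finset.univ.filter p).card = (Finset.univ.filter (fun k => p (Sum.inl k))).card
      + (Finset.univ.filter (fun i => p (Sum.inr i))).card := by
  simp only [Finset.card_filter, Fintype.sum_sum_type]

theorem leptonCard_filter (p : Line h → Prop) [DecidablePred p] :
    leptonCard (Finset.univ.filter p) = (Finset.univ.filter (fun k => p (Sum.inl k))).card := by
  rw [leptonCard, Finset.filter_filter, card_filter_line]
  simp

theorem card_sdiff_leptonPath (p : Line h → Prop) [DecidablePred p] :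
    (Finset.univ.filter p \ leptonPath h).card
      = (Finset.univ.filter (fun i => p (Sum.inr i))).card := by
  rw [Finset.sdiff_eq_filter, Finset.filter_filter, card_filter_line]
  simp [inl_mem_leptonPath, inr_notMem_leptonPath]

/-- The sum of the weights `1` on a tree and `-1` off it. -/
theorem sum_tree_weight (T s : Finset (Line h)) :
    ∑ l ∈ s, (if l ∈ T then (1 : ℝ) else -1) = s.card - 2 * (s \ T).card := by
  have h1 : ∀ l, (if l ∈ T then (1 : ℝ) else -1) = 1 - 2 * if l ∉ T then 1 else 0 := by
    intro l; split_ifs <;> norm_num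
  simp_rw [h1, Finset.sum_sub_distrib, ← Finset.mul_sum, Finset.sdiff_eq_filter,
    Finset.sum_boole]
  simp

theorem card_sdiff_add {T : Finset (Line h)} {G : VertexGraph h} (hT : G.IsOneTree T)
    (s : Finset (Line h)) : (s \ T).card + (sᶜ \ T).card = h := by
  have h1 := Finset.card_inter_add_card_sdiff s T
  have h2 := Finset.card_inter_add_card_sdiff sᶜ T
  have h3 := Finset.card_add_card_compl s
  have h4 : (s ∩ T).card + (sᶜ ∩ T).card = T.card := by
    rw [Finset.inter_comm s, Finset.inter_comm sᶜ, ← Finset.sdiff_eq_inter_compl]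
    exact Finset.card_inter_add_card_sdiff T s
  rw [hT.card_eq] at h4
  simp only [Fintype.card_sum, Fintype.card_fin] at h3
  omega

/-- A subgraph that is not divergent has degree of divergence at most `-1/2`. -/
theorem NoUVDivergentSubgraphs.le_neg_half {G : VertexGraph h} (hG : G.NoUVDivergentSubgraphs)
    {s T : Finset (Line h)} (hs : s ≠ ∅) (hs' : s ≠ Finset.univ)
    (hmin : ∀ T', G.IsOneTree T' → (s \ T).card ≤ (s \ T').card) :
    2 * ((s \ T).card : ℝ) - s.card + 1 / 2 * leptonCard s ≤ -(1 / 2) := by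
  obtain ⟨T', hT', e⟩ : ∃ T', G.IsOneTree T' ∧ (s \ T').card = G.nloops s :=
    Nat.sInf_mem (s := {n | ∃ T, G.IsOneTree T ∧ (s \ T).card = n})
      ⟨_, leptonPath h, G.leptonPath_isOneTree, rfl⟩
  have h1 := hG s hs hs'
  have h2 := hmin T' hT'
  rw [e] at h2
  rw [omega] at h1
  -- `2ω` is an integer, so negativity improves to `ω ≤ -1/2`.
  have h3 : (4 * (G.nloops s) + leptonCard s : ℝ) < 2 * s.card := by linarith
  have h4 : 4 * G.nloops s + leptonCard s < 2 * s.card := by exact_mod_cast h3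
  have h5 : 4 * (s \ T).card + leptonCard s + 1 ≤ 2 * s.card := by omega
  have h6 : (4 * ((s \ T).card : ℝ) + leptonCard s + 1) ≤ 2 * s.card := by exact_mod_cast h5
  linarith

/-- The weights of the photon lines above a level. -/
theorem half_le_sum_photons (G : VertexGraph h) (hG : G.NoUVDivergentSubgraphs)
    {x : Line h → ℝ} {X τ xl xmin xmax : ℝ} (hX : X < τ)
    {km : Fin h → Fin (2 * h)} (hkm : ∀ i k, G.Crosses i k → x (Sum.inl k) ≤ x (Sum.inl (km i)))
    (hsoft : ∀ i, x (Sum.inl (km i)) ≤ X ∨ 2 * x (Sum.inl (km i)) ≤ X + x (Sum.inr i))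
    {lst : Fin h} (hlst : ∀ i, x (Sum.inr i) ≤ x (Sum.inr lst))
    {θ : Fin h → ℝ} (hθ : ∀ i, θ i = if X < x (Sum.inl (km i)) then (if i = lst then 1 / 2 else 1)
      else 0)
    (hl : ∃ k, x (Sum.inl k) = xl) (hmin : ∃ l, x l = xmin) (hmax' : ∃ l, x l = xmax) :
    ((Finset.univ.filter (fun k => τ ≤ x (Sum.inl k))).card : ℝ)
        + (if xmin < τ then 1 / 2 else 0) - (if xmax < τ then 1 / 2 else 0)
        - (if τ ≤ xl then 1 / 2 else 0)
      ≤ ∑ i, ((if τ ≤ x (Sum.inr i) then 1 else 0)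
        + θ i * (2 * (if τ ≤ x (Sum.inl (km i)) then 1 else 0)
          - if τ ≤ x (Sum.inr i) then 1 else 0)) := by
  classical
  set K := Finset.univ.filter (fun k => τ ≤ x (Sum.inl k)) with hK
  set c := Finset.univ.filter (fun i => τ ≤ x (Sum.inl (km i))) with hc
  set f : Fin h → ℝ := fun i => (if τ ≤ x (Sum.inr i) then 1 else 0)
        + θ i * (2 * (if τ ≤ x (Sum.inl (km i)) then 1 else 0)
          - if τ ≤ x (Sum.inr i) then 1 else 0) with hf
  have hη : ∀ i, τ ≤ x (Sum.inl (km i)) → τ ≤ x (Sum.inr i) := by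
    intro i hi
    rcases hsoft i with h1 | h1 <;> linarith
  have hθ0 : ∀ i, 0 ≤ θ i ∧ θ i ≤ 1 := by
    intro i; rw [hθ]; split_ifs <;> norm_num
  -- A photon line over some lepton line at or above `τ` counts `2`, reduced by `1/2` for the
  -- topmost photon line.
  have f1 : ∀ i ∈ c, f i = 2 - if i = lst then 1 / 2 else 0 := by
    intro i hi
    have hi' := (Finset.mem_filter.1 hi).2
    simp only [hf, if_pos hi', if_pos (hη i hi')]
    rw [hθ, if_pos (by linarith)]
    split_ifs <;> norm_num
  have f2 : ∀ i ∉ c, f i = (1 - θ i) * if τ ≤ x (Sum.inr i) then 1 else 0 := by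
    intro i hi
    have hi' : ¬ τ ≤ x (Sum.inl (km i)) := fun e => hi (Finset.mem_filter.2 ⟨Finset.mem_univ i, e⟩)
    simp only [hf, if_neg hi']
    ring
  have f2' : ∀ i ∉ c, 0 ≤ f i := by
    intro i hi
    rw [f2 i hi]
    have := hθ0 i
    split_ifs <;> linarith
  have f3 : ∑ i, f i = ∑ i ∈ c, f i + ∑ i ∈ cᶜ, f i := (Finset.sum_add_sum_compl c f).symm
  have f4 : 0 ≤ ∑ i ∈ cᶜ, f i := Finset.sum_nonneg fun i hi => f2' i (Finset.mem_compl.1 hi)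
  have f5 : 2 * (c.card : ℝ) - 1 / 2 ≤ ∑ i ∈ c, f i := by
    rw [Finset.sum_congr rfl f1, Finset.sum_sub_distrib, Finset.sum_const, Finset.sum_ite_eq']
    simp only [nsmul_eq_mul]
    split_ifs <;> linarith
  rw [f3]
  have b1 : (if xmin < τ then (1 / 2 : ℝ) else 0) ≤ 1 / 2 := by split_ifs <;> norm_num
  have b2 : 0 ≤ (if xmax < τ then (1 / 2 : ℝ) else 0) := by split_ifs <;> norm_num
  have b3 : 0 ≤ (if τ ≤ xl then (1 / 2 : ℝ) else 0) := by split_ifs <;> norm_num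
  -- With no lepton line above `τ`, the `1/2` needed unless `xmax < τ` comes from the topmost photon
  -- line, where `θ ≤ 1/2`. With all of them above, the ultraviolet condition says nothing, and the
  -- missing `1/2` is supplied by the `xl` term. In between, `|K| + 1 ≤ 2|c|` gives `2|c| - 1/2 ≥
  -- |K| + 1/2`.
  rcases K.eq_empty_or_nonempty with hK0 | hK0
  · have hc0 : c = ∅ := by
      rw [Finset.eq_empty_iff_forall_notMem]
      intro i hi
      have : km i ∈ K := Finset.mem_filter.2 ⟨Finset.mem_univ _, (Finset.mem_filter.1 hi).2⟩
      rw [hK0] at this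
      simp at this
    rw [hK0, hc0]
    rw [hc0] at f4 f2
    simp only [Finset.card_empty, Nat.cast_zero, Finset.sum_empty]
    by_cases hx : xmax < τ
    · rw [if_pos hx]; linarith
    · rw [if_neg hx]
      have h1 : τ ≤ x (Sum.inr lst) := by
        obtain ⟨l, hl'⟩ := hmax'
        rcases l with k | i
        · exfalso
          have : k ∈ K := Finset.mem_filter.2 ⟨Finset.mem_univ _, by rw [hl']; linarith⟩
          rw [hK0] at this
          simp at this
        · have := hlst i
          linarith
      have h2 : 1 / 2 ≤ f lst := by
        rw [f2 lst (by simp), if_pos h1, hθ, if_pos rfl]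
        split_ifs <;> norm_num
      have h3 : f lst ≤ ∑ i ∈ (∅ : Finset (Fin h))ᶜ, f i :=
        Finset.single_le_sum (f := f) (fun i _ => f2' i (by rw [hc0]; simp)) (by simp)
      linarith
  · by_cases hK1 : K = Finset.univ
    · have hc1 : c = Finset.univ := by
        ext i
        have : km i ∈ K := by rw [hK1]; simp
        simp [hc, (Finset.mem_filter.1 this).2]
      have h1 : ¬ xmin < τ := by
        obtain ⟨l, rfl⟩ := hmin
        rw [not_lt]
        rcases l with k | i
        · have : k ∈ K := by rw [hK1]; simp
          exact (Finset.mem_filter.1 this).2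
        · have : i ∈ c := by rw [hc1]; simp
          exact hη i (Finset.mem_filter.1 this).2
      have h2 : τ ≤ xl := by
        obtain ⟨k, rfl⟩ := hl
        have : k ∈ K := by rw [hK1]; simp
        exact (Finset.mem_filter.1 this).2
      rw [if_neg h1, if_pos h2]
      have h3 : (K.card : ℝ) = 2 * h := by rw [hK1]; simp
      have h4 : (c.card : ℝ) = h := by rw [hc1]; simp
      linarith
    · have h1 := G.card_lt_two_mul_crossing hG K hK0 hK1 c (by
        intro i hi k hk hcr
        have := hkm i k hcr
        exact hi (Finset.mem_filter.2 ⟨Finset.mem_univ _, (Finset.mem_filter.1 hk).2.trans this⟩))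
      have h2 : (K.card : ℝ) + 1 ≤ 2 * c.card := by exact_mod_cast h1
      linarith

/-- The bound for the integrand, in terms of the logarithms of the parameters. -/
theorem level_bound (G : VertexGraph h) (hh : 1 ≤ h) (hG : G.NoUVDivergentSubgraphs)
    {x : Line h → ℝ} {T : Finset (Line h)} (hT : G.IsOneTree T)
    (hmin : ∀ t : ℝ, ∀ T', G.IsOneTree T' → ((Finset.univ.filter (fun l => x l < t)) \ T).card
        ≤ ((Finset.univ.filter (fun l => x l < t)) \ T').card)
    {X xl xmin xmax : ℝ} (hX : ∃ k, X ≤ x (Sum.inl k))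
    (hsoft : ∀ i k, G.Crosses i k → x (Sum.inl k) ≤ X ∨ 2 * x (Sum.inl k) ≤ X + x (Sum.inr i))
    (hl' : ∃ k, x (Sum.inl k) = xl)
    (hmin' : ∃ l, x l = xmin) (hmax' : ∃ l, x l = xmax) :
    ∑ l, x l - 2 * ∑ l ∈ Tᶜ, x l + 1 / 2 * ∑ k, max (X - x (Sum.inl k)) 0 - h * X
      + 1 / 2 * min (X - xl) 0 ≤ -(1 / 2) * (xmax - xmin) := by
  classical
  have hne : ∀ i, ∃ k, G.Crosses i k ∧ ∀ k', G.Crosses i k' → x (Sum.inl k') ≤ x (Sum.inl k) := by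
    intro i
    obtain ⟨k, hk, hk'⟩ := Finset.exists_max_image (Finset.univ.filter (fun k => G.Crosses i k))
      (fun k => x (Sum.inl k)) (by
        obtain ⟨k, hk⟩ := G.exists_crosses i
        exact ⟨k, Finset.mem_filter.2 ⟨Finset.mem_univ k, hk⟩⟩)
    exact ⟨k, (Finset.mem_filter.1 hk).2, fun k' hk'' =>
      hk' k' (Finset.mem_filter.2 ⟨Finset.mem_univ k', hk''⟩)⟩
  choose km hkm hkm' using hne
  have hsoft' := fun i => hsoft i (km i) (hkm i)
  obtain ⟨lst, -, hlst⟩ := Finset.exists_max_image (Finset.univ : Finset (Fin h))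
    (fun i => x (Sum.inr i)) ⟨⟨0, hh⟩, Finset.mem_univ _⟩
  -- `θ i` is the multiple of `2 x_(km i) ≤ X + x_i` that is added to the claim, where `hsoft`
  -- provides this inequality. The value `1/2` at the topmost photon line leaves weight there to
  -- compensate for `xmax`.
  let θ : Fin h → ℝ := fun i => if X < x (Sum.inl (km i)) then (if i = lst then 1 / 2 else 1) else 0
  have hθ0 : ∀ i, 0 ≤ θ i := by
    intro i; simp only [θ]; split_ifs <;> norm_num
  let β : Line h → ℝ := fun l => if l ∈ T then 1 else -1
  let δ : ℝ := if X < xl then 1 / 2 else 0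
  let ε : Fin (2 * h) → ℝ := fun k => if x (Sum.inl k) < X then 1 / 2 else 0
  -- All terms of the claim and of the added inequalities are brought to one side as weights `α` on
  -- values `y`; `ε` and `δ` are the slopes of the `max` and `min` terms. The total is zero because
  -- `|T| - |Tᶜ| = h`.
  let α : Line h ⊕ (Fin (2 * h) ⊕ (Fin h ⊕ (Fin h ⊕ Fin 4))) → ℝ :=
    Sum.elim β (Sum.elim (fun k => -ε k) (Sum.elim θ (Sum.elim (fun i => -2 * θ i)
      ![∑ k, ε k + ∑ i, θ i + δ - h, -δ, 1 / 2, -(1 / 2)])))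
  let y : Line h ⊕ (Fin (2 * h) ⊕ (Fin h ⊕ (Fin h ⊕ Fin 4))) → ℝ :=
    Sum.elim x (Sum.elim (fun k => x (Sum.inl k)) (Sum.elim (fun i => x (Sum.inr i))
      (Sum.elim (fun i => x (Sum.inl (km i))) ![X, xl, xmax, xmin])))
  have hβ : ∑ l, β l = h := by
    have h1 := sum_tree_weight T Finset.univ
    have h2 := card_sdiff_add hT Finset.univ
    simp only [Finset.compl_univ, Finset.empty_sdiff, Finset.card_empty, add_zero] at h2
    rw [h2] at h1
    simp only [β, h1, Finset.card_univ, Fintype.card_sum, Fintype.card_fin]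
    push_cast
    ring
  have h0 : ∑ j, α j = 0 := by
    simp only [α, Fintype.sum_sum_type, Sum.elim_inl, Sum.elim_inr, Fin.sum_univ_four,
      Matrix.cons_val, Finset.sum_neg_distrib, ← Finset.mul_sum]
    rw [← Fintype.sum_sum_type, hβ]
    ring
  have split : ∀ f : Line h ⊕ (Fin (2 * h) ⊕ (Fin h ⊕ (Fin h ⊕ Fin 4))) → ℝ,
      ∑ j, f j = ∑ l, f (Sum.inl l) + (∑ k, f (Sum.inr (Sum.inl k))
        + (∑ i, f (Sum.inr (Sum.inr (Sum.inl i))) + (∑ i, f (Sum.inr (Sum.inr (Sum.inr (Sum.inl i))))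
        + ∑ j, f (Sum.inr (Sum.inr (Sum.inr (Sum.inr j))))))) := fun f => by
    rw [Fintype.sum_sum_type f, Fintype.sum_sum_type fun j => f (Sum.inr j),
      Fintype.sum_sum_type fun j => f (Sum.inr (Sum.inr j)),
      Fintype.sum_sum_type fun j => f (Sum.inr (Sum.inr (Sum.inr j)))]
  have hlev : ∀ τ, 0 ≤ ∑ j, if y j < τ then α j else 0 := by
    intro τ
    have e1 : ∑ j, (if y j < τ then α j else 0)
        = (∑ l, if x l < τ then β l else 0) + (-(∑ k, if x (Sum.inl k) < τ then ε k else 0)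
          + ((∑ i, if x (Sum.inr i) < τ then θ i else 0)
          + (-2 * (∑ i, if x (Sum.inl (km i)) < τ then θ i else 0)
          + ((if X < τ then ∑ k, ε k + ∑ i, θ i + δ - h else 0) + (if xl < τ then -δ else 0)
            + (if xmax < τ then 1 / 2 else 0) + (if xmin < τ then -(1 / 2) else 0))))) := by
      obtain ⟨step, hstep⟩ : ∃ f : ℝ → ℝ → ℝ, ∀ a b, f a b = if a < τ then b else 0 :=
        ⟨_, fun _ _ => rfl⟩
      have hmul : ∀ a b c, step a (b * c) = b * step a c := by
        intro a b c; rw [hstep, hstep, mul_ite, mul_zero]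
      have hneg : ∀ a b, step a (-b) = -step a b := by
        intro a b; rw [neg_eq_neg_one_mul, hmul, neg_one_mul]
      simp only [← hstep]
      rw [split, Fin.sum_univ_four]
      simp only [α, y, Sum.elim_inl, Sum.elim_inr, Matrix.cons_val, hmul (_ : ℝ) (-2), hneg,
        Finset.sum_neg_distrib, ← Finset.mul_sum]
    rw [e1]
    -- Below the scale the line weights add up to `-ω` of the set of lines below `τ`, and the margin
    -- `1/2` pays for `xmin`; by `hX` this set is never everything. Above the scale the lines at or
    -- above `τ` are counted, and the minimal tree is compared with the lepton path.
    rcases le_or_gt τ X with hτ | hτ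
    · set s := Finset.univ.filter (fun l => x l < τ) with hs
      have a1 : ∑ l, (if x l < τ then β l else 0) = s.card - 2 * (s \ T).card := by
        rw [← Finset.sum_filter]; exact sum_tree_weight T s
      have a2 : ∑ k, (if x (Sum.inl k) < τ then ε k else 0) = 1 / 2 * leptonCard s := by
        rw [leptonCard_filter, ← Finset.sum_boole, Finset.mul_sum]
        refine Finset.sum_congr rfl fun k _ => ?_
        by_cases hk : x (Sum.inl k) < τ
        · rw [if_pos hk, if_pos hk]
          simp only [ε]
          rw [if_pos (by linarith)]; norm_num
        · rw [if_neg hk, if_neg hk, mul_zero]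
      have a3 : ∀ i, (if x (Sum.inr i) < τ then θ i else 0) = 0 := by
        intro i
        split_ifs with hi
        · simp only [θ]
          rw [if_neg]
          intro hi'
          rcases hsoft' i with h1 | h1 <;> linarith
        · rfl
      have a4 : ∀ i, (if x (Sum.inl (km i)) < τ then θ i else 0) = 0 := by
        intro i
        split_ifs with hi
        · simp only [θ]
          rw [if_neg]
          intro hi'
          linarith
        · rfl
      have a5 : (if xl < τ then -δ else 0) = 0 := by
        split_ifs with h1
        · simp only [δ]
          rw [if_neg (by linarith), neg_zero]
        · rfl
      rw [a1, a2, if_neg (not_lt.2 hτ), a5]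
      simp only [a3, a4, Finset.sum_const_zero]
      by_cases hs0 : s = ∅
      · have : ¬ xmin < τ := by
          obtain ⟨l, rfl⟩ := hmin'
          intro hlt
          have : l ∈ s := Finset.mem_filter.2 ⟨Finset.mem_univ l, hlt⟩
          rw [hs0] at this
          simp at this
        rw [if_neg this, hs0]
        simp only [Finset.card_empty, Finset.empty_sdiff, leptonCard, Finset.filter_empty]
        split_ifs <;> norm_num
      · have hs1 : s ≠ Finset.univ := by
          obtain ⟨k, hk⟩ := hX
          intro e
          have : Sum.inl k ∈ s := by rw [e]; simp
          have := (Finset.mem_filter.1 this).2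
          linarith
        have := hG.le_neg_half hs0 hs1 (hmin τ)
        split_ifs <;> linarith
    · have b0 := G.half_le_sum_photons hG hτ hkm' hsoft' (fun i => hlst i (Finset.mem_univ i))
        (θ := θ) (fun i => rfl) hl' hmin' hmax'
      have c1 : ∀ a b : ℝ, (if a < τ then b else 0) = b - b * (if τ ≤ a then 1 else 0) := by
        intro a b
        by_cases ha : a < τ
        · rw [if_pos ha, if_neg (not_le.2 ha)]; ring
        · rw [if_neg ha, if_pos (not_lt.1 ha)]; ring
      set s := Finset.univ.filter (fun l => x l < τ) with hs
      have a1 : ∑ l, (if x l < τ then β l else 0) = s.card - 2 * (s \ T).card := by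
        rw [← Finset.sum_filter]; exact sum_tree_weight T s
      have a2 : ∑ k, (if x (Sum.inl k) < τ then ε k else 0) = ∑ k, ε k := by
        refine Finset.sum_congr rfl fun k _ => ?_
        simp only [ε]
        split_ifs <;> first | rfl | linarith
      have a3 : (s.card : ℝ) + (Finset.univ.filter (fun k => τ ≤ x (Sum.inl k))).card
          + (Finset.univ.filter (fun i => τ ≤ x (Sum.inr i))).card = 3 * h := by
        have h1 := Finset.card_filter_add_card_filter_not (s := (Finset.univ : Finset (Line h)))
          (fun l => x l < τ)
        simp only [not_lt] at h1
        rw [← hs, card_filter_line (fun l => τ ≤ x l), Finset.card_univ, Fintype.card_sum,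
          Fintype.card_fin, Fintype.card_fin] at h1
        have h2 : s.card + (Finset.univ.filter (fun k => τ ≤ x (Sum.inl k))).card
          + (Finset.univ.filter (fun i => τ ≤ x (Sum.inr i))).card = 3 * h := by omega
        exact_mod_cast h2
      have a4 : ((s \ T).card : ℝ) + (Finset.univ.filter (fun i => τ ≤ x (Sum.inr i))).card ≤ h := by
        have h1 := hmin τ _ G.leptonPath_isOneTree
        rw [card_sdiff_leptonPath (fun l => x l < τ), ← hs] at h1
        have h2 := Finset.card_filter_add_card_filter_not (s := (Finset.univ : Finset (Fin h)))
          (fun i => x (Sum.inr i) < τ)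
        simp only [not_lt, Finset.card_univ, Fintype.card_fin] at h2
        have h3 : (s \ T).card + (Finset.univ.filter (fun i => τ ≤ x (Sum.inr i))).card ≤ h := by
          omega
        exact_mod_cast h3
      have a5 : (∑ i, if x (Sum.inr i) < τ then θ i else 0)
          + (-2 * (∑ i, if x (Sum.inl (km i)) < τ then θ i else 0)) + ∑ i, θ i
          + ((Finset.univ.filter (fun i => τ ≤ x (Sum.inr i))).card : ℝ)
          = ∑ i, ((if τ ≤ x (Sum.inr i) then 1 else 0)
            + θ i * (2 * (if τ ≤ x (Sum.inl (km i)) then 1 else 0)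
            - if τ ≤ x (Sum.inr i) then 1 else 0)) := by
        rw [← Finset.sum_boole, Finset.mul_sum, ← Finset.sum_add_distrib, ← Finset.sum_add_distrib,
          ← Finset.sum_add_distrib]
        refine Finset.sum_congr rfl fun i _ => ?_
        rw [c1, c1]
        ring
      have a6 : (if xl < τ then -δ else 0) + δ = if τ ≤ xl then 1 / 2 else 0 := by
        rw [c1]
        simp only [δ]
        by_cases h1 : τ ≤ xl
        · rw [if_pos h1, if_pos (by linarith), if_pos h1]; norm_num
        · rw [if_neg h1, if_neg h1]; ring
      have a7 : (if xmin < τ then -(1 / 2) else (0 : ℝ)) = -(if xmin < τ then 1 / 2 else 0) := by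
        split_ifs <;> simp
      rw [a1, a2, if_pos hτ, a7]
      linarith
  have key := sum_mul_nonpos_of_levels α y h0 hlev
  have e2 : ∑ j, α j * y j = ∑ l, β l * x l + (-(∑ k, ε k * x (Sum.inl k))
      + ((∑ i, θ i * x (Sum.inr i)) + (-2 * (∑ i, θ i * x (Sum.inl (km i)))
        + ((∑ k, ε k + ∑ i, θ i + δ - h) * X + -δ * xl + 1 / 2 * xmax + -(1 / 2) * xmin)))) := by
    rw [split, Fin.sum_univ_four, ← Finset.sum_neg_distrib, Finset.mul_sum]
    simp only [α, y, Sum.elim_inl, Sum.elim_inr, Matrix.cons_val, neg_mul, mul_assoc]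
  have e3 : ∑ l, β l * x l = ∑ l, x l - 2 * ∑ l ∈ Tᶜ, x l := by
    have h1 : ∑ l ∈ Tᶜ, x l = ∑ l, if l ∈ T then 0 else x l := by
      rw [← Finset.sum_subset (Finset.subset_univ Tᶜ)]
      · exact Finset.sum_congr rfl fun l hl => (if_neg (Finset.mem_compl.1 hl)).symm
      · intro l _ hl
        exact if_pos (by simpa using hl)
    rw [h1, Finset.mul_sum, ← Finset.sum_sub_distrib]
    refine Finset.sum_congr rfl fun l _ => ?_
    simp only [β]
    split_ifs <;> ring
  have e4 : 1 / 2 * ∑ k, max (X - x (Sum.inl k)) 0 = (∑ k, ε k) * X - ∑ k, ε k * x (Sum.inl k) := by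
    rw [Finset.mul_sum, Finset.sum_mul, ← Finset.sum_sub_distrib]
    refine Finset.sum_congr rfl fun k _ => ?_
    simp only [ε]
    split_ifs with h1
    · rw [max_eq_left (by linarith)]; ring
    · rw [max_eq_right (by linarith)]; ring
  have e5 : 1 / 2 * min (X - xl) 0 = δ * X - δ * xl := by
    simp only [δ]
    split_ifs with h1
    · rw [min_eq_left (by linarith)]; ring
    · rw [min_eq_right (by linarith)]; ring
  -- The added inequalities are nonnegative contributions and can be dropped again.
  have e6 : 0 ≤ (∑ i, θ i) * X + ∑ i, θ i * x (Sum.inr i) + -2 * (∑ i, θ i * x (Sum.inl (km i))) := by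
    rw [Finset.sum_mul, Finset.mul_sum, ← Finset.sum_add_distrib, ← Finset.sum_add_distrib]
    refine Finset.sum_nonneg fun i _ => ?_
    rcases hsoft' i with h1 | h1
    · have : θ i = 0 := if_neg (not_lt.2 h1)
      rw [this]; simp
    · have := mul_nonneg (hθ0 i) (sub_nonneg.2 h1)
      linarith
  rw [e2, e3] at key
  rw [e4, e5]
  linarith

end VertexGraph
end QED

/-! ### The bound for the integrand -/

namespace QED
namespace VertexGraph

variable {h : ℕ} {γ : Fin 4 → SpinorMatrix}

/-- The magnetic moment of the terms belonging to `P` is a smooth function of the coefficients of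
the momenta in the lepton lines. -/
theorem exists_moment (G : VertexGraph h) (hγ : IsDirac γ)
    {P : Finset (Fin (2 * h) × Fin (2 * h))} (hP : IsPairing P) :
    ∃ A : (Fin (2 * h) → ℝ × ℝ) → ℂ, ContDiff ℝ 1 A ∧ (P = ∅ → A G.pathCoeff = 0) ∧
      ∀ m : ℝ, 0 < m → ∀ z, HasMagneticMoment m γ (G.amplitude m γ P z)
        ((m : ℂ) ^ (2 * (h - P.card)) * A (G.lineCoeff z)) := by
  obtain ⟨A, hA, h1⟩ := hγ.exists_magneticMoment_pathWord G.photonSlots hP.slots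
    G.card_photonSlots_eq_none
  refine ⟨A, hA, ?_, fun m hm z => ?_⟩
  · rintro rfl
    exact hγ.hasMagneticMoment_unique one_pos (h1 _) (G.hasMagneticMoment_pathCoeff hγ hP)
  · refine HasMagneticMoment.scale hm _ ?_ (G.amplitude_smul m hP z)
    rw [G.amplitude_eq_wordVertex hP]
    exact h1 _

theorem norm_lineCoeff_le (G : VertexGraph h) {z : Line h → ℝ} (hz : ∀ l, 0 < z l) :
    ‖G.lineCoeff z‖ ≤ 1 := by
  refine (pi_norm_le_iff_of_nonneg zero_le_one).2 fun k => ?_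
  rw [Prod.norm_def]
  exact max_le (G.abs_lineCoeff_le hz k).1 (G.abs_lineCoeff_le hz k).2

theorem norm_pathCoeff_le (G : VertexGraph h) : ‖G.pathCoeff‖ ≤ 1 := by
  refine (pi_norm_le_iff_of_nonneg zero_le_one).2 fun k => ?_
  rw [pathCoeff]; split_ifs <;> simp [Prod.norm_def]

/-- Bounds for a smooth function of the coefficients. -/
theorem exists_bound_lineCoeff (G : VertexGraph h) {A : (Fin (2 * h) → ℝ × ℝ) → ℂ}
    (hA : ContDiff ℝ 1 A) :
    ∃ C : ℝ, 0 ≤ C ∧ ∀ z : Line h → ℝ, (∀ l, 0 < z l) → ‖A (G.lineCoeff z)‖ ≤ C ∧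
      (A G.pathCoeff = 0 → ∀ δ : ℝ, 0 ≤ δ →
        (∀ i k, G.Crosses i k → z (Sum.inl k) ≤ δ * z (Sum.inr i)) →
        ‖A (G.lineCoeff z)‖ ≤ C * δ) := by
  obtain ⟨C₁, hC₁⟩ := (isCompact_closedBall (0 : Fin (2 * h) → ℝ × ℝ) 1).exists_bound_of_continuousOn
    hA.continuous.continuousOn
  obtain ⟨C₂, hC₂⟩ := (isCompact_closedBall (0 : Fin (2 * h) → ℝ × ℝ) 1).exists_bound_of_continuousOn
    (hA.continuous_fderiv one_ne_zero).continuousOn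
  have h0 : (0 : Fin (2 * h) → ℝ × ℝ) ∈ Metric.closedBall (0 : Fin (2 * h) → ℝ × ℝ) 1 := by simp
  have p1 : 0 ≤ C₁ := (norm_nonneg _).trans (hC₁ 0 h0)
  have p2 : 0 ≤ C₂ := (norm_nonneg _).trans (hC₂ 0 h0)
  refine ⟨C₁ + C₂ * (4 * h ^ 2), by positivity, fun z hz => ⟨?_, fun h1 δ hδ hcr => ?_⟩⟩
  · refine (hC₁ _ (by simpa using G.norm_lineCoeff_le hz)).trans ?_
    have : 0 ≤ C₂ * (4 * (h : ℝ) ^ 2) := by positivity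
    linarith
  -- Mean value inequality on the unit ball, starting from `pathCoeff`, where the function vanishes.
  · have h2 := (convex_closedBall (0 : Fin (2 * h) → ℝ × ℝ) 1).norm_image_sub_le_of_norm_fderiv_le
      (f := A) (fun c _ => (hA.differentiable one_ne_zero) c) hC₂
      (by simpa using G.norm_pathCoeff_le) (by simpa using G.norm_lineCoeff_le hz)
    rw [h1, sub_zero] at h2
    have h3 : ‖G.lineCoeff z - G.pathCoeff‖ ≤ 4 * h ^ 2 * δ :=
      (pi_norm_le_iff_of_nonneg (by positivity)).2 fun k => G.norm_lineCoeff_sub_le hz hcr k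
    have h4 := mul_le_mul_of_nonneg_left h3 p2
    have h5 := mul_nonneg p1 hδ
    linarith

/-- The scale of the denominator. -/
theorem exists_scale (G : VertexGraph h) (hh : 1 ≤ h) {z : Line h → ℝ} (hz : ∀ l, 0 < z l) :
    ∃ v : ℝ, 0 < v ∧ v ≤ 2 * G.excessPower z ∧ (∃ k, v ≤ z (Sum.inl k)) ∧
      ∀ i k, G.Crosses i k →
        z (Sum.inl k) ≤ v ∨ z (Sum.inl k) ^ 2 ≤ v * z (Sum.inr i) := by
  have hw := G.excessPower_pos hh hz
  obtain ⟨k₀, -, hk₀⟩ := Finset.exists_max_image (Finset.univ : Finset (Fin (2 * h)))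
    (fun k => z (Sum.inl k)) ⟨⟨0, by omega⟩, Finset.mem_univ _⟩
  -- If `z_k > 2w`, then `z_k w` is at most half of `z_k²`, and `z_k² ≤ (z_k + z_i) w` gives `z_k² ≤
  -- 2w z_i`. The cap by the largest lepton parameter keeps one lepton line at or above the scale,
  -- so that the lines below it never form the whole graph.
  refine ⟨min (2 * G.excessPower z) (z (Sum.inl k₀)), lt_min (by linarith) (hz _), min_le_left _ _,
    ⟨k₀, min_le_right _ _⟩, fun i k hik => ?_⟩
  by_contra! H
  have h1 := hk₀ k (Finset.mem_univ k)
  have h2 : 2 * G.excessPower z < z (Sum.inl k) := by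
    by_contra! h3
    exact absurd H.1 (not_lt.2 (le_min h3 h1))
  rw [min_eq_left (h2.le.trans h1)] at H
  have h3 := G.sq_le_of_crosses hz hik
  nlinarith [hz (Sum.inl k)]

theorem IsPairing.sum_le {P : Finset (Fin (2 * h) × Fin (2 * h))} (hP : IsPairing P)
    {g : Fin (2 * h) → ℝ} (hg : ∀ k, 0 ≤ g k) : ∑ a ∈ P, (g a.1 + g a.2) ≤ ∑ k, g k := by
  classical
  rw [← Finset.sum_fiberwise Finset.univ hP.slots.slot g, Fintype.sum_option,
    ← Finset.sum_coe_sort P]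
  have h1 : ∀ c : P, ∑ k ∈ Finset.univ.filter (fun k => hP.slots.slot k = some c), g k
      = g c.1.1 + g c.1.2 := by
    intro c
    rw [hP.slots.filter_slot_eq, Finset.sum_pair (hP.slots.ne c)]
    rfl
  simp only [h1]
  have := Finset.sum_nonneg fun k (_ : k ∈ Finset.univ.filter
    (fun k => hP.slots.slot k = none)) => hg k
  linarith

/-- The contribution of the pairs to the exponent. -/
theorem IsPairing.sum_exponent_le {P : Finset (Fin (2 * h) × Fin (2 * h))} (hP : IsPairing P)
    (x : Fin (2 * h) → ℝ) (X xl : ℝ) (hl : ∀ k, xl ≤ x k) :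
    P.card * X - 1 / 2 * ∑ a ∈ P, (x a.1 + x a.2) + (if P = ∅ then 1 / 2 * min (X - xl) 0 else 0)
      ≤ 1 / 2 * ∑ k, max (X - x k) 0 + 1 / 2 * min (X - xl) 0 := by
  have h1 : P.card * X - 1 / 2 * ∑ a ∈ P, (x a.1 + x a.2)
      = 1 / 2 * ∑ a ∈ P, ((X - x a.1) + (X - x a.2)) := by
    simp only [Finset.sum_add_distrib, Finset.sum_sub_distrib, Finset.sum_const, nsmul_eq_mul]
    ring
  have h2 : 0 ≤ ∑ k, max (X - x k) 0 := Finset.sum_nonneg fun k _ => le_max_right _ _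
  rw [h1]
  split_ifs with hP0
  · subst hP0
    simp only [Finset.sum_empty]
    linarith
  -- If all lepton lines lie above `X`, every pair contributes negatively and a single one already
  -- gives at most `X - xl`. This is why no vanishing of the moment is needed for `P ≠ ∅`.
  · rcases le_or_gt xl X with hX | hX
    · rw [min_eq_right (by linarith)]
      have h3 := hP.sum_le (g := fun k => max (X - x k) 0) fun k => le_max_right _ _
      have h4 : ∑ a ∈ P, ((X - x a.1) + (X - x a.2))
          ≤ ∑ a ∈ P, (max (X - x a.1) 0 + max (X - x a.2) 0) :=
        Finset.sum_le_sum fun a _ => add_le_add (le_max_left _ _) (le_max_left _ _)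
      linarith
    · rw [min_eq_left (by linarith)]
      obtain ⟨a, ha⟩ := Finset.nonempty_iff_ne_empty.2 hP0
      have h4 : ∑ a ∈ P, ((X - x a.1) + (X - x a.2)) ≤ ∑ a ∈ {a}, ((X - x a.1) + (X - x a.2)) := by
        refine Finset.sum_le_sum_of_subset_of_nonpos' (by simpa using ha) ?_
        intro b _ _
        linarith [hl b.1, hl b.2]
      rw [Finset.sum_singleton] at h4
      linarith [hl a.1, hl a.2]

/-- `D` is bounded below by the monomial of one tree, which is left free here and later taken
minimal for the given parameters. -/
theorem abs_K_le (G : VertexGraph h) {z : Line h → ℝ} (hz : ∀ l, 0 < z l)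
    {T : Finset (Line h)} (hT : G.IsOneTree T) (P : Finset (Fin (2 * h) × Fin (2 * h))) :
    |G.K P z| ≤ Real.exp (-2 * ∑ l ∈ Tᶜ, Real.log (z l)
      - 1 / 2 * ∑ a ∈ P, (Real.log (z (Sum.inl a.1)) + Real.log (z (Sum.inl a.2)))) := by
  have hD := G.D_pos hz
  have h1 : 1 / G.D z ^ 2 ≤ Real.exp (-2 * ∑ l ∈ Tᶜ, Real.log (z l)) := by
    rw [neg_mul, Real.exp_neg, one_div, two_mul, Real.exp_add, ← sq, Real.exp_sum]
    refine inv_anti₀ (pow_pos (Finset.prod_pos fun l _ => Real.exp_pos _) 2) ?_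
    refine pow_le_pow_left₀ (Finset.prod_nonneg fun l _ => (Real.exp_pos _).le) ?_ 2
    refine le_trans (le_of_eq ?_) (G.prod_compl_le_D hz hT)
    exact Finset.prod_congr rfl fun l _ => Real.exp_log (hz l)
  have hs : ∀ k, (√(z (Sum.inl k)))⁻¹ = Real.exp (-(1 / 2) * Real.log (z (Sum.inl k))) := by
    intro k
    rw [neg_mul, Real.exp_neg, Real.sqrt_eq_rpow, Real.rpow_def_of_pos (hz _), mul_comm]
  have h2 : |∏ a ∈ P, (G.B a.1 a.2 z / G.D z)| ≤ Real.exp (-(1 / 2)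
      * ∑ a ∈ P, (Real.log (z (Sum.inl a.1)) + Real.log (z (Sum.inl a.2)))) := by
    rw [Finset.abs_prod, Finset.mul_sum, Real.exp_sum]
    refine Finset.prod_le_prod (fun a _ => abs_nonneg _) fun a _ => ?_
    rw [mul_add, Real.exp_add, ← hs, ← hs]
    exact G.abs_B_div_D_le hz a.1 a.2
  rw [K, abs_mul, abs_of_pos (by positivity), sub_eq_add_neg, Real.exp_add, ← neg_mul]
  exact mul_le_mul h1 h2 (abs_nonneg _) (Real.exp_pos _).le

/-- The bound for the terms belonging to `P`. -/
theorem exists_term_bound (G : VertexGraph h) (hh : 1 ≤ h) (hG : G.NoUVDivergentSubgraphs)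
    {P : Finset (Fin (2 * h) × Fin (2 * h))} (hP : IsPairing P)
    {A : (Fin (2 * h) → ℝ × ℝ) → ℂ} (hA : ContDiff ℝ 1 A) (hA0 : P = ∅ → A G.pathCoeff = 0) :
    ∃ C : ℝ, 0 ≤ C ∧ ∀ z : Line h → ℝ, (∀ l, 0 < z l) → ∀ l l' : Line h,
      |G.K P z| * ‖A (G.lineCoeff z)‖ / G.excessPower z ^ (h - P.card) * ∏ l, z l
        ≤ C * Real.exp (-(1 / 2) * (Real.log (z l') - Real.log (z l))) := by
  obtain ⟨C, hC, h1⟩ := G.exists_bound_lineCoeff hA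
  refine ⟨C * 2 ^ (h - P.card), by positivity, fun z hz l l' => ?_⟩
  obtain ⟨v, hv, hvw, ⟨k₀, hk₀⟩, hcr⟩ := G.exists_scale hh hz
  set x : Line h → ℝ := fun l => Real.log (z l) with hx
  have hex : ∀ l, Real.exp (x l) = z l := fun l => Real.exp_log (hz l)
  set X := Real.log v with hX
  have heX : Real.exp X = v := Real.exp_log hv
  obtain ⟨T, hT, hTmin⟩ := G.exists_minimal_tree x
  obtain ⟨kl, -, hkl⟩ := Finset.exists_min_image (Finset.univ : Finset (Fin (2 * h)))
    (fun k => x (Sum.inl k)) ⟨⟨0, by omega⟩, Finset.mem_univ _⟩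
  have hkl' : ∀ k, x (Sum.inl kl) ≤ x (Sum.inl k) := fun k => hkl k (Finset.mem_univ k)
  have hsoft : ∀ i k, G.Crosses i k →
      x (Sum.inl k) ≤ X ∨ 2 * x (Sum.inl k) ≤ X + x (Sum.inr i) := by
    intro i k hik
    refine (hcr i k hik).imp (fun H => Real.log_le_log (hz _) H) fun H => ?_
    have := Real.log_le_log (pow_pos (hz _) 2) H
    rwa [Real.log_pow, Real.log_mul hv.ne' (hz _).ne'] at this
  have hlev := G.level_bound hh hG hT hTmin ⟨k₀, Real.log_le_log hv hk₀⟩ hsoft ⟨kl, rfl⟩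
    (xmin := x l) ⟨l, rfl⟩ (xmax := x l') ⟨l', rfl⟩
  -- The vanishing at `pathCoeff` is used only for `P = ∅` with all lepton lines above the scale.
  -- Then `hsoft` yields `z_k ≤ δ z_i` with `δ = exp (X - xl)`, of which only the square root is
  -- kept.
  have hAb : ‖A (G.lineCoeff z)‖
      ≤ C * Real.exp (if P = ∅ then 1 / 2 * min (X - x (Sum.inl kl)) 0 else 0) := by
    obtain ⟨h2, h3⟩ := h1 z hz
    split_ifs with hP0
    · rcases le_or_gt (x (Sum.inl kl)) X with hle | hlt
      · rw [min_eq_right (by linarith)]; simpa using h2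
      · rw [min_eq_left (by linarith)]
        have h4 := h3 (hA0 hP0) (Real.exp (X - x (Sum.inl kl))) (Real.exp_pos _).le (by
          intro i k hik
          rw [← hex, ← hex, ← Real.exp_add, Real.exp_le_exp]
          have := hkl' k
          rcases hsoft i k hik with h5 | h5 <;> linarith)
        refine h4.trans (mul_le_mul_of_nonneg_left (Real.exp_le_exp.2 ?_) hC)
        linarith
    · simpa using h2
  have hw : (G.excessPower z ^ (h - P.card))⁻¹
      ≤ 2 ^ (h - P.card) * Real.exp (-((h - P.card : ℕ) : ℝ) * X) := by
    rw [neg_mul, Real.exp_neg, Real.exp_nat_mul, heX, ← div_eq_mul_inv, ← div_pow, ← inv_pow]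
    have hwp := G.excessPower_pos hh hz
    refine pow_le_pow_left₀ (inv_nonneg.2 hwp.le) ?_ _
    rw [inv_eq_one_div, div_le_div_iff₀ hwp hv]
    linarith
  have hprod : ∏ l, z l = Real.exp (∑ l, x l) := by
    rw [Real.exp_sum]
    exact Finset.prod_congr rfl fun l _ => (hex l).symm
  have hcard : (((h - P.card : ℕ) : ℝ)) = h - P.card := by
    rw [Nat.cast_sub hP.card_le]
  have hpair := hP.sum_exponent_le (fun k => x (Sum.inl k)) X _ hkl'
  rw [div_eq_mul_inv, hprod]
  have hwp := G.excessPower_pos hh hz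
  calc |G.K P z| * ‖A (G.lineCoeff z)‖ * (G.excessPower z ^ (h - P.card))⁻¹ * Real.exp (∑ l, x l)
      ≤ Real.exp (-2 * ∑ l ∈ Tᶜ, x l
          - 1 / 2 * ∑ a ∈ P, (x (Sum.inl a.1) + x (Sum.inl a.2)))
        * (C * Real.exp (if P = ∅ then 1 / 2 * min (X - x (Sum.inl kl)) 0 else 0))
        * (2 ^ (h - P.card) * Real.exp (-((h - P.card : ℕ) : ℝ) * X)) * Real.exp (∑ l, x l) := by
        gcongr
        exact G.abs_K_le hz hT P
    _ = C * 2 ^ (h - P.card) * Real.exp ((-2 * ∑ l ∈ Tᶜ, x l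
          - 1 / 2 * ∑ a ∈ P, (x (Sum.inl a.1) + x (Sum.inl a.2)))
        + (if P = ∅ then 1 / 2 * min (X - x (Sum.inl kl)) 0 else 0)
        + (-((h - P.card : ℕ) : ℝ) * X) + ∑ l, x l) := by
        rw [Real.exp_add, Real.exp_add, Real.exp_add]; ring
    _ ≤ C * 2 ^ (h - P.card) * Real.exp (-(1 / 2) * (x l' - x l)) := by
        gcongr
        rw [hcard]
        linarith

-- Moment and denominator carry the same power `m ^ (2(h - |P|))`, so the mass cancels and the
-- constants derived from this form do not depend on it.
open Classical in
theorem exists_integrand_eq (G : VertexGraph h) (hh : 1 ≤ h) (hγ : IsDirac γ)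
    (κ : Finset (Fin (2 * h) × Fin (2 * h)) → ℂ) :
    ∃ A : Finset (Fin (2 * h) × Fin (2 * h)) → (Fin (2 * h) → ℝ × ℝ) → ℂ,
      (∀ P, IsPairing P → ContDiff ℝ 1 (A P) ∧ (P = ∅ → A P G.pathCoeff = 0)) ∧
      ∀ m : ℝ, 0 < m → ∀ z : Line h → ℝ, (∀ l, 0 < z l) → G.integrand m γ κ z =
        ∑ P with IsPairing P, κ P * (G.K P z : ℂ) * A P (G.lineCoeff z)
          / (-(G.excessPower z : ℂ)) ^ (h - P.card) := by
  choose! A hA hA0 hA1 using fun P (hP : IsPairing P) => G.exists_moment hγ hP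
  refine ⟨A, fun P hP => ⟨hA P hP, hA0 P hP⟩, fun m hm z hz => ?_⟩
  rw [integrand]
  refine Finset.sum_congr (by congr) fun P hP => ?_
  have hP' := (Finset.mem_filter.1 hP).2
  have hm' : (m : ℂ) ≠ 0 := by exact_mod_cast hm.ne'
  have hw : (G.excessPower z : ℂ) ≠ 0 := by exact_mod_cast (G.excessPower_pos hh hz).ne'
  rw [hγ.magneticMoment_eq hm (hA1 P hP' m hm z), W_eq G m hz]
  have e1 : ((-(m ^ 2 * G.excessPower z) : ℝ) : ℂ) ^ (h - P.card)
      = (m : ℂ) ^ (2 * (h - P.card)) * (-(G.excessPower z : ℂ)) ^ (h - P.card) := by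
    rw [pow_mul, ← mul_pow]; push_cast; ring
  have e2 : (-(G.excessPower z : ℂ)) ^ (h - P.card) ≠ 0 := pow_ne_zero _ (neg_ne_zero.2 hw)
  rw [e1]
  field_simp

open Classical in
/-- The bound of the integrand. -/
theorem exists_integrand_bound (G : VertexGraph h) (hh : 1 ≤ h) (hG : G.NoUVDivergentSubgraphs)
    (hγ : IsDirac γ) (κ : Finset (Fin (2 * h) × Fin (2 * h)) → ℂ) :
    ∃ C : ℝ, 0 ≤ C ∧ ∀ m : ℝ, 0 < m → ∀ z : Line h → ℝ, (∀ l, 0 < z l) → ∑ l, z l = 1 →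
      ‖G.integrand m γ κ z‖ ≤ C * (⨅ l, z l) ^ (1 / 2 : ℝ) / ∏ l, z l := by
  obtain ⟨A, hA, hI⟩ := G.exists_integrand_eq hh hγ κ
  choose! C hC0 hC using fun P (hP : IsPairing P) =>
    G.exists_term_bound hh hG hP (hA P hP).1 (hA P hP).2
  have hs : 0 ≤ ∑ P with IsPairing P, ‖κ P‖ * C P :=
    Finset.sum_nonneg fun P hP => mul_nonneg (norm_nonneg _) (hC0 P (Finset.mem_filter.1 hP).2)
  refine ⟨(∑ P with IsPairing P, ‖κ P‖ * C P) * (3 * h) ^ (1 / 2 : ℝ), by positivity,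
    fun m hm z hz hsum => ?_⟩
  have hne : Nonempty (Line h) := ⟨Sum.inr ⟨0, hh⟩⟩
  obtain ⟨l, hl⟩ := exists_eq_ciInf_of_finite (f := z)
  -- The `3h` parameters sum to one, so one of them is at least `1 / (3h)`; the smallest one is
  -- compared with it.
  obtain ⟨l', hl'⟩ : ∃ l', 1 ≤ 3 * h * z l' := by
    by_contra! H
    have h1 : ∑ l, 3 * h * z l < ∑ _l : Line h, (1 : ℝ) :=
      Finset.sum_lt_sum_of_nonempty Finset.univ_nonempty fun l _ => H l
    rw [← Finset.mul_sum, hsum] at h1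
    simp only [Finset.sum_const, Finset.card_univ, Fintype.card_sum, Fintype.card_fin,
      nsmul_eq_mul] at h1
    push_cast at h1
    linarith
  have hp : 0 < ∏ l, z l := Finset.prod_pos fun l _ => hz l
  have hexp : Real.exp (-(1 / 2) * (Real.log (z l') - Real.log (z l)))
      ≤ (3 * h) ^ (1 / 2 : ℝ) * (⨅ l, z l) ^ (1 / 2 : ℝ) := by
    have hh' : (0 : ℝ) < 3 * h := by positivity
    rw [← hl, Real.rpow_def_of_pos hh', Real.rpow_def_of_pos (hz l), ← Real.exp_add,
      Real.exp_le_exp]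
    have := Real.log_le_log one_pos hl'
    rw [Real.log_one, Real.log_mul hh'.ne' (hz l').ne'] at this
    linarith
  rw [hI m hm z hz, le_div_iff₀ hp]
  calc ‖∑ P with IsPairing P, κ P * (G.K P z : ℂ) * A P (G.lineCoeff z)
          / (-(G.excessPower z : ℂ)) ^ (h - P.card)‖ * ∏ l, z l
      ≤ (∑ P with IsPairing P, ‖κ P‖ * (|G.K P z| * ‖A P (G.lineCoeff z)‖
          / G.excessPower z ^ (h - P.card))) * ∏ l, z l := by
        gcongr
        refine (norm_sum_le _ _).trans (Finset.sum_le_sum fun P _ => le_of_eq ?_)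
        rw [norm_div, norm_mul, norm_mul, norm_pow, norm_neg, Complex.norm_real, Complex.norm_real,
          Real.norm_eq_abs, Real.norm_of_nonneg (G.excessPower_nonneg hz)]
        ring
    _ ≤ ∑ P with IsPairing P, ‖κ P‖ * C P
          * Real.exp (-(1 / 2) * (Real.log (z l') - Real.log (z l))) := by
        rw [Finset.sum_mul]
        refine Finset.sum_le_sum fun P hP => ?_
        rw [mul_assoc, mul_assoc]
        exact mul_le_mul_of_nonneg_left (hC P (Finset.mem_filter.1 hP).2 z hz l l') (norm_nonneg _)
    _ ≤ _ := by
        rw [← Finset.sum_mul, mul_assoc]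
        exact mul_le_mul_of_nonneg_left hexp hs

-- Supplies measurability. The moment is defined by a choice for each `z`; its continuity comes from
-- the identification with a C¹ function of `lineCoeff z`.
open Classical in
theorem continuousOn_integrand (G : VertexGraph h) (hh : 1 ≤ h) (hγ : IsDirac γ)
    (κ : Finset (Fin (2 * h) × Fin (2 * h)) → ℂ) {m : ℝ} (hm : 0 < m) :
    ContinuousOn (G.integrand m γ κ) {z | ∀ l, 0 < z l} := by
  obtain ⟨A, hA, hI⟩ := G.exists_integrand_eq hh hγ κ
  refine ContinuousOn.congr ?_ fun z hz => hI m hm z hz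
  refine continuousOn_finsetSum _ fun P hP => ?_
  have hK : ContinuousOn (G.K P) {z | ∀ l, 0 < z l} := by
    refine ContinuousOn.mul (ContinuousOn.div continuousOn_const
      (G.continuous_D.pow 2).continuousOn fun z hz => (pow_pos (G.D_pos hz) 2).ne') ?_
    exact continuousOn_finsetProd _ fun a _ => ContinuousOn.div (G.continuous_B _ _).continuousOn
      G.continuous_D.continuousOn fun z hz => (G.D_pos hz).ne'
  refine ContinuousOn.div ?_ ?_ fun z hz => pow_ne_zero _ (neg_ne_zero.2 ?_)
  · exact (continuousOn_const.mul (Complex.continuous_ofReal.comp_continuousOn hK)).mul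
      ((hA P (Finset.mem_filter.1 hP).2).1.continuous.comp_continuousOn G.continuousOn_lineCoeff)
  · exact (Complex.continuous_ofReal.comp_continuousOn G.continuousOn_excessPower).neg.pow _
  · exact_mod_cast (G.excessPower_pos hh hz).ne'

end VertexGraph
end QED

/-! ### Integrability over the simplex -/

namespace QED

section simplex

variable {ι : Type*} [Fintype ι]

theorem integrableOn_prod_rpow {a : ℝ} (ha : 0 < a) :
    IntegrableOn (fun x : ι → ℝ => ∏ i, x i ^ (a - 1)) (Set.univ.pi fun _ => Set.Ioo 0 1) := by
  rw [IntegrableOn, volume_pi, Measure.restrict_pi_pi]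
  refine Integrable.fintype_prod (f := fun _ x => x ^ (a - 1)) fun i => ?_
  exact (intervalIntegral.integrableOn_Ioo_rpow_iff one_pos).2 (by linarith)

variable [DecidableEq ι]

/-- Negation of the sum of the coordinates, stored in the coordinate `j`. -/
def reflectLinear (j : ι) : (ι → ℝ) →ₗ[ℝ] (ι → ℝ) where
  toFun x := Function.update x j (-∑ i, x i)
  map_add' x y := by
    ext i
    by_cases hi : i = j
    · subst hi; simp [Finset.sum_add_distrib]; ring
    · simp [hi]
  map_smul' a x := by
    ext i
    by_cases hi : i = j
    · subst hi; simp [Finset.mul_sum]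
    · simp [hi]

theorem sum_update_eq (j : ι) (x : ι → ℝ) (b : ℝ) :
    ∑ i, Function.update x j b i = b + ∑ i, x i - x j := by
  rw [Finset.sum_update_of_mem (Finset.mem_univ j), ← Finset.sum_sdiff (Finset.subset_univ {j}),
    Finset.sum_singleton]
  ring

theorem reflectLinear_comp (j : ι) : reflectLinear j ∘ₗ reflectLinear j = LinearMap.id := by
  refine LinearMap.ext fun x => ?_
  change Function.update (Function.update x j (-∑ i, x i)) j
    (-∑ i, Function.update x j (-∑ i, x i) i) = x
  rw [sum_update_eq, Function.update_idem]
  simp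

/-- The exchange of the coordinate `j` with the eliminated one. -/
def reflect (j : ι) (x : ι → ℝ) : ι → ℝ := Function.update x j (1 - ∑ i, x i)

/-- The linear part is an involution, so its determinant is `±1`; the rest is a translation. -/
theorem measurePreserving_reflect (j : ι) : MeasurePreserving (reflect (ι := ι) j) volume volume := by
  have h1 : LinearMap.det (reflectLinear j) * LinearMap.det (reflectLinear j) = 1 := by
    rw [← LinearMap.det_comp, reflectLinear_comp, LinearMap.det_id]
  have h2 : |LinearMap.det (reflectLinear j)| = 1 := by
    rw [← abs_mul_abs_self] at h1
    nlinarith [abs_nonneg (LinearMap.det (reflectLinear j))]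
  have h3 : MeasurePreserving (reflectLinear j) volume volume := by
    refine ⟨(LinearMap.continuous_of_finiteDimensional _).measurable, ?_⟩
    rw [Real.map_linearMap_volume_pi_eq_smul_volume_pi, abs_inv, h2]
    · simp
    · intro h0; rw [h0] at h2; simp at h2
  have h4 : reflect j = (fun x => (Pi.single j 1 : ι → ℝ) + x) ∘ reflectLinear j := by
    funext x i
    by_cases hi : i = j
    · subst hi; simp [reflect, reflectLinear]; ring
    · simp [reflect, reflectLinear, hi]
  rw [h4]
  exact (measurePreserving_add_left volume _).comp h3

end simplex

/-- Pointwise bound by products over all lines but one. -/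
theorem rpow_iInf_div_prod_le {L : Type*} [Fintype L] [Nonempty L] [DecidableEq L] {z : L → ℝ}
    (hz : ∀ l, 0 < z l) (hsum : ∑ l, z l = 1) :
    (⨅ l, z l) ^ (1 / 2 : ℝ) / ∏ l, z l ≤ Fintype.card L *
      ∑ j, ∏ l ∈ Finset.univ.erase j, z l ^ ((2 * Fintype.card L : ℝ)⁻¹ - 1) := by
  set n : ℝ := (Fintype.card L : ℝ) with hn
  have hn1 : 1 ≤ n := by rw [hn]; exact_mod_cast Fintype.card_pos
  set a : ℝ := (2 * n)⁻¹ with ha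
  have ha0 : 0 < a := by positivity
  have hmin : 0 ≤ ⨅ l, z l := Real.iInf_nonneg fun l => (hz l).le
  -- With `a = 1/(2n)` the square root of the minimum is a product of `n` factors `min ^ a`, one for
  -- each line, and softens every `1 / z_l` to `z_l ^ (a - 1)`.
  have h1 : (⨅ l, z l) ^ (1 / 2 : ℝ) ≤ ∏ l, z l ^ a := by
    have e : (1 / 2 : ℝ) = a * (Fintype.card L : ℕ) := by rw [ha, ← hn]; field_simp
    rw [e, Real.rpow_mul_natCast hmin, ← Finset.card_univ, ← Finset.prod_const]
    exact Finset.prod_le_prod (fun l _ => Real.rpow_nonneg hmin _) fun l _ =>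
      Real.rpow_le_rpow hmin (ciInf_le (Set.finite_range z).bddBelow l) ha0.le
  have hp : 0 < ∏ l, z l := Finset.prod_pos fun l _ => hz l
  have h2 : (⨅ l, z l) ^ (1 / 2 : ℝ) / ∏ l, z l ≤ ∏ l, z l ^ (a - 1) := by
    rw [div_le_iff₀ hp, ← Finset.prod_mul_distrib]
    refine h1.trans (le_of_eq (Finset.prod_congr rfl fun l _ => ?_))
    rw [Real.rpow_sub_one (hz l).ne', div_mul_cancel₀ _ (hz l).ne']
  obtain ⟨j, hj⟩ : ∃ j, 1 ≤ n * z j := by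
    by_contra! H
    have h3 : ∑ l, n * z l < ∑ _l : L, (1 : ℝ) :=
      Finset.sum_lt_sum_of_nonempty Finset.univ_nonempty fun l _ => H l
    rw [← Finset.mul_sum, hsum] at h3
    simp [hn] at h3
  have hnn : ∀ j, 0 ≤ ∏ l ∈ Finset.univ.erase j, z l ^ (a - 1) := fun j =>
    Finset.prod_nonneg fun l _ => Real.rpow_nonneg (hz l).le _
  -- The line with `z_j ≥ 1/n` can be spared: its factor is at most `n ^ (1 - a) ≤ n`. Then there
  -- are only as many singular factors as free coordinates.
  have h4 : z j ^ (a - 1) ≤ n := by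
    have ha1 : a ≤ 1 := by
      rw [ha]; exact inv_le_one_of_one_le₀ (by linarith)
    have h5 : n⁻¹ ≤ z j := by rwa [inv_le_iff_one_le_mul₀' (by linarith)]
    calc z j ^ (a - 1) ≤ (n⁻¹) ^ (a - 1) :=
          Real.rpow_le_rpow_of_nonpos (by positivity) h5 (by linarith)
      _ = n ^ (1 - a) := by
          rw [Real.inv_rpow (by linarith), ← Real.rpow_neg (by linarith), neg_sub]
      _ ≤ n ^ (1 : ℝ) := Real.rpow_le_rpow_of_exponent_le hn1 (by linarith)
      _ = n := Real.rpow_one n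
  refine h2.trans ?_
  rw [← Finset.mul_prod_erase _ _ (Finset.mem_univ j)]
  exact mul_le_mul h4 (Finset.single_le_sum (f := fun j => ∏ l ∈ Finset.univ.erase j, z l ^ (a - 1))
    (fun j _ => hnn j) (Finset.mem_univ j)) (hnn j) (by linarith)

section

variable {h : ℕ}

theorem simplexPoint_self (e : Line h) (x : {l : Line h // l ≠ e} → ℝ) :
    simplexPoint e x e = 1 - ∑ j, x j := dif_pos rfl

theorem simplexPoint_of_ne {e l : Line h} (hl : l ≠ e) (x : {l : Line h // l ≠ e} → ℝ) :
    simplexPoint e x l = x ⟨l, hl⟩ := dif_neg hl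

theorem prod_erase_simplexPoint (e : Line h) (x : {l : Line h // l ≠ e} → ℝ) (f : ℝ → ℝ) :
    ∏ l ∈ Finset.univ.erase e, f (simplexPoint e x l) = ∏ j, f (x j) := by
  rw [Finset.prod_subtype (p := fun l => l ≠ e) (Finset.univ.erase e) (by simp)]
  exact Finset.prod_congr rfl fun j _ => by rw [simplexPoint_of_ne j.2]

theorem sum_simplexPoint (e : Line h) (x : {l : Line h // l ≠ e} → ℝ) :
    ∑ l, simplexPoint e x l = 1 := by
  have h1 : ∑ l ∈ Finset.univ.erase e, simplexPoint e x l = ∑ j, x j := by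
    rw [Finset.sum_subtype (p := fun l => l ≠ e) (Finset.univ.erase e) (by simp)]
    exact Finset.sum_congr rfl fun j _ => simplexPoint_of_ne j.2 x
  rw [← Finset.add_sum_erase _ _ (Finset.mem_univ e), h1, simplexPoint_self, sub_add_cancel]

theorem simplexPoint_pos {e : Line h} {x : {l : Line h // l ≠ e} → ℝ} (hx : ∀ l, 0 < x l)
    (hx' : ∑ l, x l < 1) (l : Line h) : 0 < simplexPoint e x l := by
  by_cases hl : l = e
  · subst hl; rw [simplexPoint_self]; linarith
  · rw [simplexPoint_of_ne hl]; exact hx _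

theorem continuous_simplexPoint (e : Line h) : Continuous (simplexPoint e) := by
  refine continuous_pi fun l => ?_
  by_cases hl : l = e
  · subst hl; simp only [simplexPoint_self]; fun_prop
  · simp only [simplexPoint_of_ne hl]; fun_prop

theorem simplexPoint_reflect {e : Line h} (j : {l : Line h // l ≠ e})
    (x : {l : Line h // l ≠ e} → ℝ) (l : Line h) :
    simplexPoint e (reflect j x) l = simplexPoint e x (Equiv.swap e j l) := by
  by_cases hl : l = e
  · subst hl
    rw [Equiv.swap_apply_left, simplexPoint_self, simplexPoint_of_ne j.2, reflect, sum_update_eq]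
    ring
  · by_cases hj : l = j
    · subst hj
      rw [Equiv.swap_apply_right, simplexPoint_self, simplexPoint_of_ne j.2, reflect]
      simp
    · rw [Equiv.swap_apply_of_ne_of_ne hl hj, simplexPoint_of_ne hl, simplexPoint_of_ne hl, reflect,
        Function.update_of_ne]
      exact fun H => hj (congrArg Subtype.val H)

/-- The open simplex. -/
def openSimplex (e : Line h) : Set ({l : Line h // l ≠ e} → ℝ) :=
  {x | (∀ l, 0 < x l) ∧ ∑ l, x l < 1}

theorem measurableSet_openSimplex (e : Line h) : MeasurableSet (openSimplex e) := by
  refine IsOpen.measurableSet ?_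
  have h1 : IsOpen {x : {l : Line h // l ≠ e} → ℝ | ∀ l, 0 < x l} := by
    simp only [Set.ofPred_forall]
    exact isOpen_iInter_of_finite fun l => isOpen_lt continuous_const (continuous_apply l)
  exact h1.inter (isOpen_lt (f := fun x : {l : Line h // l ≠ e} → ℝ => ∑ l, x l) (by fun_prop)
    continuous_const)

theorem openSimplex_subset (e : Line h) :
    openSimplex e ⊆ Set.univ.pi fun _ => Set.Ioo (0 : ℝ) 1 := by
  intro x hx l _
  exact ⟨hx.1 l, (Finset.single_le_sum (fun l _ => (hx.1 l).le) (Finset.mem_univ l)).trans_lt hx.2⟩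

theorem reflect_mem_openSimplex {e : Line h} (j : {l : Line h // l ≠ e})
    {x : {l : Line h // l ≠ e} → ℝ} (hx : x ∈ openSimplex e) : reflect j x ∈ openSimplex e := by
  refine ⟨fun l => ?_, ?_⟩
  · rw [← simplexPoint_of_ne l.2 (reflect j x), simplexPoint_reflect]
    exact simplexPoint_pos hx.1 hx.2 _
  · have := simplexPoint_pos hx.1 hx.2 (Equiv.swap e j e)
    rw [← simplexPoint_reflect, simplexPoint_self] at this
    linarith

/-- For `j = e` the product runs over the free coordinates and is integrable on the whole cube.
Otherwise the reflection exchanging `z_j` with the eliminated parameter preserves the measure and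
the simplex, and reduces to that case. -/
theorem integrableOn_prod_erase {a : ℝ} (ha : 0 < a) (e j : Line h) :
    IntegrableOn (fun x => ∏ l ∈ Finset.univ.erase j, simplexPoint e x l ^ (a - 1))
      (openSimplex e) volume := by
  have h1 := integrableOn_prod_rpow (ι := {l : Line h // l ≠ e}) ha
  have hbox : MeasurableSet (Set.univ.pi fun _ : {l : Line h // l ≠ e} => Set.Ioo (0 : ℝ) 1) :=
    MeasurableSet.univ_pi fun _ => measurableSet_Ioo
  by_cases hj : j = e
  · subst hj
    refine (h1.mono_set (openSimplex_subset j)).congr_fun (fun x _ => ?_)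
      (measurableSet_openSimplex j)
    exact (prod_erase_simplexPoint j x fun t => t ^ (a - 1)).symm
  · have h2 := ((measurePreserving_reflect (⟨j, hj⟩ : {l : Line h // l ≠ e})).integrable_comp_of_integrable
      ((integrable_indicator_iff hbox).2 h1)).integrableOn (s := openSimplex e)
    refine h2.congr_fun (fun x hx => ?_) (measurableSet_openSimplex e)
    have h3 := openSimplex_subset e (reflect_mem_openSimplex ⟨j, hj⟩ hx)
    rw [Function.comp_apply, Set.indicator_of_mem h3]
    rw [← prod_erase_simplexPoint e _ fun t => t ^ (a - 1)]
    simp only [simplexPoint_reflect]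
    refine Finset.prod_equiv (Equiv.swap e j) (fun l => ?_) fun l _ => rfl
    simp only [Finset.mem_erase, Finset.mem_univ, and_true, ne_eq]
    rw [Equiv.swap_apply_eq_iff, Equiv.swap_apply_right]

theorem VertexGraph.integrableOn_integrand {γ : Fin 4 → SpinorMatrix} (G : VertexGraph h) (hh : 1 ≤ h)
    (hG : G.NoUVDivergentSubgraphs) (hγ : IsDirac γ)
    (κ : Finset (Fin (2 * h) × Fin (2 * h)) → ℂ) {m : ℝ} (hm : 0 < m) (e : Line h) :
    IntegrableOn (fun x => G.integrand m γ κ (simplexPoint e x)) (openSimplex e) volume := by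
  obtain ⟨C, hC0, hC⟩ := G.exists_integrand_bound hh hG hγ κ
  have hne : Nonempty (Line h) := ⟨Sum.inr ⟨0, hh⟩⟩
  have ha : (0 : ℝ) < (2 * Fintype.card (Line h) : ℝ)⁻¹ := by
    have : (0 : ℝ) < Fintype.card (Line h) := by exact_mod_cast Fintype.card_pos
    positivity
  have hint : IntegrableOn (fun x => C * (Fintype.card (Line h) *
      ∑ j, ∏ l ∈ Finset.univ.erase j, simplexPoint e x l ^ ((2 * Fintype.card (Line h) : ℝ)⁻¹ - 1)))
      (openSimplex e) volume :=
    ((integrable_finsetSum _ fun j _ => integrableOn_prod_erase ha e j).const_mul _).const_mul _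
  refine Integrable.mono' hint ?_ ?_
  · refine ContinuousOn.aestronglyMeasurable ?_ (measurableSet_openSimplex e)
    exact (G.continuousOn_integrand hh hγ κ hm).comp (continuous_simplexPoint e).continuousOn
      fun x hx => simplexPoint_pos hx.1 hx.2
  · refine (ae_restrict_iff' (measurableSet_openSimplex e)).2
      (Filter.Eventually.of_forall fun x hx => ?_)
    have hz := simplexPoint_pos hx.1 hx.2
    refine (hC m hm _ hz (sum_simplexPoint e x)).trans ?_
    rw [mul_div_assoc]
    exact mul_le_mul_of_nonneg_left (rpow_iInf_div_prod_le hz (sum_simplexPoint e x)) hC0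

end

end QED

theorem mainTheorem2 (h : ℕ) (hh : 1 ≤ h) (G : QED.VertexGraph h)
    (hG : G.NoUVDivergentSubgraphs)
    (γ : Fin 4 → QED.SpinorMatrix) (hγ : QED.IsDirac γ)
    (κ : Finset (Fin (2 * h) × Fin (2 * h)) → ℂ) :
    (∀ m : ℝ, 0 < m → ∀ z : QED.Line h → ℝ, (∀ l, 0 < z l) →
      G.D z ≠ 0 ∧ G.W m z ≠ 0 ∧
      ∀ P, QED.VertexGraph.IsPairing P →
        ∃! a : ℂ, QED.HasMagneticMoment m γ (G.amplitude m γ P z) a) ∧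
    (∃ C : ℝ, ∀ m : ℝ, 0 < m → ∀ z : QED.Line h → ℝ, (∀ l, 0 < z l) → ∑ l, z l = 1 →
      ‖G.integrand m γ κ z‖ ≤ C * (⨅ l, z l) ^ (1 / 2 : ℝ) / ∏ l, z l) ∧
    (∀ m : ℝ, 0 < m → ∀ e : QED.Line h,
      IntegrableOn (fun x : {l : QED.Line h // l ≠ e} → ℝ =>
          G.integrand m γ κ (QED.simplexPoint e x))
        {x | (∀ l, 0 < x l) ∧ ∑ l, x l < 1} volume) := by
  refine ⟨fun m hm z hz => ⟨(G.D_pos hz).ne', ?_, fun P hP => ?_⟩, ?_, fun m hm e =>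
    G.integrableOn_integrand hh hG hγ κ hm e⟩
  · rw [G.W_eq m hz]
    exact neg_ne_zero.2 (mul_pos (pow_pos hm 2) (G.excessPower_pos hh hz)).ne'
  · obtain ⟨A, -, -, hA⟩ := G.exists_moment hγ hP
    exact ⟨_, hA m hm z, fun a ha => hγ.hasMagneticMoment_unique hm ha (hA m hm z)⟩
  · obtain ⟨C, -, hC⟩ := G.exists_integrand_bound hh hG hγ κ
    exact ⟨C, hC⟩
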